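/- Consider an M/G/1 queue with vacations. Customers arrive according to a Poisson process with rate $\lambda>0$. Service times are i.i.d. copies of a non-negative random variable $B$ with $E[B^2]<\infty$ and Laplace–Stieltjes transform $\tilde B(s)=E[e^{-sB}]$, and they are independent of the arrivals and of the vacations. Put $\rho=\lambda E[B]$ and assume $\rho<1$. Right after a service completion that leaves $i\ge 0$ customers behind, the server goes on vacation with probability $\psi(i)=\frac1{i+1}$ and otherwise immediately starts the next service; after a vacation the next service starts. The length of a vacation may depend on the number $i$ of customers present at its beginning, on the arrivals during the vacation and on external randomness (drawn independently for each vacation), but not on future arrivals. Let $X_i$ be the number of arrivals during a vacation that begins with $i$ customers; assume $P(X_0=0)=0$ and $E[X_i^2]<\infty$ for all $i$. Assume moreover (Scenario 1) that $X_i\overset{d}{=}X$ for all $i\ge1$, where $P(X=0)<1$, and that either $X_0\overset{d}{=}X$ and $P(X=0)=0$, or $X_0>_{\rm st}X$ and $P(X=0)>0$. Here $W_1>_{\rm st}W_2$ means $P(W_1\le w)\le P(W_2\le w)$ for all $w$, with strict inequality for some $w$. For a random variable $W$ with values in $\{0,1,2,\dots\}$ write $G_W(r)=E[r^W]$, $r\in[0,1]$.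 For $r\in[0,1)$ put $$Y(r)=\frac{\tilde B(\lambda(1-r))\,(1-G_X(r))}{\tilde B(\lambda(1-r))-r},\qquad K(r)=\frac{\tilde B(\lambda(1-r))\,(G_X(r)-G_{X_0}(r))}{\tilde B(\lambda(1-r))-r},$$ with the values (limits) $Y(1)=\frac{E[X]}{1-\rho}$ and $K(1)=\frac{E[X_0]-E[X]}{1-\rho}$ at $1$, and let $\alpha(r)=\int_r^1\frac{Y(x)}{x}\,dx$ for $r\in(0,1]$. Then the number $L(t)$ of customers in the system at time $t$ has a stationary distribution: there is a random variable $L$ with values in $\{0,1,2,\dots\}$ such that, for every number $k$ of customers left behind by a service completion at time $0$ and every $j$, $\lim_{t\to\infty}\frac1t\int_0^t P(L(s)=j)\,ds=P(L=j)$. Its generating function is given as follows, where all integrals converge. (i) If $X_0\overset{d}{=}X$, then $$G_L(r)=\frac{(1-\rho)\,Y(r)}{r\,E[X]}\,e^{-\alpha(r)}.$$ (ii) If $X_0>_{\rm st}X$, then $$G_L(r)=P(L=0)\Big(K(r)+\frac{Y(r)}{r}\,e^{-\alpha(r)}\int_0^rK(y)\,e^{\alpha(y)}\,dy\Big),$$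 with $$P(L=0)=\frac{1}{K(1)+Y(1)\int_0^1K(x)\,e^{\alpha(x)}\,dx}.$$ Both formulas for $G_L$ hold for all $r\in(0,1]$, and for $r=0$ with the right-hand side read as its limit for $r\downarrow0$. -/

import Mathlib

open MeasureTheory ProbabilityTheory Filter Topology Set

noncomputable section

namespace VacQueue

/-! ### Arrival epochs -/

/-- A genuine sequence of arrival epochs after time `0`: positive, strictly increasing, and with
finitely many epochs in every bounded interval. -/
def IsArrivalSeq (a : ℕ → ℝ) : Prop :=
  0 < a 0 ∧ StrictMono a ∧ Tendsto a atTop atTop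

/-- The arrival epochs `g 0, g 0 + g 1, …` belonging to interarrival times `g`. -/
def epochs (g : ℕ → ℝ) (j : ℕ) : ℝ := ∑ i ∈ Finset.range (j + 1), g i

/-- The number of arrivals up to and including time `t`. -/
def arrivalCount (a : ℕ → ℝ) (t : ℝ) : ℕ := {j : ℕ | a j ≤ t}.ncard

/-- The arrivals strictly after time `d`, with time measured from `d` on. -/
def arrivalsAfter (a : ℕ → ℝ) (d : ℝ) (j : ℕ) : ℝ := a (arrivalCount a d + j) - d

/-- The law of the interarrival times of a Poisson process with rate `lam`:
independent and exponentially distributed. -/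
def poissonGaps (lam : ℝ) : Measure (ℕ → ℝ) := Measure.infinitePi fun _ => expMeasure lam

/-! ### Vacations -/

/-- A vacation discipline. A vacation that begins with `i` customers in the system lasts for the
time `length i u a`, where `u` is external randomness and `a` are the arrival epochs, measured
from the beginning of the vacation. The length does not depend on future arrivals: if it is
`v` for the arrival epochs `a`, then it is also `v` for all arrival epochs that agree with `a` on
`[0, v]`. -/
structure VacationRule (Θ : Type*) [MeasurableSpace Θ] where
  length : ℕ → Θ → (ℕ → ℝ) → ℝ
  measurable_length : ∀ i, Measurable fun p : Θ × (ℕ → ℝ) => length i p.1 p.2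
  length_nonneg : ∀ i u a, 0 ≤ length i u a
  nonanticipating : ∀ i u a a', IsArrivalSeq a → IsArrivalSeq a' →
    (∀ t ≤ length i u a, arrivalCount a' t = arrivalCount a t) → length i u a' = length i u a

variable {Θ : Type*} [MeasurableSpace Θ]

/-- The law of `X_i`, the number of (Poisson) arrivals during a vacation that begins with `i`
customers in the system; its mass at `m` is `α(i, m)`. -/
def vacationArrivals (lam : ℝ) (θ : Measure Θ) (R : VacationRule Θ) (i : ℕ) : Measure ℕ :=
  (θ.prod (poissonGaps lam)).map fun p =>
    arrivalCount (epochs p.2) (R.length i p.1 (epochs p.2))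

/-! ### The M/G/1 queue with vacations -/

/-- The sample space of the queue: interarrival times, service times, external randomness of the
vacations, and uniform variables that decide on the de-activations. -/
abbrev Sample (Θ : Type*) : Type _ := (ℕ → ℝ) × (ℕ → ℝ) × (ℕ → Θ) × (ℕ → ℝ)

/-- The four sequences are independent, and each of them is independent and identically
distributed: exponential interarrival times with rate `lam`, service times with law `β`,
vacation randomness with law `θ`, and uniform variables on `[0, 1]`. -/
def sampleLaw (lam : ℝ) (β : Measure ℝ) (θ : Measure Θ) : Measure (Sample Θ) :=
  (poissonGaps lam).prod ((Measure.infinitePi fun _ => β).prod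
    ((Measure.infinitePi fun _ => θ).prod
      (Measure.infinitePi fun _ => (volume : Measure ℝ).restrict (Icc 0 1))))

/-- The epoch of the `n`-th service completion, where the system starts at time `0`, just after a
service completion that leaves `k` customers behind. The `n`-th completion, at time `d`, leaves `z`
customers behind; the server then becomes inactive with probability `ψ z`, in which case a
vacation takes place, and stays active otherwise; then the next service begins. -/
def departure (ψ : ℕ → ℝ) (R : VacationRule Θ) (k : ℕ) (ω : Sample Θ) : ℕ → ℝ
  | 0 => 0
  | n + 1 =>
    let d := departure ψ R k ω n
    let z := k + arrivalCount (epochs ω.1) d - n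
    let vacation :=
      if ω.2.2.2 n < ψ z then R.length z (ω.2.2.1 n) (arrivalsAfter (epochs ω.1) d) else 0
    d + vacation + ω.2.1 n

/-- The number `L(t)` of customers in the system at time `t`, with `L(0-) = k` for the start just
after a completion: the initial customers and the arrivals up to `t` without the customers
whose services are completed by time `t`. -/
def customers (ψ : ℕ → ℝ) (R : VacationRule Θ) (k : ℕ) (t : ℝ) (ω : Sample Θ) : ℕ :=
  k + arrivalCount (epochs ω.1) t - {n : ℕ | 1 ≤ n ∧ departure ψ R k ω n ≤ t}.ncard

/-- `π` is the stationary law of the number of customers: from every initial number `k` of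
customers, the long-run average of `P(L(t) = j)` is `π {j}`. (If `P(L(t) = j)` has a limit as `t → ∞`,
it is this one; for lattice distributed service and vacation times there may be no limit.) -/
def IsStationaryLaw (lam : ℝ) (β : Measure ℝ) (θ : Measure Θ) (ψ : ℕ → ℝ) (R : VacationRule Θ)
    (π : Measure ℕ) : Prop :=
  IsProbabilityMeasure π ∧ ∀ k j : ℕ,
    Tendsto (fun t : ℝ =>
        (∫ s in (0 : ℝ)..t, (sampleLaw lam β θ).real {ω | customers ψ R k s ω = j}) / t)
      atTop (𝓝 (π.real {j}))

/-! ### Stochastic order and generating functions -/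

/-- A variable with law `μ` is stochastically strictly larger than one with law `ν`. -/
def StStrictlyLarger (μ ν : Measure ℕ) : Prop :=
  (∀ w, μ.real (Iic w) ≤ ν.real (Iic w)) ∧ ∃ w, μ.real (Iic w) < ν.real (Iic w)

/-- Equal vacation distributions: `X_i` has the law of `X` for all `i ≥ 1`, where `X` is
stochastically strictly larger than `0`, and either `X_0` has the law of `X` and `P(X = 0) = 0`, or
`X_0` is stochastically strictly larger than `X` and `P(X = 0) > 0`. Here `ξ i` is the law of
`X_i` and `X` stands for its own law. -/
def EqualVacations (ξ : ℕ → Measure ℕ) (X : Measure ℕ) : Prop :=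
  (∀ i, 1 ≤ i → ξ i = X) ∧ StStrictlyLarger X (Measure.dirac 0) ∧
    ((ξ 0 = X ∧ X.real {0} = 0) ∨ (StStrictlyLarger (ξ 0) X ∧ 0 < X.real {0}))

/-- The generating function `G(r) = E[r ^ W]` of a variable `W` with law `μ`. -/
def genFun (μ : Measure ℕ) (r : ℝ) : ℝ := ∫ n, r ^ n ∂μ

/-- The mean of a variable with law `μ`. -/
def mean (μ : Measure ℕ) : ℝ := ∫ n, (n : ℝ) ∂μ

/-- The Laplace-Stieltjes transform of the service times. -/
def lst (β : Measure ℝ) (s : ℝ) : ℝ := ∫ x, Real.exp (-(s * x)) ∂β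

/-- The traffic intensity. -/
def load (lam : ℝ) (β : Measure ℝ) : ℝ := lam * ∫ x, x ∂β

/-- The function `Y`, with its limit `E[X] / (1 - ρ)` as value at `1`. -/
def Y (lam : ℝ) (β : Measure ℝ) (X : Measure ℕ) (r : ℝ) : ℝ :=
  if r = 1 then mean X / (1 - load lam β)
  else lst β (lam * (1 - r)) * (1 - genFun X r) / (lst β (lam * (1 - r)) - r)

/-- The function `K`, with its limit `(E[X_0] - E[X]) / (1 - ρ)` as value at `1`. -/
def K (lam : ℝ) (β : Measure ℝ) (X X₀ : Measure ℕ) (r : ℝ) : ℝ :=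
  if r = 1 then (mean X₀ - mean X) / (1 - load lam β)
  else lst β (lam * (1 - r)) * (genFun X r - genFun X₀ r) / (lst β (lam * (1 - r)) - r)

/-- `α(r) = ∫_r^1 Y(x) / x dx`. -/
def α (lam : ℝ) (β : Measure ℝ) (X : Measure ℕ) (r : ℝ) : ℝ :=
  ∫ x in r..1, Y lam β X x / x

end VacQueue

end

/-!
# The stationary law of an M/G/1 queue with vacations

Write `d_n` for the epochs of the service completions and `z_n` for the numbers of customers they
leave behind. The length of a cycle `[d_n, d_{n+1})` is a nonanticipating time for the arrivals
after `d_n`, so by the strong Markov property of the Poisson process (`strong_markov`, proved by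
splitting the probability space into pieces on which the time depends on finitely many interarrival
times only) what happens in a cycle depends on the past only through `z_n` (`lintegral_cycle`).
Ergodic theory of the embedded chain is avoided: everything is derived from the expected number
`v_t(z)` of completions up to time `t` that leave `z` customers behind (`visits`), through relations
that hold for every fixed `t` up to errors bounded in `t`.

* Completions that leave `j` behind and arrivals that find `j` present alternate, and Poisson
  arrivals see time averages (`lintegral_sum_arrivals`). Hence
  `v_t(j) = lam ∫₀ᵗ P(L(s) = j) ds + O(1)` (`visits_level_crossing`).
* The identity `z_{n+1} + 1 = z_n + (arrivals in the cycle)`, summed over the completions up to `t`,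
  gives `∑ v_t(z) r ^ z (r - κ_z(r)) = O(1)`, where `κ_z` is the generating function of the number of
  arrivals in a cycle (`visits_balance`).
* The cycles that begin up to `t` cover `[0, t]`, so that
  `lam t ≤ ∑ v_t(z) (ρ + ψ(z) E[X_z])` (`le_tsum_visits_mul`).

Let `q` be a limit of the averages `(1/t) ∫₀ᵗ P(L(s) = j) ds` along an ultrafilter; such limits exist
by compactness of `[0, 1]`. With `ψ(z) = 1/(z+1)` the balance becomes
`Q(r) = Y(r) R(r) / r + q₀ K(r)`, where `Q = ∑ q_z r ^ z` and `R` is its primitive with `R(0) = 0`,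
that is, a linear differential equation for `R`. Because `ψ` vanishes at infinity, mass that might
escape to infinity does not contribute to the third relation in the limit (`le_tsum_of_tendsto`),
which gives `1 - ρ ≤ E[X] R(1) + q₀ (E[X₀] - E[X])`. The right-hand side is `(1 - ρ) Q(1)` by the
balance at `r = 1`, so `Q(1) = 1`: no mass escapes (`IsLimitLaw.powSum_one`). This takes the place of
positive recurrence.

If `X₀` has the law of `X`, then `K = 0`, the equation is homogeneous and `R(1)` is known from
`Q(1) = 1`. Otherwise `P(X = 0) > 0`, so `Y(0) < 1`; then `e ^ α` is `O(r ^ (-y))` with `y < 1`, the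
constant of integration vanishes since `R(r) = O(r)` (`avgSum_mul_exp_eq`), and `Q(1) = 1` fixes
`q₀`. In both cases `q` is determined by `Y` and `K` alone. So all ultrafilter limits, for all initial
numbers of customers, agree; this is convergence (`exists_isLimitLaw_tendsto`).
-/

open scoped ENNReal

noncomputable section

namespace VacQueue

/-! ### Independent sequences -/

/-- The sequence `x 0, …, x (i - 1), y 0, y 1, …`. -/
def splice {E : Type*} (i : ℕ) (x y : ℕ → E) (j : ℕ) : E := if j < i then x j else y (j - i)

lemma measurable_splice {E : Type*} [MeasurableSpace E] (i : ℕ) :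
    Measurable fun p : (ℕ → E) × (ℕ → E) => splice i p.1 p.2 := by
  refine measurable_pi_lambda _ fun j => ?_
  unfold splice
  split_ifs <;> fun_prop

lemma map_splice_infinitePi {E : Type*} [MeasurableSpace E] (μ : Measure E)
    [IsProbabilityMeasure μ] (i : ℕ) :
    ((Measure.infinitePi fun _ : ℕ => μ).prod (Measure.infinitePi fun _ : ℕ => μ)).map
      (fun p => splice i p.1 p.2) = Measure.infinitePi fun _ : ℕ => μ := by
  refine Measure.eq_infinitePi _ fun s t ht => ?_
  rw [Measure.map_apply (measurable_splice i) (MeasurableSet.pi s.countable_toSet fun j _ => ht j)]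
  have h : (fun p : (ℕ → E) × (ℕ → E) => splice i p.1 p.2) ⁻¹' ((s : Set ℕ).pi t) =
      ((s.filter (· < i) : Finset ℕ) : Set ℕ).pi t ×ˢ
        (((s.filter (¬ · < i)).image (· - i) : Finset ℕ) : Set ℕ).pi fun j => t (j + i) := by
    ext p
    simp only [mem_preimage, Set.mem_pi, mem_prod, Finset.mem_coe, Finset.mem_filter,
      Finset.mem_image, splice]
    constructor
    · refine fun h => ⟨fun j hj => ?_, ?_⟩
      · have := h j hj.1
        rwa [if_pos hj.2] at this
      · rintro _ ⟨j, ⟨hj, hji⟩, rfl⟩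
        have := h j hj
        rw [if_neg hji] at this
        rwa [Nat.sub_add_cancel (not_lt.1 hji)]
    · rintro ⟨h1, h2⟩ j hj
      split_ifs with hji
      · exact h1 j ⟨hj, hji⟩
      · have := h2 (j - i) ⟨j, ⟨hj, hji⟩, rfl⟩
        rwa [Nat.sub_add_cancel (not_lt.1 hji)] at this
  rw [h, Measure.prod_prod, Measure.infinitePi_pi _ (fun j _ => ht j),
    Measure.infinitePi_pi _ (fun j _ => ht (j + i)), Finset.prod_image]
  · rw [← Finset.prod_filter_mul_prod_filter_not s (· < i)]
    congr 1
    refine Finset.prod_congr rfl fun j hj => ?_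
    rw [Nat.sub_add_cancel (not_lt.1 (Finset.mem_filter.1 hj).2)]
  · intro a ha b hb hab
    simp only [Finset.coe_filter, mem_ofPred_eq, not_lt] at ha hb
    simp only at hab
    omega

/-- In an i.i.d. sequence, the first `i` terms are independent of the others, which form a copy of
the whole sequence. -/
lemma lintegral_past_future {E : Type*} [MeasurableSpace E] (μ : Measure E)
    [IsProbabilityMeasure μ] (i : ℕ) (F : (ℕ → E) → (ℕ → E) → ℝ≥0∞)
    (hF : Measurable fun p : (ℕ → E) × (ℕ → E) => F p.1 p.2)
    (hpast : ∀ x x' y, (∀ j < i, x j = x' j) → F x y = F x' y) :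
    ∫⁻ x, F x (fun j => x (i + j)) ∂(Measure.infinitePi fun _ : ℕ => μ) =
      ∫⁻ x, ∫⁻ y, F x y ∂(Measure.infinitePi fun _ : ℕ => μ)
        ∂(Measure.infinitePi fun _ : ℕ => μ) := by
  have hm : Measurable fun x : ℕ → E => F x (fun j => x (i + j)) :=
    hF.comp (measurable_id.prodMk (measurable_pi_lambda _ fun j => measurable_pi_apply _))
  conv_lhs => rw [← map_splice_infinitePi μ i]
  rw [lintegral_map hm (measurable_splice i),
    ← lintegral_prod _ hF.aemeasurable]
  refine lintegral_congr fun p => ?_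
  have h2 : (fun j => splice i p.1 p.2 (i + j)) = p.2 := by
    funext j
    simp [splice]
  rw [h2]
  exact hpast _ _ _ fun j hj => by simp [splice, hj]

/-- One step of an i.i.d. sequence: the term with index `i` is independent of the first `i`
terms. -/
lemma lintegral_past_present {E : Type*} [MeasurableSpace E] (μ : Measure E)
    [IsProbabilityMeasure μ] (i : ℕ) (F : (ℕ → E) → E → ℝ≥0∞)
    (hF : Measurable fun p : (ℕ → E) × E => F p.1 p.2)
    (hpast : ∀ x x' y, (∀ j < i, x j = x' j) → F x y = F x' y) :
    ∫⁻ x, F x (x i) ∂(Measure.infinitePi fun _ : ℕ => μ) =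
      ∫⁻ x, ∫⁻ y, F x y ∂μ ∂(Measure.infinitePi fun _ : ℕ => μ) := by
  have h := lintegral_past_future μ i (fun x y => F x (y 0))
    (hF.comp (measurable_fst.prodMk ((measurable_pi_apply 0).comp measurable_snd)))
    (fun x x' y hx => hpast x x' _ hx)
  simp only [add_zero] at h
  rw [h]
  refine lintegral_congr fun x => ?_
  conv_rhs => rw [← Measure.infinitePi_map_eval (fun _ : ℕ => μ) 0]
  exact (lintegral_map (f := fun y => F x y) (hF.comp (measurable_const.prodMk measurable_id))
    (measurable_pi_apply 0)).symm

/-! ### The exponential law -/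

lemma lintegral_expMeasure (lam : ℝ) (f : ℝ → ℝ≥0∞) (hf : Measurable f) :
    ∫⁻ x, f x ∂(expMeasure lam) =
      ∫⁻ x in Ioi 0, ENNReal.ofReal (lam * Real.exp (-(lam * x))) * f x := by
  have h : expMeasure lam = volume.withDensity (exponentialPDF lam) := rfl
  have hm : Measurable (exponentialPDF lam) :=
    (measurable_exponentialPDFReal lam).ennreal_ofReal
  rw [h, lintegral_withDensity_eq_lintegral_mul _ hm hf, ← setLIntegral_congr Ioi_ae_eq_Ici.symm,
    ← lintegral_indicator measurableSet_Ici]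
  refine lintegral_congr fun x => ?_
  by_cases hx : 0 ≤ x
  · simp [hx, exponentialPDF_eq]
  · simp [hx, exponentialPDF_eq]

/-- The exponential law has no memory. -/
lemma lintegral_expMeasure_memoryless (lam c : ℝ) (hc : 0 ≤ c) (f : ℝ → ℝ≥0∞)
    (hf : Measurable f) :
    ∫⁻ x, (Ioi c).indicator (fun x => f (x - c)) x ∂(expMeasure lam) =
      ENNReal.ofReal (Real.exp (-(lam * c))) * ∫⁻ x, f x ∂(expMeasure lam) := by
  have hm : Measurable ((Ioi c).indicator fun x => f (x - c)) :=
    (hf.comp (measurable_id.sub_const c)).indicator measurableSet_Ioi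
  rw [lintegral_expMeasure lam _ hm, lintegral_expMeasure lam f hf, ← lintegral_const_mul _ (by fun_prop),
    ← lintegral_indicator measurableSet_Ioi, ← lintegral_indicator measurableSet_Ioi]
  conv_rhs => rw [← lintegral_sub_right_eq_self _ c]
  refine lintegral_congr fun x => ?_
  by_cases hx : c < x
  · have h0 : 0 < x := hc.trans_lt hx
    have e : lam * Real.exp (-(lam * x)) =
        Real.exp (-(lam * c)) * (lam * Real.exp (-(lam * (x - c)))) := by
      rw [mul_left_comm, ← Real.exp_add]
      ring_nf
    simp [indicator, hx, h0, e, ENNReal.ofReal_mul (Real.exp_pos _).le, mul_assoc]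
  · simp [indicator, hx]

lemma expMeasure_Ioi {lam c : ℝ} (hlam : 0 < lam) (hc : 0 ≤ c) :
    expMeasure lam (Ioi c) = ENNReal.ofReal (Real.exp (-(lam * c))) := by
  have := isProbabilityMeasure_expMeasure hlam
  have h := lintegral_expMeasure_memoryless lam c hc (fun _ => 1) measurable_const
  simpa [lintegral_indicator measurableSet_Ioi] using h

/-! ### Counting arrivals -/

lemma lt_ncard_iff_mem {S : Set ℕ} (hS : IsLowerSet S) (hfin : S.Finite) (i : ℕ) :
    i < S.ncard ↔ i ∈ S := by
  obtain ⟨m, rfl⟩ : ∃ m, S = Iio m := by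
    have hne : Sᶜ.Nonempty := hfin.infinite_compl.nonempty
    refine ⟨sInf Sᶜ, ?_⟩
    ext j
    refine ⟨fun hj => ?_, fun hj => ?_⟩
    · by_contra h
      exact Nat.sInf_mem hne (hS (not_lt.1 h) hj)
    · by_contra h
      exact absurd (Nat.sInf_le (show j ∈ Sᶜ from h)) (not_le.2 hj)
  rw [ncard_eq_toFinset_card']
  simp

lemma IsArrivalSeq.lt_arrivalCount_iff {a : ℕ → ℝ} (ha : IsArrivalSeq a) {i : ℕ} {t : ℝ} :
    i < arrivalCount a t ↔ a i ≤ t := by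
  have h := lt_ncard_iff_mem (S := {j : ℕ | a j ≤ t})
    (fun j i hij (hj : a j ≤ t) => (ha.2.1.monotone hij).trans hj) ?_ i
  · exact h
  · obtain ⟨m, hm⟩ := (ha.2.2.eventually_gt_atTop t).exists
    refine (finite_Iio m).subset fun j (hj : a j ≤ t) => ?_
    by_contra h
    exact absurd (ha.2.1.monotone (not_lt.1 h)) (not_le.2 (hj.trans_lt hm))

lemma IsArrivalSeq.arrivalCount_mono {a : ℕ → ℝ} (ha : IsArrivalSeq a) :
    Monotone (arrivalCount a) := by
  intro s t hst
  by_contra! h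
  exact lt_irrefl _ (ha.lt_arrivalCount_iff.2 ((ha.lt_arrivalCount_iff.1 h).trans hst))

lemma IsArrivalSeq.pos {a : ℕ → ℝ} (ha : IsArrivalSeq a) (i : ℕ) : 0 < a i :=
  ha.1.trans_le (ha.2.1.monotone (Nat.zero_le i))

lemma IsArrivalSeq.arrivalCount_eq_of {a : ℕ → ℝ} (ha : IsArrivalSeq a) {t : ℝ} {c : ℕ}
    (h : ∀ i, i < c ↔ a i ≤ t) : arrivalCount a t = c := by
  refine le_antisymm ?_ ?_
  · by_contra! hc
    exact lt_irrefl _ ((h c).2 (ha.lt_arrivalCount_iff.1 hc))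
  · by_contra! hc
    exact lt_irrefl _ (ha.lt_arrivalCount_iff.2 ((h _).1 hc))

lemma IsArrivalSeq.arrivalCount_zero {a : ℕ → ℝ} (ha : IsArrivalSeq a) : arrivalCount a 0 = 0 :=
  ha.arrivalCount_eq_of fun i => by simp [ha.pos i]

lemma IsArrivalSeq.arrivalCount_of_neg {a : ℕ → ℝ} (ha : IsArrivalSeq a) {t : ℝ} (ht : t < 0) :
    arrivalCount a t = 0 :=
  ha.arrivalCount_eq_of fun i => by simp [ht.trans (ha.pos i)]

lemma IsArrivalSeq.arrivalsAfter {a : ℕ → ℝ} (ha : IsArrivalSeq a) (d : ℝ) :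
    IsArrivalSeq (arrivalsAfter a d) := by
  refine ⟨?_, fun i j hij => ?_, ?_⟩
  · have : ¬ (arrivalCount a d + 0 < arrivalCount a d) := by simp
    rw [ha.lt_arrivalCount_iff] at this
    exact sub_pos.2 (not_le.1 this)
  · exact sub_lt_sub_right (ha.2.1 (by omega)) d
  · refine tendsto_atTop_add_const_right _ (-d) (ha.2.2.comp ?_)
    exact tendsto_atTop_mono (fun n => Nat.le_add_left n _) tendsto_id

lemma IsArrivalSeq.arrivalCount_add {a : ℕ → ℝ} (ha : IsArrivalSeq a) (d : ℝ) {s : ℝ}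
    (hs : 0 ≤ s) : arrivalCount a (d + s) =
      arrivalCount a d + arrivalCount (VacQueue.arrivalsAfter a d) s := by
  refine ha.arrivalCount_eq_of fun i => ?_
  by_cases hi : i < arrivalCount a d
  · have := ha.lt_arrivalCount_iff.1 hi
    exact ⟨fun _ => by linarith, fun _ => by omega⟩
  · obtain ⟨j, rfl⟩ := Nat.exists_eq_add_of_le (not_lt.1 hi)
    rw [Nat.add_lt_add_iff_left, (ha.arrivalsAfter d).lt_arrivalCount_iff, VacQueue.arrivalsAfter]
    constructor <;> intro h <;> linarith

/-- If two arrival sequences have the same counts up to time `d + s`, then the arrivals after `d`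
have the same counts up to time `s`. -/
lemma IsArrivalSeq.arrivalsAfter_congr {a a' : ℕ → ℝ} (ha : IsArrivalSeq a)
    (ha' : IsArrivalSeq a') {d s : ℝ}
    (h : ∀ t ≤ d + s, arrivalCount a' t = arrivalCount a t) (t : ℝ) (ht : t ≤ s) :
    arrivalCount (VacQueue.arrivalsAfter a' d) t = arrivalCount (VacQueue.arrivalsAfter a d) t := by
  rcases lt_or_ge t 0 with h0 | h0
  · rw [(ha.arrivalsAfter d).arrivalCount_of_neg h0, (ha'.arrivalsAfter d).arrivalCount_of_neg h0]
  · have h1 := ha.arrivalCount_add d h0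
    have h2 := ha'.arrivalCount_add d h0
    rw [h _ (by linarith), h d (by linarith)] at h2
    omega

/-! ### Partial sums of the interarrival times -/

/-- The time of the `i`-th arrival, with time `0` for `i = 0`. -/
def arrivalTime (g : ℕ → ℝ) (i : ℕ) : ℝ := ∑ j ∈ Finset.range i, g j

@[simp] lemma arrivalTime_zero (g : ℕ → ℝ) : arrivalTime g 0 = 0 := by simp [arrivalTime]

lemma arrivalTime_succ (g : ℕ → ℝ) (i : ℕ) : arrivalTime g (i + 1) = arrivalTime g i + g i :=
  Finset.sum_range_succ _ _

lemma epochs_eq (g : ℕ → ℝ) (i : ℕ) : epochs g i = arrivalTime g (i + 1) := rfl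

lemma arrivalTime_congr {g g' : ℕ → ℝ} {i : ℕ} (h : ∀ j < i, g j = g' j) :
    arrivalTime g i = arrivalTime g' i :=
  Finset.sum_congr rfl fun j hj => h j (Finset.mem_range.1 hj)

lemma measurable_arrivalTime (i : ℕ) : Measurable fun g => arrivalTime g i :=
  Finset.measurable_fun_sum _ fun j _ => measurable_pi_apply j

lemma measurable_epochs : Measurable epochs :=
  measurable_pi_lambda _ fun i => measurable_arrivalTime (i + 1)

/-- Interarrival times of a genuine arrival sequence. -/
structure IsGapSeq (g : ℕ → ℝ) : Prop where
  pos : ∀ i, 0 < g i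
  tendsto : Tendsto (arrivalTime g) atTop atTop

lemma IsGapSeq.isArrivalSeq {g : ℕ → ℝ} (hg : IsGapSeq g) : IsArrivalSeq (epochs g) := by
  refine ⟨?_, strictMono_nat_of_lt_succ fun i => ?_, ?_⟩
  · simpa [epochs_eq, arrivalTime_succ] using hg.pos 0
  · rw [epochs_eq, epochs_eq, arrivalTime_succ _ (i + 1)]
    linarith [hg.pos (i + 1)]
  · exact hg.tendsto.comp (tendsto_add_atTop_nat 1)

lemma IsGapSeq.arrivalTime_mono {g : ℕ → ℝ} (hg : IsGapSeq g) : Monotone (arrivalTime g) :=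
  monotone_nat_of_le_succ fun i => by
    rw [arrivalTime_succ]
    linarith [hg.pos i]

lemma IsGapSeq.arrivalTime_nonneg {g : ℕ → ℝ} (hg : IsGapSeq g) (i : ℕ) : 0 ≤ arrivalTime g i :=
  (arrivalTime_zero g).symm.le.trans (hg.arrivalTime_mono (Nat.zero_le i))

lemma IsGapSeq.arrivalCount_eq_iff {g : ℕ → ℝ} (hg : IsGapSeq g) {t : ℝ} (ht : 0 ≤ t) {i : ℕ} :
    arrivalCount (epochs g) t = i ↔ arrivalTime g i ≤ t ∧ t < arrivalTime g i + g i := by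
  have ha := hg.isArrivalSeq
  constructor
  · rintro rfl
    constructor
    · rcases h : arrivalCount (epochs g) t with _ | c
      · simpa using ht
      · exact ha.lt_arrivalCount_iff.1 (h ▸ Nat.lt_succ_self c)
    · rw [← arrivalTime_succ]
      have := lt_irrefl (arrivalCount (epochs g) t)
      rw [ha.lt_arrivalCount_iff] at this
      exact not_le.1 this
  · rintro ⟨h1, h2⟩
    rw [← arrivalTime_succ] at h2
    refine ha.arrivalCount_eq_of fun j => ⟨fun hj => ?_, fun hj => ?_⟩
    · exact (hg.arrivalTime_mono hj).trans h1
    · by_contra! h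
      exact absurd (hg.arrivalTime_mono (Nat.succ_le_succ h)) (not_le.2 (hj.trans_lt h2))

lemma ae_pos_expMeasure (lam : ℝ) : ∀ᵐ x ∂(expMeasure lam), 0 < x := by
  have h : ∀ᵐ x ∂(expMeasure lam), ¬ (x ∈ Iic (0 : ℝ)) := by
    rw [← measure_eq_zero_iff_ae_notMem, ← lintegral_indicator_one measurableSet_Iic,
      lintegral_expMeasure _ _ (measurable_one.indicator measurableSet_Iic)]
    refine (setLIntegral_congr_fun measurableSet_Ioi fun x hx => ?_).trans lintegral_zero
    have : ¬ x ≤ 0 := not_le.2 hx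
    simp [this]
  filter_upwards [h] with x hx using not_le.1 hx

lemma isProbabilityMeasure_poissonGaps {lam : ℝ} (hlam : 0 < lam) :
    IsProbabilityMeasure (poissonGaps lam) := by
  have := isProbabilityMeasure_expMeasure hlam
  unfold poissonGaps
  infer_instance

lemma ae_isGapSeq {lam : ℝ} (hlam : 0 < lam) : ∀ᵐ g ∂(poissonGaps lam), IsGapSeq g := by
  have := isProbabilityMeasure_expMeasure hlam
  have := isProbabilityMeasure_poissonGaps hlam
  have hpos : ∀ᵐ g ∂(poissonGaps lam), ∀ i, 0 < g i := by
    rw [ae_all_iff]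
    intro i
    exact (measurePreserving_eval_infinitePi (fun _ : ℕ => expMeasure lam) i).quasiMeasurePreserving.ae
      (ae_pos_expMeasure lam)
  -- The expectation of `exp (-arrivalTime g n)` is `c ^ n` with `c < 1`, hence tends to `0`.
  set c : ℝ≥0∞ := ∫⁻ x, ENNReal.ofReal (Real.exp (-x)) ∂(expMeasure lam) with hc
  have hc1 : c < 1 := by
    have h := lintegral_strict_mono (μ := expMeasure lam)
      (f := fun x => ENNReal.ofReal (Real.exp (-x))) (g := fun _ => 1)
      (IsProbabilityMeasure.ne_zero _) aemeasurable_const ?_ ?_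
    · simpa using h
    · refine ne_top_of_le_ne_top (b := ∫⁻ _, 1 ∂(expMeasure lam)) (by simp) (lintegral_mono_ae ?_)
      filter_upwards [ae_pos_expMeasure lam] with x hx
      simpa using hx.le
    · filter_upwards [ae_pos_expMeasure lam] with x hx
      simpa using hx
  have hpow : ∀ n, ∫⁻ g, ENNReal.ofReal (Real.exp (-arrivalTime g n)) ∂(poissonGaps lam) = c ^ n := by
    intro n
    induction n with
    | zero => simp
    | succ n ih =>
      have h := lintegral_past_present (expMeasure lam) n
        (fun x y => ENNReal.ofReal (Real.exp (-arrivalTime x n)) * ENNReal.ofReal (Real.exp (-y)))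
        (by
          have := measurable_arrivalTime n
          fun_prop)
        (fun x x' y hx => by simp only [arrivalTime_congr hx])
      have e : ∀ g : ℕ → ℝ, ENNReal.ofReal (Real.exp (-arrivalTime g (n + 1))) =
          ENNReal.ofReal (Real.exp (-arrivalTime g n)) * ENNReal.ofReal (Real.exp (-g n)) := by
        intro g
        rw [← ENNReal.ofReal_mul (Real.exp_pos _).le, ← Real.exp_add, arrivalTime_succ, neg_add]
      simp only [e]
      refine h.trans ?_
      have := measurable_arrivalTime n
      simp_rw [lintegral_const_mul _ (show Measurable fun y : ℝ => ENNReal.ofReal (Real.exp (-y)) by fun_prop)]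
      rw [lintegral_mul_const _ (by fun_prop), pow_succ]
      exact congrArg (· * c) ih
  have hinf : ∀ᵐ g ∂(poissonGaps lam), ⨅ n, ENNReal.ofReal (Real.exp (-arrivalTime g n)) = 0 := by
    have := fun n => measurable_arrivalTime n
    refine (lintegral_eq_zero_iff (Measurable.iInf fun n => by fun_prop)).1 (le_antisymm ?_ bot_le)
    refine ge_of_tendsto' (ENNReal.tendsto_pow_atTop_nhds_zero_of_lt_one hc1) fun n => ?_
    rw [← hpow n]
    exact lintegral_mono fun g => iInf_le _ n
  filter_upwards [hpos, hinf] with g h1 h2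
  refine ⟨h1, tendsto_atTop_atTop_of_monotone (monotone_nat_of_le_succ fun i => ?_) fun M => ?_⟩
  · rw [arrivalTime_succ]
    linarith [h1 i]
  · have h3 : ⨅ n, ENNReal.ofReal (Real.exp (-arrivalTime g n)) < ENNReal.ofReal (Real.exp (-M)) := by
      rw [h2]
      simpa using Real.exp_pos _
    obtain ⟨n, hn⟩ := iInf_lt_iff.1 h3
    rw [ENNReal.ofReal_lt_ofReal_iff (Real.exp_pos _), Real.exp_lt_exp] at hn
    exact ⟨n, by linarith⟩

/-! ### Measurability of counts -/

lemma measurable_ncard {γ : Type*} [MeasurableSpace γ] {p : ℕ → γ → Prop}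
    (hp : ∀ j, MeasurableSet {x | p j x}) : Measurable fun x => {j : ℕ | p j x}.ncard := by
  have h : ∀ x, (({j : ℕ | p j x}.ncard : ℕ) : ℝ) =
      (∑' j : ℕ, {x | p j x}.indicator (1 : γ → ℝ≥0∞) x).toReal := by
    intro x
    have e : ∑' j : ℕ, {x | p j x}.indicator (1 : γ → ℝ≥0∞) x =
        ∑' j : ℕ, {j : ℕ | p j x}.indicator (fun _ => (1 : ℝ≥0∞)) j := by
      congr 1
    rw [e, ← tsum_subtype, ENNReal.tsum_set_one]
    rcases {j : ℕ | p j x}.finite_or_infinite with hf | hf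
    · rw [← hf.cast_ncard_eq]
      simp
    · simp [hf.ncard, hf.encard_eq]
  have hm : Measurable fun x => (({j : ℕ | p j x}.ncard : ℕ) : ℝ) := by
    simp_rw [h]
    exact (Measurable.tsum fun j => measurable_one.indicator (hp j)).ennreal_toReal
  refine measurable_to_countable' fun m => ?_
  convert hm (measurableSet_singleton (m : ℝ)) using 1
  ext x
  simp

lemma measurable_arrivalCount {γ : Type*} [MeasurableSpace γ] {a : γ → ℕ → ℝ} {t : γ → ℝ}
    (ha : Measurable a) (ht : Measurable t) : Measurable fun x => arrivalCount (a x) (t x) :=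
  measurable_ncard fun j => measurableSet_le ((measurable_pi_apply j).comp ha) ht

lemma measurable_arrivalsAfter {γ : Type*} [MeasurableSpace γ] {a : γ → ℕ → ℝ} {t : γ → ℝ}
    (ha : Measurable a) (ht : Measurable t) : Measurable fun x => arrivalsAfter (a x) (t x) := by
  refine measurable_pi_lambda _ fun j => Measurable.sub ?_ ht
  have h : Measurable fun p : (ℕ → ℝ) × ℕ => p.1 (p.2 + j) :=
    measurable_from_prod_countable_left fun n => measurable_pi_apply (n + j)
  exact h.comp (ha.prodMk (measurable_arrivalCount ha ht))

/-! ### The strong Markov property of the Poisson process -/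

/-- The first `i` interarrival times of `g`, then an interarrival time `M`, then ones. -/
def freeze (i : ℕ) (M : ℝ) (g : ℕ → ℝ) (j : ℕ) : ℝ :=
  if j < i then g j else if j = i then M else 1

lemma measurable_freeze (i : ℕ) : Measurable fun p : ℝ × (ℕ → ℝ) => freeze i p.1 p.2 := by
  refine measurable_pi_lambda _ fun j => ?_
  unfold freeze
  split_ifs <;> fun_prop

lemma freeze_congr {i : ℕ} (M : ℝ) {g g' : ℕ → ℝ} (h : ∀ j < i, g j = g' j) :
    freeze i M g = freeze i M g' := by
  funext j
  unfold freeze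
  split_ifs with hj
  · exact h j hj
  · rfl
  · rfl

lemma freeze_of_lt {i j : ℕ} (hj : j < i) (M : ℝ) (g : ℕ → ℝ) : freeze i M g j = g j := if_pos hj

@[simp] lemma freeze_self (i : ℕ) (M : ℝ) (g : ℕ → ℝ) : freeze i M g i = M := by simp [freeze]

lemma IsGapSeq.freeze {g : ℕ → ℝ} (hg : IsGapSeq g) (i : ℕ) {M : ℝ} (hM : 0 < M) :
    IsGapSeq (freeze i M g) := by
  refine ⟨fun j => ?_, ?_⟩
  · unfold VacQueue.freeze
    split_ifs
    exacts [hg.pos j, hM, one_pos]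
  · rw [← tendsto_add_atTop_iff_nat (i + 1)]
    have h : ∀ n : ℕ, arrivalTime (VacQueue.freeze i M g) (n + (i + 1)) =
        n + arrivalTime (VacQueue.freeze i M g) (i + 1) := by
      intro n
      induction n with
      | zero => simp
      | succ n ih =>
        have e : VacQueue.freeze i M g (n + (i + 1)) = 1 := by
          unfold VacQueue.freeze
          rw [if_neg (by omega), if_neg (by omega)]
        rw [Nat.add_right_comm, arrivalTime_succ, ih, e]
        push_cast
        ring
    simp_rw [h]
    exact tendsto_atTop_add_const_right _ _ tendsto_natCast_atTop_atTop

/-- The number of arrivals up to a time before the arrival with index `i` is determined by the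
first `i` interarrival times. -/
lemma IsGapSeq.arrivalCount_congr {g g' : ℕ → ℝ} (hg : IsGapSeq g) (hg' : IsGapSeq g') {i : ℕ}
    (h : ∀ j < i, g j = g' j) {t : ℝ} (ht : t < arrivalTime g i + g i)
    (ht' : t < arrivalTime g i + g' i) :
    arrivalCount (epochs g') t = arrivalCount (epochs g) t := by
  refine hg'.isArrivalSeq.arrivalCount_eq_of fun j => ?_
  rw [hg.isArrivalSeq.lt_arrivalCount_iff, epochs_eq, epochs_eq]
  rcases lt_or_ge j i with hj | hj
  · rw [arrivalTime_congr (g := g) (g' := g') fun l hl => h l (by omega)]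
  · have h1 := hg.arrivalTime_mono (Nat.succ_le_succ hj)
    have h2 := hg'.arrivalTime_mono (Nat.succ_le_succ hj)
    rw [Nat.succ_eq_add_one, arrivalTime_succ] at h1 h2
    rw [arrivalTime_congr (g := g) (g' := g') h] at ht ht' h1
    constructor <;> intro h3 <;> exfalso <;> simp only [Nat.succ_eq_add_one] at h1 h2 <;> linarith

/-- If the first arrival is known to come after time `c`, then the arrivals after `c` form a
Poisson process. -/
lemma lintegral_poissonGaps_memoryless {lam : ℝ} (hlam : 0 < lam) {c : ℝ} (hc : 0 ≤ c)
    (Ψ : (ℕ → ℝ) → ℝ≥0∞) (hΨ : Measurable Ψ) :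
    ∫⁻ y, (if c < y 0 then Ψ (fun j => epochs y j - c) else 0) ∂(poissonGaps lam) =
      ENNReal.ofReal (Real.exp (-(lam * c))) * ∫⁻ y, Ψ (epochs y) ∂(poissonGaps lam) := by
  have := isProbabilityMeasure_expMeasure hlam
  have := isProbabilityMeasure_poissonGaps hlam
  set f : ℝ → ℝ≥0∞ := fun x => ∫⁻ z, Ψ (fun j => x + arrivalTime z j) ∂(poissonGaps lam) with hf
  have hat := fun j => measurable_arrivalTime j
  have hm : Measurable fun p : ℝ × (ℕ → ℝ) => Ψ (fun j => p.1 + arrivalTime p.2 j) :=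
    hΨ.comp (measurable_pi_lambda _ fun j =>
      measurable_fst.add ((hat j).comp measurable_snd))
  have hfm : Measurable f := hm.lintegral_prod_right'
  have key : ∀ c : ℝ, ∫⁻ y, (if c < y 0 then Ψ (fun j => epochs y j - c) else 0)
      ∂(poissonGaps lam) =
      ∫⁻ x, (Ioi c).indicator (fun x => f (x - c)) x ∂(expMeasure lam) := by
    intro c
    have hF : Measurable fun p : (ℕ → ℝ) × (ℕ → ℝ) =>
        if c < p.1 0 then Ψ (fun j => (p.1 0 - c) + arrivalTime p.2 j) else 0 := by
      refine Measurable.ite (measurableSet_lt measurable_const (by fun_prop)) ?_ measurable_const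
      exact hm.comp (Measurable.prodMk (by fun_prop) measurable_snd)
    have h1 := lintegral_past_future (expMeasure lam) 1
      (fun x z => if c < x 0 then Ψ (fun j => (x 0 - c) + arrivalTime z j) else 0) hF
      (fun x x' y h => by simp only [h 0 one_pos])
    have h2 : ∀ y : ℕ → ℝ, (fun j => epochs y j - c) =
        fun j => (y 0 - c) + arrivalTime (fun l => y (1 + l)) j := by
      intro y
      funext j
      rw [epochs_eq, arrivalTime, Finset.sum_range_succ', arrivalTime]
      simp only [add_comm 1]
      ring
    simp only [h2]
    refine h1.trans ?_
    have hm2 : Measurable ((Ioi c).indicator fun x => f (x - c)) :=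
      (hfm.comp (measurable_id.sub_const c)).indicator measurableSet_Ioi
    conv_rhs => rw [← (measurePreserving_eval_infinitePi (fun _ : ℕ => expMeasure lam) 0).map_eq,
      lintegral_map hm2 (measurable_pi_apply 0)]
    refine lintegral_congr fun x => ?_
    by_cases hx : c < x 0
    · simp [hx, hf, poissonGaps]
    · simp [hx]
  rw [key c, lintegral_expMeasure_memoryless lam c hc f hfm]
  congr 1
  have h0 := key 0
  have h3 : ∀ᵐ y ∂(poissonGaps lam), (if 0 < y 0 then Ψ (fun j => epochs y j - 0) else 0) =
      Ψ (epochs y) := by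
    filter_upwards [ae_isGapSeq hlam] with y hy
    simp [hy.pos 0]
  rw [lintegral_congr_ae h3] at h0
  rw [h0]
  refine lintegral_congr_ae ?_
  filter_upwards [ae_pos_expMeasure lam] with x hx
  simp [hx]

lemma lintegral_eq_tsum_fiber {γ ι : Type*} [MeasurableSpace γ] [Countable ι] [MeasurableSpace ι]
    [MeasurableSingletonClass ι] [DecidableEq ι] (μ : Measure γ) {I : γ → ι} (hI : Measurable I)
    {f : γ → ℝ≥0∞} (hf : Measurable f) :
    ∫⁻ x, f x ∂μ = ∑' p, ∫⁻ x, (if I x = p then f x else 0) ∂μ := by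
  have hm : ∀ p, Measurable fun x => if I x = p then f x else 0 := fun p =>
    Measurable.ite (hI (measurableSet_singleton p)) hf measurable_const
  rw [← lintegral_tsum fun p => (hm p).aemeasurable]
  refine lintegral_congr fun x => ?_
  rw [tsum_eq_single (I x) fun p hp => if_neg hp.symm, if_pos rfl]

/-- The strong Markov property of the Poisson process at a nonanticipating time `T`: whatever is
determined by the arrivals up to time `T` is independent of the arrivals after `T`, which form a
Poisson process again. -/
theorem strong_markov {lam : ℝ} (hlam : 0 < lam) {T : (ℕ → ℝ) → ℝ} (hT : Measurable T)
    (hT0 : ∀ g, IsGapSeq g → 0 ≤ T g) {Φ : (ℕ → ℝ) → ℝ≥0∞} (hΦ : Measurable Φ)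
    (hna : ∀ g g', IsGapSeq g → IsGapSeq g' →
      (∀ t ≤ T g, arrivalCount (epochs g') t = arrivalCount (epochs g) t) →
        T g' = T g ∧ Φ g' = Φ g)
    {Ψ : (ℕ → ℝ) → ℝ≥0∞} (hΨ : Measurable Ψ) :
    ∫⁻ g, Φ g * Ψ (arrivalsAfter (epochs g) (T g)) ∂(poissonGaps lam) =
      (∫⁻ g, Φ g ∂(poissonGaps lam)) * ∫⁻ g, Ψ (epochs g) ∂(poissonGaps lam) := by
  have := isProbabilityMeasure_expMeasure hlam
  have := isProbabilityMeasure_poissonGaps hlam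
  have hfz : ∀ i (m : ℕ), Measurable fun g => freeze i (m + 1) g := fun i m =>
    (measurable_freeze i).comp (measurable_const.prodMk measurable_id)
  -- The probability space is split according to the number of arrivals before `T` and the integer
  -- part `m` of the time between the last of these arrivals and `T`. An interarrival time `m + 1` in
  -- place of the current one is long enough not to end before `T`.
  set I : (ℕ → ℝ) → ℕ × ℕ := fun g => (arrivalCount (epochs g) (T g),
    ⌊T g - arrivalTime g (arrivalCount (epochs g) (T g))⌋₊) with hI
  have hcount : Measurable fun g => arrivalCount (epochs g) (T g) :=
    measurable_arrivalCount measurable_epochs hT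
  have hIm : Measurable I := by
    refine hcount.prodMk (Nat.measurable_floor.comp (hT.sub ?_))
    have h : Measurable fun p : (ℕ → ℝ) × ℕ => arrivalTime p.1 p.2 :=
      measurable_from_prod_countable_left fun n => measurable_arrivalTime n
    exact h.comp (measurable_id.prodMk hcount)
  -- On the part with index `(i, m)`, `T` agrees with its value for the frozen sequence, which does
  -- not depend on the interarrival times from index `i` on.
  have hpiece : ∀ (p : ℕ × ℕ) (Ψ : (ℕ → ℝ) → ℝ≥0∞), Measurable Ψ →
      ∫⁻ g, (if I g = p then Φ g * Ψ (arrivalsAfter (epochs g) (T g)) else 0) ∂(poissonGaps lam) =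
      (∫⁻ g, (if 0 ≤ T (freeze p.1 (p.2 + 1) g) - arrivalTime g p.1 ∧
          ⌊T (freeze p.1 (p.2 + 1) g) - arrivalTime g p.1⌋₊ = p.2 then
        Φ (freeze p.1 (p.2 + 1) g) * ENNReal.ofReal
          (Real.exp (-(lam * (T (freeze p.1 (p.2 + 1) g) - arrivalTime g p.1)))) else 0)
        ∂(poissonGaps lam)) * ∫⁻ g, Ψ (epochs g) ∂(poissonGaps lam) := by
    rintro ⟨i, m⟩ Ψ hΨ
    simp only
    set c : (ℕ → ℝ) → ℝ := fun g => T (freeze i (m + 1) g) - arrivalTime g i with hc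
    have hcm : Measurable c := (hT.comp (hfz i m)).sub (measurable_arrivalTime i)
    have hccong : ∀ x x' : ℕ → ℝ, (∀ j < i, x j = x' j) → c x = c x' := by
      intro x x' h
      simp only [hc, arrivalTime_congr h, freeze_congr _ h]
    set C : (ℕ → ℝ) → ℝ≥0∞ := fun g =>
      if 0 ≤ c g ∧ ⌊c g⌋₊ = m then Φ (freeze i (m + 1) g) else 0 with hC
    have hCm : Measurable C := by
      refine Measurable.ite ?_ (hΦ.comp (hfz i m)) measurable_const
      exact (measurableSet_le measurable_const hcm).inter
        ((Nat.measurable_floor.comp hcm) (measurableSet_singleton m))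
    have h1 := lintegral_past_future (expMeasure lam) i
      (fun x y => C x * (if c x < y 0 then Ψ (fun j => epochs y j - c x) else 0))
      (by
        refine (hCm.comp measurable_fst).mul (Measurable.ite ?_ ?_ measurable_const)
        · exact measurableSet_lt (hcm.comp measurable_fst)
            ((measurable_pi_apply 0).comp measurable_snd)
        · refine hΨ.comp (measurable_pi_lambda _ fun j => ?_)
          exact ((measurable_arrivalTime (j + 1)).comp measurable_snd).sub
            (hcm.comp measurable_fst))
      (fun x x' y h => by
        simp only [hC, hccong x x' h, freeze_congr _ h])
    have h2 : ∀ᵐ g ∂(poissonGaps lam),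
        (if I g = (i, m) then Φ g * Ψ (arrivalsAfter (epochs g) (T g)) else 0) =
          C g * (if c g < g (i + 0) then
            Ψ (fun j => epochs (fun l => g (i + l)) j - c g) else 0) := by
      filter_upwards [ae_isGapSeq hlam] with g hg
      have hm0 : (0 : ℝ) < m + 1 := by positivity
      have hg' := hg.freeze i hm0
      have hfi : ∀ j < i, g j = freeze i (m + 1) g j := fun j hj => (freeze_of_lt hj _ _).symm
      have hgf : ∀ j < i, freeze i (m + 1) g j = g j := fun j hj => freeze_of_lt hj _ _
      have hS := arrivalTime_congr hfi
      have hT0g := hT0 g hg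
      have hiff : I g = (i, m) → (0 ≤ c g ∧ ⌊c g⌋₊ = m) ∧ c g < g i := by
        intro hIg
        rw [hI, Prod.mk.injEq] at hIg
        obtain ⟨h3, h4⟩ := hIg
        rw [h3] at h4
        obtain ⟨h5, h6⟩ := (hg.arrivalCount_eq_iff hT0g).1 h3
        have h7 : T g - arrivalTime g i < m + 1 := by
          rw [← h4]
          exact Nat.lt_floor_add_one _
        have h8 := (hna g _ hg hg' fun t ht => hg.arrivalCount_congr hg' hfi (by linarith)
          (by rw [freeze_self]; linarith)).1
        simp only [hc, h8]
        exact ⟨⟨by linarith, h4⟩, by linarith⟩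
      have hiff' : (0 ≤ c g ∧ ⌊c g⌋₊ = m) ∧ c g < g i → T g = T (freeze i (m + 1) g) ∧
          Φ g = Φ (freeze i (m + 1) g) := by
        rintro ⟨⟨h3, h4⟩, h5⟩
        have h7 : c g < m + 1 := by
          rw [← h4]
          exact Nat.lt_floor_add_one _
        simp only [hc] at h3 h5 h7
        refine hna _ g hg' hg fun t ht => hg'.arrivalCount_congr hg hgf ?_ ?_
        · rw [← hS, freeze_self]
          linarith
        · rw [← hS]
          linarith
      by_cases hIg : I g = (i, m)
      · obtain ⟨h3, h4⟩ := hiff hIg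
        obtain ⟨h5, h6⟩ := hiff' ⟨h3, h4⟩
        rw [if_pos hIg, add_zero, if_pos h4]
        simp only [hC, if_pos h3, h6]
        congr 2
        funext j
        have h7 : arrivalCount (epochs g) (T g) = i := congrArg Prod.fst hIg
        rw [arrivalsAfter, h7, epochs_eq, epochs_eq, arrivalTime, arrivalTime, add_assoc,
          Finset.sum_range_add, hc]
        simp only [← h5, arrivalTime]
        ring
      · rw [if_neg hIg, add_zero]
        by_cases h3 : 0 ≤ c g ∧ ⌊c g⌋₊ = m
        · by_cases h4 : c g < g i
          · obtain ⟨h5, h6⟩ := hiff' ⟨h3, h4⟩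
            refine absurd ?_ hIg
            have h7 : arrivalCount (epochs g) (T g) = i := by
              rw [hg.arrivalCount_eq_iff hT0g, h5]
              simp only [hc] at h3 h4
              exact ⟨by linarith, by linarith⟩
            simp only [hI, h7, Prod.mk.injEq, true_and]
            rw [h5]
            exact h3.2
          · rw [if_neg h4, mul_zero]
        · simp only [hC, if_neg h3, zero_mul]
    rw [lintegral_congr_ae h2]
    refine h1.trans ?_
    rw [← lintegral_mul_const]
    · refine lintegral_congr fun x => ?_
      rw [lintegral_const_mul]
      · by_cases h3 : 0 ≤ c x ∧ ⌊c x⌋₊ = m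
        · have h4 := lintegral_poissonGaps_memoryless hlam h3.1 Ψ hΨ
          rw [poissonGaps] at h4 ⊢
          rw [h4, if_pos h3, mul_assoc]
          simp only [hC, if_pos h3]
          rfl
        · rw [if_neg h3]
          simp only [hC, if_neg h3, zero_mul]
      · refine Measurable.ite ?_ ?_ measurable_const
        · exact measurableSet_lt measurable_const (measurable_pi_apply 0)
        · exact hΨ.comp (measurable_pi_lambda _ fun j => (measurable_arrivalTime (j + 1)).sub_const _)
    · refine Measurable.ite ?_ ((hΦ.comp (hfz i m)).mul ?_) measurable_const
      · exact (measurableSet_le measurable_const hcm).inter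
          ((Nat.measurable_floor.comp hcm) (measurableSet_singleton m))
      · have : Measurable fun a => T (freeze i (m + 1) a) - arrivalTime a i := hcm
        fun_prop
  have hA : Measurable fun g => Φ g * Ψ (arrivalsAfter (epochs g) (T g)) :=
    hΦ.mul (hΨ.comp (measurable_arrivalsAfter measurable_epochs hT))
  rw [lintegral_eq_tsum_fiber _ hIm hA, lintegral_eq_tsum_fiber _ hIm hΦ, ← ENNReal.tsum_mul_right]
  refine tsum_congr fun p => ?_
  rw [hpiece p Ψ hΨ]
  have h1 := hpiece p (fun _ => 1) measurable_const
  simp only [mul_one, lintegral_const, measure_univ] at h1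
  rw [h1]

/-! ### The compensator of the Poisson process -/

/-- Poisson arrivals see time averages: if `H s` is determined by the arrivals strictly before
time `s`, then the expected sum of `H` over the arrival epochs is `lam` times the expected
time integral of `H`. -/
theorem lintegral_sum_arrivals {lam : ℝ} (hlam : 0 < lam) {H : ℝ → (ℕ → ℝ) → ℝ≥0∞}
    (hH : Measurable fun p : ℝ × (ℕ → ℝ) => H p.1 p.2)
    (hpred : ∀ g g' s, IsGapSeq g → IsGapSeq g' → 0 < s →
      (∀ t < s, arrivalCount (epochs g') t = arrivalCount (epochs g) t) → H s g' = H s g) :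
    ∫⁻ g, ∑' i, H (epochs g i) g ∂(poissonGaps lam) =
      ENNReal.ofReal lam * ∫⁻ g, (∫⁻ s in Ioi 0, H s g) ∂(poissonGaps lam) := by
  have := isProbabilityMeasure_expMeasure hlam
  have := isProbabilityMeasure_poissonGaps hlam
  have hat := fun j => measurable_arrivalTime j
  -- Between two arrivals, `H` can be computed from the earlier arrivals and the elapsed time `x`;
  -- any value above `x` may be taken for the current interarrival time.
  set h : ℕ → ℝ → (ℕ → ℝ) → ℝ≥0∞ := fun i x g => H (arrivalTime g i + x) (freeze i (x + 1) g)
    with hh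
  have hhm : ∀ i, Measurable fun p : (ℕ → ℝ) × ℝ => h i p.2 p.1 := fun i =>
    hH.comp ((((hat i).comp measurable_fst).add measurable_snd).prodMk
      ((measurable_freeze i).comp ((measurable_snd.add_const 1).prodMk measurable_fst)))
  have hcong : ∀ i x (g g' : ℕ → ℝ), (∀ j < i, g j = g' j) → h i x g = h i x g' := by
    intro i x g g' hgg
    simp only [hh, arrivalTime_congr hgg, freeze_congr _ hgg]
  have hHh : ∀ g, IsGapSeq g → ∀ i x, 0 < x → x ≤ g i → H (arrivalTime g i + x) g = h i x g := by
    intro g hg i x hx hxg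
    have hg' : IsGapSeq (freeze i (x + 1) g) := hg.freeze i (by linarith)
    refine hpred _ g _ hg' hg (by linarith [hg.arrivalTime_nonneg i]) fun t ht => ?_
    have hfi : ∀ j < i, g j = freeze i (x + 1) g j := fun j hj => (freeze_of_lt hj _ _).symm
    exact (hg.arrivalCount_congr hg' hfi (by linarith) (by rw [freeze_self]; linarith)).symm
  have hsplit : ∀ g, IsGapSeq g → ∫⁻ s in Ioi 0, H s g =
      ∑' i, ∫⁻ x in Ioi 0, (if x < g i then h i x g else 0) := by
    intro g hg
    have hU : Ioi (0 : ℝ) = ⋃ i, Ioc (arrivalTime g i) (arrivalTime g (i + 1)) := by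
      ext s
      simp only [mem_Ioi, mem_iUnion, mem_Ioc]
      constructor
      · intro hs
        have hex := (hg.tendsto.eventually_ge_atTop s).exists
        classical
        have h0 : Nat.find hex ≠ 0 := by
          intro h0
          have := Nat.find_spec hex
          rw [h0, arrivalTime_zero] at this
          linarith
        obtain ⟨n, hn⟩ := Nat.exists_eq_succ_of_ne_zero h0
        refine ⟨n, ?_, ?_⟩
        · have := Nat.find_min hex (m := n) (by omega)
          exact not_le.1 this
        · have := Nat.find_spec hex
          rwa [hn] at this
      · rintro ⟨i, h1, -⟩
        exact (hg.arrivalTime_nonneg i).trans_lt h1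
    conv_lhs => rw [hU]
    refine (lintegral_iUnion (fun i => measurableSet_Ioc)
      hg.arrivalTime_mono.pairwise_disjoint_on_Ioc_succ _).trans ?_
    simp only [Order.succ_eq_add_one]
    refine tsum_congr fun i => ?_
    rw [← lintegral_indicator measurableSet_Ioc, ← lintegral_indicator measurableSet_Ioi,
      ← lintegral_add_left_eq_self _ (arrivalTime g i)]
    refine lintegral_congr_ae ?_
    have hne : ∀ᵐ x : ℝ, x ≠ g i := by simp [ae_iff]
    filter_upwards [hne] with x hx
    rw [arrivalTime_succ]
    by_cases h0 : 0 < x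
    · by_cases h1 : x < g i
      · rw [indicator_of_mem, indicator_of_mem (show x ∈ Ioi 0 from h0), if_pos h1,
          hHh g hg i x h0 h1.le]
        exact ⟨by linarith, by linarith⟩
      · rw [indicator_of_notMem, indicator_of_mem (show x ∈ Ioi 0 from h0), if_neg h1]
        rintro ⟨-, h2⟩
        exact hx (le_antisymm (by linarith) (not_lt.1 h1))
    · rw [indicator_of_notMem, indicator_of_notMem (show x ∉ Ioi 0 from h0)]
      rintro ⟨h2, -⟩
      linarith
  have hm2 : ∀ i, Measurable fun p : ((ℕ → ℝ) × ℝ) × ℝ =>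
      if p.2 < p.1.2 then h i p.2 p.1.1 else 0 := fun i =>
    Measurable.ite (measurableSet_lt measurable_snd (measurable_snd.comp measurable_fst))
      ((hhm i).comp ((measurable_fst.comp measurable_fst).prodMk measurable_snd)) measurable_const
  have hepm : ∀ i, Measurable fun g => H (epochs g i) g := fun i =>
    hH.comp ((hat (i + 1)).prodMk measurable_id)
  rw [lintegral_tsum fun i => (hepm i).aemeasurable,
    lintegral_congr_ae ((ae_isGapSeq hlam).mono hsplit), lintegral_tsum]
  · rw [← ENNReal.tsum_mul_left]
    refine tsum_congr fun i => ?_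
    -- Integration over the interarrival time with index `i`: its density at `x` is `lam` times the
    -- probability that it exceeds `x`.
    have e1 : ∫⁻ g, H (epochs g i) g ∂(poissonGaps lam) =
        ∫⁻ g, h i (g i) g ∂(poissonGaps lam) := by
      refine lintegral_congr_ae ((ae_isGapSeq hlam).mono fun g hg => ?_)
      simp only [epochs_eq, arrivalTime_succ]
      exact hHh g hg i (g i) (hg.pos i) le_rfl
    have e2 := lintegral_past_present (expMeasure lam) i (fun g x => h i x g) (hhm i)
      (fun g g' x hgg => hcong i x g g' hgg)
    have e3 := lintegral_past_present (expMeasure lam) i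
      (fun g y => ∫⁻ x in Ioi 0, (if x < y then h i x g else 0))
      (hm2 i).lintegral_prod_right'
      (fun g g' y hgg => by simp only [hcong i _ g g' hgg])
    rw [e1]
    refine e2.trans ?_
    refine Eq.trans ?_ (congrArg (ENNReal.ofReal lam * ·) e3.symm)
    rw [← lintegral_const_mul]
    · refine lintegral_congr fun g => ?_
      have hgm : Measurable fun x => h i x g :=
        (hhm i).comp (measurable_const.prodMk measurable_id)
      rw [lintegral_expMeasure _ _ hgm, lintegral_lintegral_swap
        (((hm2 i).comp ((measurable_const.prodMk measurable_fst).prodMk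
          measurable_snd)).aemeasurable (f := fun p : ℝ × ℝ => if p.2 < p.1 then h i p.2 g else 0)),
        ← lintegral_const_mul]
      · refine setLIntegral_congr_fun measurableSet_Ioi fun x hx => ?_
        have e4 : ∀ y, (if x < y then h i x g else 0) =
            (Ioi x).indicator (fun _ => h i x g) y := fun y => by simp [indicator]
        simp only [e4]
        rw [lintegral_indicator measurableSet_Ioi, lintegral_const, Measure.restrict_apply_univ,
          expMeasure_Ioi hlam (le_of_lt hx), ENNReal.ofReal_mul hlam.le]
        ring
      · refine Measurable.lintegral_prod_right' (f := fun p : ℝ × ℝ =>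
          if p.1 < p.2 then h i p.1 g else 0) ?_
        exact (hm2 i).comp ((measurable_const.prodMk measurable_snd).prodMk measurable_fst)
    · exact Measurable.lintegral_prod_right' (f := fun p : (ℕ → ℝ) × ℝ =>
        ∫⁻ x in Ioi 0, (if x < p.2 then h i x p.1 else 0)) (hm2 i).lintegral_prod_right'
  · intro i
    have := (hm2 i).lintegral_prod_right' (ν := volume.restrict (Ioi 0))
    exact (this.comp (measurable_id.prodMk (measurable_pi_apply i))).aemeasurable

/-! ### Arrivals during a nonanticipating time -/

/-- A time that is determined by the arrivals up to that time. -/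
def Nonanticipating (T : (ℕ → ℝ) → ℝ) : Prop :=
  ∀ g g', IsGapSeq g → IsGapSeq g' →
    (∀ t ≤ T g, arrivalCount (epochs g') t = arrivalCount (epochs g) t) → T g' = T g

lemma nonanticipating_const (t : ℝ) : Nonanticipating fun _ => t := fun _ _ _ _ _ => rfl

lemma Nonanticipating.le_iff {T : (ℕ → ℝ) → ℝ} (hT : Nonanticipating T) {g g' : ℕ → ℝ}
    (hg : IsGapSeq g) (hg' : IsGapSeq g') {s : ℝ}
    (h : ∀ t < s, arrivalCount (epochs g') t = arrivalCount (epochs g) t) :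
    s ≤ T g' ↔ s ≤ T g := by
  constructor
  · intro h1
    by_contra! h2
    have := hT g g' hg hg' fun t ht => h t (ht.trans_lt h2)
    linarith
  · intro h1
    by_contra! h2
    have := hT g' g hg' hg fun t ht => (h t (ht.trans_lt h2)).symm
    linarith

lemma IsGapSeq.tsum_le_eq {g : ℕ → ℝ} (hg : IsGapSeq g) (t : ℝ) (f : ℕ → ℝ≥0∞) :
    ∑' i, (if epochs g i ≤ t then f i else 0) =
      ∑ i ∈ Finset.range (arrivalCount (epochs g) t), f i := by
  rw [tsum_eq_sum (s := Finset.range (arrivalCount (epochs g) t))]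
  · refine Finset.sum_congr rfl fun i hi => ?_
    rw [if_pos]
    exact hg.isArrivalSeq.lt_arrivalCount_iff.1 (Finset.mem_range.1 hi)
  · intro i hi
    rw [if_neg]
    exact fun h => hi (Finset.mem_range.2 (hg.isArrivalSeq.lt_arrivalCount_iff.2 h))

/-- Wald's identity. -/
lemma lintegral_arrivalCount {lam : ℝ} (hlam : 0 < lam) {T : (ℕ → ℝ) → ℝ} (hTm : Measurable T)
    (hT : Nonanticipating T) :
    ∫⁻ g, (arrivalCount (epochs g) (T g) : ℝ≥0∞) ∂(poissonGaps lam) =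
      ENNReal.ofReal lam * ∫⁻ g, ENNReal.ofReal (T g) ∂(poissonGaps lam) := by
  have h := lintegral_sum_arrivals hlam (H := fun s g => if s ≤ T g then 1 else 0)
    (Measurable.ite (measurableSet_le measurable_fst (hTm.comp measurable_snd))
      measurable_const measurable_const)
    (fun g g' s hg hg' _ hs => by simp only [hT.le_iff hg hg' hs])
  rw [lintegral_congr_ae (g := fun g => (arrivalCount (epochs g) (T g) : ℝ≥0∞))
    ((ae_isGapSeq hlam).mono fun g hg => by simp [hg.tsum_le_eq (T g) fun _ => 1])] at h
  rw [h]
  congr 1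
  refine lintegral_congr fun g => ?_
  have e : ∀ s, (if s ≤ T g then (1 : ℝ≥0∞) else 0) = (Iic (T g)).indicator 1 s :=
    fun s => by simp [indicator]
  simp only [e]
  rw [lintegral_indicator_one measurableSet_Iic, Measure.restrict_apply measurableSet_Iic,
    inter_comm, Ioi_inter_Iic, Real.volume_Ioc, sub_zero]

lemma eq_exp_of_eq_integral {u : ℝ → ℝ} {c : ℝ} (hint : ∀ t, IntervalIntegrable u volume 0 t)
    (hu : ∀ t, 0 ≤ t → u t = 1 - c * ∫ s in (0 : ℝ)..t, u s) {t : ℝ} (ht : 0 ≤ t) :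
    u t = Real.exp (-(c * t)) := by
  have hint' : ∀ a b, IntervalIntegrable u volume a b := fun a b => (hint a).symm.trans (hint b)
  have hcont : Continuous fun t => ∫ s in (0 : ℝ)..t, u s :=
    intervalIntegral.continuous_primitive hint' 0
  set v : ℝ → ℝ := fun t => 1 - c * ∫ s in (0 : ℝ)..t, u s with hv
  have hvc : Continuous v := continuous_const.sub (continuous_const.mul hcont)
  have hI : ∀ t, 0 ≤ t → ∫ s in (0 : ℝ)..t, u s = ∫ s in (0 : ℝ)..t, v s := by
    intro t ht
    refine intervalIntegral.integral_congr fun s hs => ?_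
    rw [uIcc_of_le ht] at hs
    exact hu s hs.1
  have hd : ∀ x, HasDerivAt (fun t => ∫ s in (0 : ℝ)..t, v s) (v x) x := fun x =>
    intervalIntegral.integral_hasDerivAt_right (hvc.intervalIntegrable _ _)
      (hvc.stronglyMeasurableAtFilter _ _) hvc.continuousAt
  set W : ℝ → ℝ := fun t => (1 - c * ∫ s in (0 : ℝ)..t, v s) * Real.exp (c * t) with hW
  have hWd : ∀ x, 0 ≤ x → HasDerivAt W 0 x := by
    intro x hx
    have h1 := ((hd x).const_mul c).const_sub 1
    have h2 : HasDerivAt (fun t => Real.exp (c * t)) (Real.exp (c * x) * (c * 1)) x :=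
      ((hasDerivAt_id x).const_mul c).exp
    refine (h1.mul h2).congr_deriv ?_
    rw [← hI x hx]
    simp only [hv]
    ring
  have hWc : ContinuousOn W (Icc 0 t) := fun x hx => (hWd x hx.1).continuousAt.continuousWithinAt
  have h3 := constant_of_has_deriv_right_zero hWc
    (fun x hx => (hWd x hx.1).hasDerivWithinAt) t ⟨ht, le_rfl⟩
  simp only [hW, intervalIntegral.integral_same, mul_zero, sub_zero, Real.exp_zero, mul_one] at h3
  rw [hu t ht, hI t ht, Real.exp_neg]
  exact eq_inv_of_mul_eq_one_left h3

/-- The number of arrivals strictly before time `t`. -/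
def arrivalCountBefore (a : ℕ → ℝ) (t : ℝ) : ℕ := {j : ℕ | a j < t}.ncard

lemma measurable_arrivalCountBefore {γ : Type*} [MeasurableSpace γ] {a : γ → ℕ → ℝ} {t : γ → ℝ}
    (ha : Measurable a) (ht : Measurable t) :
    Measurable fun x => arrivalCountBefore (a x) (t x) :=
  measurable_ncard fun j => measurableSet_lt ((measurable_pi_apply j).comp ha) ht

lemma IsArrivalSeq.arrivalCountBefore_eq {a : ℕ → ℝ} (ha : IsArrivalSeq a) (i : ℕ) :
    arrivalCountBefore a (a i) = i := by
  have : {j : ℕ | a j < a i} = Finset.range i := by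
    ext j
    simp [ha.2.1.lt_iff_lt]
  rw [arrivalCountBefore, this, ncard_coe_finset, Finset.card_range]

lemma arrivalCountBefore_eq_arrivalCount {a : ℕ → ℝ} {t : ℝ} (h : ∀ j, a j ≠ t) :
    arrivalCountBefore a t = arrivalCount a t := by
  have : {j : ℕ | a j < t} = {j : ℕ | a j ≤ t} := by
    ext j
    exact ⟨fun h' => le_of_lt (show a j < t from h'), fun h' => lt_of_le_of_ne h' (h j)⟩
  rw [arrivalCountBefore, this, arrivalCount]

lemma IsArrivalSeq.arrivalCountBefore_congr {a a' : ℕ → ℝ} (ha : IsArrivalSeq a)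
    (ha' : IsArrivalSeq a') {s : ℝ} (h : ∀ t < s, arrivalCount a' t = arrivalCount a t) :
    arrivalCountBefore a' s = arrivalCountBefore a s := by
  have : {j : ℕ | a' j < s} = {j : ℕ | a j < s} := by
    ext j
    constructor
    · intro (hj : a' j < s)
      have h1 := ha'.lt_arrivalCount_iff.2 (le_refl (a' j))
      rw [h _ hj, ha.lt_arrivalCount_iff] at h1
      exact h1.trans_lt hj
    · intro (hj : a j < s)
      have h1 := ha.lt_arrivalCount_iff.2 (le_refl (a j))
      rw [← h _ hj, ha'.lt_arrivalCount_iff] at h1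
      exact h1.trans_lt hj
  rw [arrivalCountBefore, this, arrivalCountBefore]

lemma measurable_ennreal_pow (x : ℝ≥0∞) {γ : Type*} [MeasurableSpace γ] {f : γ → ℕ}
    (hf : Measurable f) : Measurable fun y => x ^ f y :=
  (measurable_from_nat (f := fun n : ℕ => x ^ n)).comp hf

lemma pow_add_mul_geom_sum {r : ℝ} (hr0 : 0 ≤ r) (hr1 : r ≤ 1) (N : ℕ) :
    ENNReal.ofReal r ^ N +
      ENNReal.ofReal (1 - r) * ∑ i ∈ Finset.range N, ENNReal.ofReal r ^ i = 1 := by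
  simp_rw [← ENNReal.ofReal_pow hr0]
  rw [← ENNReal.ofReal_sum_of_nonneg fun i _ => pow_nonneg hr0 i,
    ← ENNReal.ofReal_mul (by linarith), mul_neg_geom_sum r N,
    ← ENNReal.ofReal_add (by positivity) (sub_nonneg.2 (pow_le_one₀ hr0 hr1))]
  simp

lemma lintegral_before_eq_lintegral_arrivalCount {lam : ℝ} (hlam : 0 < lam) (t : ℝ) (f : ℕ → ℝ≥0∞)
    (hf : Measurable f) :
    ∫⁻ g, (∫⁻ s in Ioi 0, (if s ≤ t then f (arrivalCountBefore (epochs g) s) else 0))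
      ∂(poissonGaps lam) =
      ∫⁻ s in Ioc 0 t, ∫⁻ g, f (arrivalCount (epochs g) s) ∂(poissonGaps lam) := by
  have := isProbabilityMeasure_poissonGaps hlam
  have e : ∀ g : ℕ → ℝ, ∫⁻ s in Ioi 0, (if s ≤ t then f (arrivalCountBefore (epochs g) s) else 0) =
      ∫⁻ s in Ioc 0 t, f (arrivalCount (epochs g) s) := by
    intro g
    rw [← lintegral_indicator measurableSet_Ioi, ← lintegral_indicator measurableSet_Ioc]
    refine lintegral_congr_ae ?_
    have hne : ∀ᵐ s : ℝ, ∀ j, epochs g j ≠ s := by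
      rw [ae_all_iff]
      intro j
      simp [ae_iff]
    filter_upwards [hne] with s hs
    by_cases h0 : 0 < s <;> by_cases h1 : s ≤ t <;>
      simp [indicator, h0, h1, arrivalCountBefore_eq_arrivalCount hs]
  simp_rw [e]
  refine lintegral_lintegral_swap (AEMeasurable.comp_measurable hf.aemeasurable ?_)
  exact measurable_arrivalCount (measurable_epochs.comp measurable_fst) measurable_snd

/-- The number of arrivals in a fixed time has the Poisson law, here in terms of its generating
function. -/
lemma lintegral_pow_arrivalCount_const {lam : ℝ} (hlam : 0 < lam) {r : ℝ} (hr0 : 0 ≤ r)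
    (hr1 : r ≤ 1) {t : ℝ} (ht : 0 ≤ t) :
    ∫⁻ g, ENNReal.ofReal r ^ arrivalCount (epochs g) t ∂(poissonGaps lam) =
      ENNReal.ofReal (Real.exp (-(lam * (1 - r) * t))) := by
  have := isProbabilityMeasure_poissonGaps hlam
  have hle1 : ∀ n, ENNReal.ofReal r ^ n ≤ 1 := fun n => pow_le_one' (by simpa using hr1) n
  have hjm : Measurable fun p : ℝ × (ℕ → ℝ) => ENNReal.ofReal r ^ arrivalCount (epochs p.2) p.1 :=
    measurable_ennreal_pow _
      (measurable_arrivalCount (measurable_epochs.comp measurable_snd) measurable_fst)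
  set F : ℝ → ℝ≥0∞ := fun s => ∫⁻ g, ENNReal.ofReal r ^ arrivalCount (epochs g) s ∂(poissonGaps lam)
    with hF
  have hFm : Measurable F := hjm.lintegral_prod_right'
  have hF1 : ∀ s, F s ≤ 1 := fun s => by
    refine (lintegral_mono fun g => hle1 _).trans ?_
    simp
  have hFtop : ∀ s, F s ≠ ∞ := fun s => ne_top_of_le_ne_top ENNReal.one_ne_top (hF1 s)
  have hint : ∀ t, IntervalIntegrable (fun s => (F s).toReal) volume 0 t := by
    intro t
    refine (intervalIntegrable_const (c := (1 : ℝ))).mono_fun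
      hFm.ennreal_toReal.aestronglyMeasurable (ae_of_all _ fun s => ?_)
    simpa using ENNReal.toReal_mono ENNReal.one_ne_top (hF1 s)
  have hmain : ∀ t, 0 ≤ t → F t + ENNReal.ofReal (lam * (1 - r)) * ∫⁻ s in Ioc 0 t, F s = 1 := by
    intro t ht
    have h := lintegral_sum_arrivals hlam
      (H := fun s g => if s ≤ t then ENNReal.ofReal r ^ arrivalCountBefore (epochs g) s else 0)
      (Measurable.ite (measurableSet_le measurable_fst measurable_const)
        (measurable_ennreal_pow _
          (measurable_arrivalCountBefore (measurable_epochs.comp measurable_snd) measurable_fst))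
        measurable_const)
      (fun g g' s hg hg' _ hs => by
        simp only [hg.isArrivalSeq.arrivalCountBefore_congr hg'.isArrivalSeq hs])
    rw [lintegral_congr_ae (g := fun g => ∑ i ∈ Finset.range (arrivalCount (epochs g) t),
        ENNReal.ofReal r ^ i) ((ae_isGapSeq hlam).mono fun g hg => by
          simp only [hg.isArrivalSeq.arrivalCountBefore_eq]
          exact hg.tsum_le_eq t fun i => ENNReal.ofReal r ^ i)] at h
    rw [lintegral_before_eq_lintegral_arrivalCount hlam t (fun n => ENNReal.ofReal r ^ n)
      measurable_from_nat] at h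
    have hpm : Measurable fun g => ENNReal.ofReal r ^ arrivalCount (epochs g) t :=
      measurable_ennreal_pow _ (measurable_arrivalCount measurable_epochs measurable_const)
    have hsm : Measurable fun g => ∑ i ∈ Finset.range (arrivalCount (epochs g) t),
        ENNReal.ofReal r ^ i :=
      (measurable_from_nat (f := fun n => ∑ i ∈ Finset.range n, ENNReal.ofReal r ^ i)).comp
        (measurable_arrivalCount measurable_epochs measurable_const)
    have h3 : ENNReal.ofReal (lam * (1 - r)) * ∫⁻ s in Ioc 0 t, F s =
        ∫⁻ g, ENNReal.ofReal (1 - r) * ∑ i ∈ Finset.range (arrivalCount (epochs g) t),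
          ENNReal.ofReal r ^ i ∂(poissonGaps lam) := by
      rw [lintegral_const_mul _ hsm, h, mul_comm lam, ENNReal.ofReal_mul (by linarith), mul_assoc]
    rw [h3]
    refine (lintegral_add_left hpm _).symm.trans ?_
    simp_rw [pow_add_mul_geom_sum hr0 hr1]
    simp
  have hu : ∀ t, 0 ≤ t → (F t).toReal = 1 - lam * (1 - r) * ∫ s in (0 : ℝ)..t, (F s).toReal := by
    intro t ht
    have h1 := hmain t ht
    have hfin : ∫⁻ s in Ioc 0 t, F s ≠ ∞ := by
      refine ne_top_of_le_ne_top (b := ∫⁻ s in Ioc 0 t, 1) (by simp) (lintegral_mono fun s => hF1 s)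
    have h2 := congrArg ENNReal.toReal h1
    rw [ENNReal.toReal_add (hFtop t) (ENNReal.mul_ne_top ENNReal.ofReal_ne_top hfin),
      ENNReal.toReal_mul, ENNReal.toReal_ofReal (mul_nonneg hlam.le (by linarith)),
      ENNReal.toReal_one] at h2
    rw [intervalIntegral.integral_of_le ht,
      integral_toReal hFm.aemeasurable (ae_of_all _ fun s => (hF1 s).trans_lt ENNReal.one_lt_top)]
    linarith
  rw [← eq_exp_of_eq_integral hint hu ht, ENNReal.ofReal_toReal (hFtop t)]

/-- The arrivals in a time of fixed length after a nonanticipating time are independent of the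
arrivals before it. -/
lemma lintegral_pow_arrivalCount_add {lam : ℝ} (hlam : 0 < lam) {r : ℝ} (hr0 : 0 ≤ r)
    (hr1 : r ≤ 1) {T : (ℕ → ℝ) → ℝ} (hTm : Measurable T) (hT : Nonanticipating T)
    (hT0 : ∀ g, 0 ≤ T g) {b : ℝ} (hb : 0 ≤ b) :
    ∫⁻ g, ENNReal.ofReal r ^ arrivalCount (epochs g) (T g + b) ∂(poissonGaps lam) =
      (∫⁻ g, ENNReal.ofReal r ^ arrivalCount (epochs g) (T g) ∂(poissonGaps lam)) *
        ENNReal.ofReal (Real.exp (-(lam * (1 - r) * b))) := by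
  have h := strong_markov hlam hTm (fun g _ => hT0 g)
    (Φ := fun g => ENNReal.ofReal r ^ arrivalCount (epochs g) (T g))
    (measurable_ennreal_pow _ (measurable_arrivalCount measurable_epochs hTm))
    (fun g g' hg hg' hgg => by
      have h1 := hT g g' hg hg' hgg
      refine ⟨h1, ?_⟩
      rw [h1, hgg _ le_rfl])
    (Ψ := fun a => ENNReal.ofReal r ^ arrivalCount a b)
    (measurable_ennreal_pow _ (measurable_arrivalCount measurable_id measurable_const))
  rw [lintegral_pow_arrivalCount_const hlam hr0 hr1 hb] at h
  rw [← h]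
  refine lintegral_congr_ae ((ae_isGapSeq hlam).mono fun g hg => ?_)
  simp only
  rw [hg.isArrivalSeq.arrivalCount_add _ hb, pow_add]

/-! ### The random input of one cycle -/

/-- The service times, the vacation randomness and the de-activation variables of all cycles. -/
abbrev Marks (Θ : Type*) : Type _ := (ℕ → ℝ) × (ℕ → Θ) × (ℕ → ℝ)

/-- The service time, the vacation randomness and the de-activation variable of one cycle. -/
abbrev Mark (Θ : Type*) : Type _ := ℝ × Θ × ℝ

/-- The input of the cycle with index `n`. -/
def mark {Θ : Type*} (w : Marks Θ) (n : ℕ) : Mark Θ := (w.1 n, w.2.1 n, w.2.2 n)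

/-- The uniform law on `[0, 1]`. -/
abbrev unif : Measure ℝ := (volume : Measure ℝ).restrict (Icc 0 1)

instance : IsProbabilityMeasure unif := ⟨by simp⟩

/-- The law of the input of one cycle. -/
abbrev markLaw {Θ : Type*} [MeasurableSpace Θ] (β : Measure ℝ) (θ : Measure Θ) :
    Measure (Mark Θ) := β.prod (θ.prod unif)

/-- The joint law of the inputs of all cycles. -/
abbrev marksLaw {Θ : Type*} [MeasurableSpace Θ] (β : Measure ℝ) (θ : Measure Θ) :
    Measure (Marks Θ) :=
  (Measure.infinitePi fun _ => β).prod ((Measure.infinitePi fun _ => θ).prod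
    (Measure.infinitePi fun _ => unif))

/-- Under the law `P`, the variable `c` with law `m` is independent of everything that respects the
relation `past`. -/
def IndepOfPast {W M : Type*} [MeasurableSpace W] [MeasurableSpace M] (P : Measure W)
    (m : Measure M) (c : W → M) (past : W → W → Prop) : Prop :=
  ∀ F : W → M → ℝ≥0∞, (Measurable fun p : W × M => F p.1 p.2) →
    (∀ w w' y, past w w' → F w y = F w' y) →
    ∫⁻ w, F w (c w) ∂P = ∫⁻ w, ∫⁻ y, F w y ∂m ∂P

lemma indepOfPast_infinitePi {E : Type*} [MeasurableSpace E] (μ : Measure E)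
    [IsProbabilityMeasure μ] (n : ℕ) :
    IndepOfPast (Measure.infinitePi fun _ : ℕ => μ) μ (fun x => x n)
      (fun x x' => ∀ j < n, x j = x' j) :=
  fun F hF h => lintegral_past_present μ n F hF h

lemma IndepOfPast.prod {W₁ M₁ W₂ M₂ : Type*} [MeasurableSpace W₁] [MeasurableSpace M₁]
    [MeasurableSpace W₂] [MeasurableSpace M₂] {P₁ : Measure W₁} {m₁ : Measure M₁} {c₁ : W₁ → M₁}
    {R₁ : W₁ → W₁ → Prop} {P₂ : Measure W₂} {m₂ : Measure M₂} {c₂ : W₂ → M₂}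
    {R₂ : W₂ → W₂ → Prop} [SFinite P₁] [SFinite P₂] [SFinite m₁] [SFinite m₂]
    (h₁ : IndepOfPast P₁ m₁ c₁ R₁) (h₂ : IndepOfPast P₂ m₂ c₂ R₂)
    (hc₁ : Measurable c₁) (hc₂ : Measurable c₂) (hR₁ : ∀ w, R₁ w w) (hR₂ : ∀ w, R₂ w w) :
    IndepOfPast (P₁.prod P₂) (m₁.prod m₂) (fun w => (c₁ w.1, c₂ w.2))
      (fun w w' => R₁ w.1 w'.1 ∧ R₂ w.2 w'.2) := by
  intro F hF hpast
  have hFc : Measurable fun w : W₁ × W₂ => F w (c₁ w.1, c₂ w.2) :=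
    hF.comp (measurable_id.prodMk ((hc₁.comp measurable_fst).prodMk (hc₂.comp measurable_snd)))
  have hA : Measurable fun p : ((W₁ × W₂) × M₁) × M₂ => F p.1.1 (p.1.2, p.2) :=
    hF.comp ((measurable_fst.comp measurable_fst).prodMk
      ((measurable_snd.comp measurable_fst).prodMk measurable_snd))
  have hB : Measurable fun p : (W₁ × M₁) × W₂ => ∫⁻ y, F (p.1.1, p.2) (p.1.2, y) ∂m₂ := by
    refine Measurable.lintegral_prod_right'
      (f := fun q : ((W₁ × M₁) × W₂) × M₂ => F (q.1.1.1, q.1.2) (q.1.1.2, q.2)) ?_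
    exact hF.comp (f := fun q : ((W₁ × M₁) × W₂) × M₂ => ((q.1.1.1, q.1.2), (q.1.1.2, q.2)))
      (by fun_prop)
  rw [lintegral_prod _ hFc.aemeasurable]
  have e1 : ∀ x, ∫⁻ y, F (x, y) (c₁ x, c₂ y) ∂P₂ =
      ∫⁻ y, ∫⁻ n, F (x, y) (c₁ x, n) ∂m₂ ∂P₂ := fun x =>
    h₂ (fun y n => F (x, y) (c₁ x, n))
      (hF.comp (f := fun q : W₂ × M₂ => ((x, q.1), (c₁ x, q.2))) (by fun_prop))
      (fun w w' y h => hpast _ _ _ ⟨hR₁ _, h⟩)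
  simp_rw [e1]
  rw [h₁ (fun x m => ∫⁻ y, ∫⁻ n, F (x, y) (m, n) ∂m₂ ∂P₂) hB.lintegral_prod_right'
    (fun w w' y h => by
      refine lintegral_congr fun v => lintegral_congr fun n => hpast _ _ _ ⟨h, hR₂ _⟩)]
  rw [lintegral_prod _ (hF.lintegral_prod_right' (ν := m₁.prod m₂)).aemeasurable]
  refine lintegral_congr fun x => ?_
  have hsw : AEMeasurable (Function.uncurry fun (m : M₁) (y : W₂) => ∫⁻ n, F (x, y) (m, n) ∂m₂)
      (m₁.prod P₂) :=
    (hB.comp ((measurable_const.prodMk measurable_fst).prodMk measurable_snd)).aemeasurable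
  rw [lintegral_lintegral_swap hsw]
  refine lintegral_congr fun y => ?_
  exact (lintegral_prod (f := fun p => F (x, y) p)
    (hF.comp (measurable_const.prodMk measurable_id)).aemeasurable).symm

variable {Θ : Type*} [MeasurableSpace Θ]

lemma measurable_mark (n : ℕ) : Measurable fun w : Marks Θ => mark w n := by
  unfold mark
  fun_prop

lemma indepOfPast_marks (β : Measure ℝ) [IsProbabilityMeasure β] (θ : Measure Θ)
    [IsProbabilityMeasure θ] (n : ℕ) :
    IndepOfPast (marksLaw β θ) (markLaw β θ) (fun w => mark w n)
      (fun w w' => ∀ j < n, mark w j = mark w' j) := by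
  have h := (indepOfPast_infinitePi β n).prod ((indepOfPast_infinitePi θ n).prod
    (indepOfPast_infinitePi unif n) (measurable_pi_apply n) (measurable_pi_apply n)
    (fun _ _ _ => rfl) (fun _ _ _ => rfl)) (measurable_pi_apply n)
    (((measurable_pi_apply n).comp measurable_fst).prodMk
      ((measurable_pi_apply n).comp measurable_snd))
    (fun _ _ _ => rfl) (fun _ => ⟨fun _ _ => rfl, fun _ _ => rfl⟩)
  refine fun F hF hpast => h F hF fun w w' y hw => hpast w w' y fun j hj => ?_
  simp only [mark, hw.1 j hj, hw.2.1 j hj, hw.2.2 j hj]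

/-! ### Vacations -/

/-- The time between a service completion that leaves `z` customers and the start of the next
service, for the input `m` of the cycle and the arrival epochs `a`, measured from the completion:
the length of the vacation if there is one, and zero otherwise. -/
def idleTime (ψ : ℕ → ℝ) (R : VacationRule Θ) (z : ℕ) (m : Mark Θ) (a : ℕ → ℝ) : ℝ :=
  if m.2.2 < ψ z then R.length z m.2.1 a else 0

lemma idleTime_nonneg (ψ : ℕ → ℝ) (R : VacationRule Θ) (z : ℕ) (m : Mark Θ) (a : ℕ → ℝ) :
    0 ≤ idleTime ψ R z m a := by
  unfold idleTime
  split_ifs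
  exacts [R.length_nonneg _ _ _, le_rfl]

lemma idleTime_congr (ψ : ℕ → ℝ) (R : VacationRule Θ) (z : ℕ) (m : Mark Θ) {a a' : ℕ → ℝ}
    (ha : IsArrivalSeq a) (ha' : IsArrivalSeq a')
    (h : ∀ t ≤ idleTime ψ R z m a, arrivalCount a' t = arrivalCount a t) :
    idleTime ψ R z m a' = idleTime ψ R z m a := by
  unfold idleTime at h ⊢
  split_ifs at h ⊢
  · exact R.nonanticipating _ _ _ _ ha ha' h
  · rfl

lemma nonanticipating_idleTime (ψ : ℕ → ℝ) (R : VacationRule Θ) (z : ℕ) (m : Mark Θ) :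
    Nonanticipating fun g => idleTime ψ R z m (epochs g) :=
  fun _ _ hg hg' h => idleTime_congr ψ R z m hg.isArrivalSeq hg'.isArrivalSeq h

lemma measurable_idleTime {γ : Type*} [MeasurableSpace γ] (ψ : ℕ → ℝ) (R : VacationRule Θ)
    {z : γ → ℕ} {m : γ → Mark Θ} {a : γ → ℕ → ℝ} (hz : Measurable z) (hm : Measurable m)
    (ha : Measurable a) : Measurable fun x => idleTime ψ R (z x) (m x) (a x) := by
  have h : Measurable fun p : ℕ × (Mark Θ × (ℕ → ℝ)) => idleTime ψ R p.1 p.2.1 p.2.2 := by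
    refine measurable_from_prod_countable_right fun n => ?_
    refine Measurable.ite (measurableSet_lt (by fun_prop) (measurable_const (a := ψ n))) ?_
      measurable_const
    exact (R.measurable_length n).comp (f := fun p : Mark Θ × (ℕ → ℝ) => (p.1.2.1, p.2))
      (by fun_prop)
  exact h.comp (hz.prodMk (hm.prodMk ha))

lemma lintegral_ite_unif (θ : Measure Θ) [IsProbabilityMeasure θ] {p : ℝ} (hp0 : 0 ≤ p)
    (hp1 : p ≤ 1) {Q : Θ → ℝ≥0∞} (hQ : Measurable Q) (c : ℝ≥0∞) :
    ∫⁻ x, (if x.2 < p then Q x.1 else c) ∂(θ.prod unif) =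
      ENNReal.ofReal p * ∫⁻ u, Q u ∂θ + ENNReal.ofReal (1 - p) * c := by
  have hm : Measurable fun x : Θ × ℝ => if x.2 < p then Q x.1 else c :=
    Measurable.ite (measurableSet_lt measurable_snd measurable_const) (hQ.comp measurable_fst)
      measurable_const
  have h1 : unif (Iio p) = ENNReal.ofReal p := by
    rw [Measure.restrict_apply measurableSet_Iio]
    have : Iio p ∩ Icc 0 1 = Ico 0 p := by
      ext x
      simp only [mem_inter_iff, mem_Iio, mem_Icc, mem_Ico]
      constructor
      · exact fun h => ⟨h.2.1, h.1⟩
      · exact fun h => ⟨h.2, h.1, by linarith [h.2]⟩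
    rw [this, Real.volume_Ico, sub_zero]
  have h2 : unif (Ici p) = ENNReal.ofReal (1 - p) := by
    rw [Measure.restrict_apply measurableSet_Ici]
    have : Ici p ∩ Icc 0 1 = Icc p 1 := by
      ext x
      simp only [mem_inter_iff, mem_Ici, mem_Icc]
      constructor
      · exact fun h => ⟨h.1, h.2.2⟩
      · exact fun h => ⟨h.1, by linarith [h.1], h.2⟩
    rw [this, Real.volume_Icc]
  rw [lintegral_prod _ hm.aemeasurable]
  have e : ∀ u, ∫⁻ v, (if v < p then Q u else c) ∂unif =
      ENNReal.ofReal p * Q u + ENNReal.ofReal (1 - p) * c := by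
    intro u
    have e1 : ∀ v : ℝ, (if v < p then Q u else c) =
        (Iio p).indicator (fun _ => Q u) v + (Ici p).indicator (fun _ => c) v := by
      intro v
      by_cases hv : v < p
      · simp [hv]
      · simp [hv, not_lt.1 hv]
    simp_rw [e1]
    rw [lintegral_add_left (measurable_const.indicator measurableSet_Iio),
      lintegral_indicator_const measurableSet_Iio, lintegral_indicator_const measurableSet_Ici,
      h1, h2, mul_comm, mul_comm c]
  simp_rw [e]
  rw [lintegral_add_right _ measurable_const, lintegral_const_mul _ hQ]
  simp

lemma isProbabilityMeasure_vacationArrivals {lam : ℝ} (hlam : 0 < lam) (θ : Measure Θ)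
    [IsProbabilityMeasure θ] (R : VacationRule Θ) (z : ℕ) :
    IsProbabilityMeasure (vacationArrivals lam θ R z) := by
  have := isProbabilityMeasure_poissonGaps hlam
  refine Measure.isProbabilityMeasure_map (Measurable.aemeasurable ?_)
  exact measurable_arrivalCount (measurable_epochs.comp measurable_snd)
    ((R.measurable_length z).comp (measurable_fst.prodMk (measurable_epochs.comp measurable_snd)))

lemma lintegral_vacationArrivals {lam : ℝ} (hlam : 0 < lam) (θ : Measure Θ)
    [IsProbabilityMeasure θ] (R : VacationRule Θ) (z : ℕ) (f : ℕ → ℝ≥0∞) :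
    ∫⁻ n, f n ∂(vacationArrivals lam θ R z) =
      ∫⁻ u, ∫⁻ g, f (arrivalCount (epochs g) (R.length z u (epochs g))) ∂(poissonGaps lam) ∂θ := by
  have := isProbabilityMeasure_poissonGaps hlam
  have hm : Measurable fun p : Θ × (ℕ → ℝ) =>
      arrivalCount (epochs p.2) (R.length z p.1 (epochs p.2)) :=
    measurable_arrivalCount (measurable_epochs.comp measurable_snd)
      ((R.measurable_length z).comp (measurable_fst.prodMk (measurable_epochs.comp measurable_snd)))
  rw [vacationArrivals, lintegral_map (measurable_of_countable f) hm,
    lintegral_prod (fun p : Θ × (ℕ → ℝ) => f (arrivalCount (epochs p.2)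
      (R.length z p.1 (epochs p.2)))) ((measurable_of_countable f).comp hm).aemeasurable]

lemma ofReal_lst (β : Measure ℝ) [IsProbabilityMeasure β] (hβ : β (Iio 0) = 0) {s : ℝ}
    (hs : 0 ≤ s) : ∫⁻ x, ENNReal.ofReal (Real.exp (-(s * x))) ∂β = ENNReal.ofReal (lst β s) := by
  have hpos : ∀ᵐ x ∂β, 0 ≤ x := by
    filter_upwards [measure_eq_zero_iff_ae_notMem.1 hβ] with x hx using not_lt.1 hx
  rw [lst, ofReal_integral_eq_lintegral_ofReal]
  · refine (integrable_const (1 : ℝ)).mono' (by fun_prop) ?_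
    filter_upwards [hpos] with x hx
    rw [Real.norm_eq_abs, abs_of_pos (Real.exp_pos _), Real.exp_le_one_iff]
    nlinarith [mul_nonneg hs hx]
  · exact ae_of_all _ fun x => (Real.exp_pos _).le

/-- The generating function of the number of arrivals during a cycle that starts with `z`
customers. -/
lemma lintegral_pow_cycle {lam : ℝ} (hlam : 0 < lam) (β : Measure ℝ) [IsProbabilityMeasure β]
    (hβ : β (Iio 0) = 0) (θ : Measure Θ) [IsProbabilityMeasure θ] (R : VacationRule Θ)
    {ψ : ℕ → ℝ} {z : ℕ} (hψ0 : 0 ≤ ψ z) (hψ1 : ψ z ≤ 1) {r : ℝ} (hr0 : 0 ≤ r) (hr1 : r ≤ 1) :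
    ∫⁻ m, ∫⁻ g, ENNReal.ofReal r ^
        arrivalCount (epochs g) (idleTime ψ R z m (epochs g) + m.1) ∂(poissonGaps lam)
        ∂(markLaw β θ) =
      ENNReal.ofReal (lst β (lam * (1 - r))) *
        (ENNReal.ofReal (ψ z) * ∫⁻ n, ENNReal.ofReal r ^ n ∂(vacationArrivals lam θ R z) +
          ENNReal.ofReal (1 - ψ z)) := by
  have := isProbabilityMeasure_poissonGaps hlam
  have hpos : ∀ᵐ x ∂β, 0 ≤ x := by
    filter_upwards [measure_eq_zero_iff_ae_notMem.1 hβ] with x hx using not_lt.1 hx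
  have hpos' : ∀ᵐ m ∂(markLaw β θ), 0 ≤ m.1 := Measure.quasiMeasurePreserving_fst.ae hpos
  set A : Θ → ℝ≥0∞ := fun u => ∫⁻ g, ENNReal.ofReal r ^
    arrivalCount (epochs g) (R.length z u (epochs g)) ∂(poissonGaps lam) with hA
  have hAm : Measurable A := by
    refine Measurable.lintegral_prod_right' (f := fun p : Θ × (ℕ → ℝ) =>
      ENNReal.ofReal r ^ arrivalCount (epochs p.2) (R.length z p.1 (epochs p.2))) ?_
    exact measurable_ennreal_pow _ (measurable_arrivalCount (measurable_epochs.comp measurable_snd)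
      ((R.measurable_length z).comp (measurable_fst.prodMk (measurable_epochs.comp measurable_snd))))
  have hBm : Measurable fun x : Θ × ℝ => if x.2 < ψ z then A x.1 else 1 :=
    Measurable.ite (measurableSet_lt measurable_snd measurable_const) (hAm.comp measurable_fst)
      measurable_const
  have e : ∀ᵐ m ∂(markLaw β θ), ∫⁻ g, ENNReal.ofReal r ^
      arrivalCount (epochs g) (idleTime ψ R z m (epochs g) + m.1) ∂(poissonGaps lam) =
      ENNReal.ofReal (Real.exp (-(lam * (1 - r) * m.1))) *
        (if m.2.2 < ψ z then A m.2.1 else 1) := by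
    filter_upwards [hpos'] with m hm
    rw [lintegral_pow_arrivalCount_add hlam hr0 hr1
      (measurable_idleTime ψ R measurable_const measurable_const measurable_epochs)
      (nonanticipating_idleTime ψ R z m) (fun g => idleTime_nonneg _ _ _ _ _) hm, mul_comm]
    congr 1
    unfold idleTime
    split_ifs with h
    · rfl
    · rw [lintegral_congr_ae (g := fun _ => 1)]
      · simp
      · exact (ae_isGapSeq hlam).mono fun g hg => by simp [hg.isArrivalSeq.arrivalCount_zero]
  have hem : Measurable fun b : ℝ => ENNReal.ofReal (Real.exp (-(lam * (1 - r) * b))) := by fun_prop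
  rw [lintegral_congr_ae e, lintegral_prod_mul hem.aemeasurable hBm.aemeasurable,
    ofReal_lst β hβ (mul_nonneg hlam.le (by linarith)), lintegral_ite_unif θ hψ0 hψ1 hAm, mul_one,
    lintegral_vacationArrivals hlam]

/-- The mean length of a cycle that starts with `z` customers, in terms of the mean numbers of
arrivals. -/
lemma lintegral_cycle_length {lam : ℝ} (hlam : 0 < lam) (β : Measure ℝ) [IsProbabilityMeasure β]
    (hβ : β (Iio 0) = 0) (hβi : Integrable (fun x => x) β) (θ : Measure Θ)
    [IsProbabilityMeasure θ] (R : VacationRule Θ)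
    {ψ : ℕ → ℝ} {z : ℕ} (hψ0 : 0 ≤ ψ z) (hψ1 : ψ z ≤ 1) :
    ENNReal.ofReal lam * ∫⁻ m, ∫⁻ g, ENNReal.ofReal (idleTime ψ R z m (epochs g) + m.1)
        ∂(poissonGaps lam) ∂(markLaw β θ) =
      ENNReal.ofReal (load lam β) +
        ENNReal.ofReal (ψ z) * ∫⁻ n, (n : ℝ≥0∞) ∂(vacationArrivals lam θ R z) := by
  have := isProbabilityMeasure_poissonGaps hlam
  have hpos : ∀ᵐ x ∂β, 0 ≤ x := by
    filter_upwards [measure_eq_zero_iff_ae_notMem.1 hβ] with x hx using not_lt.1 hx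
  have hpos' : ∀ᵐ m ∂(markLaw β θ), 0 ≤ m.1 := Measure.quasiMeasurePreserving_fst.ae hpos
  set A : Θ → ℝ≥0∞ := fun u => ∫⁻ g, ENNReal.ofReal (R.length z u (epochs g)) ∂(poissonGaps lam)
    with hA
  have hAm : Measurable A := by
    refine Measurable.lintegral_prod_right' (f := fun p : Θ × (ℕ → ℝ) =>
      ENNReal.ofReal (R.length z p.1 (epochs p.2))) ?_
    exact ((R.measurable_length z).comp
      (measurable_fst.prodMk (measurable_epochs.comp measurable_snd))).ennreal_ofReal
  have hBm : Measurable fun x : Θ × ℝ => if x.2 < ψ z then A x.1 else 0 :=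
    Measurable.ite (measurableSet_lt measurable_snd measurable_const) (hAm.comp measurable_fst)
      measurable_const
  have e : ∀ᵐ m ∂(markLaw β θ), ∫⁻ g, ENNReal.ofReal (idleTime ψ R z m (epochs g) + m.1)
      ∂(poissonGaps lam) =
      ENNReal.ofReal m.1 + (if m.2.2 < ψ z then A m.2.1 else 0) := by
    filter_upwards [hpos'] with m hm
    simp_rw [ENNReal.ofReal_add (idleTime_nonneg ψ R z m _) hm]
    rw [lintegral_add_right _ measurable_const, add_comm, lintegral_const, measure_univ, mul_one]
    congr 1
    unfold idleTime
    split_ifs with h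
    · rfl
    · simp
  have hw : ∀ u, ENNReal.ofReal lam * A u = ∫⁻ g,
      (arrivalCount (epochs g) (R.length z u (epochs g)) : ℝ≥0∞) ∂(poissonGaps lam) := by
    intro u
    refine (lintegral_arrivalCount hlam ?_ ?_).symm
    · exact (R.measurable_length z).comp (measurable_const.prodMk measurable_epochs)
    · exact fun g g' hg hg' h => R.nonanticipating _ _ _ _ hg.isArrivalSeq hg'.isArrivalSeq h
  have hfm : Measurable fun m : Mark Θ => ENNReal.ofReal m.1 := by fun_prop
  have hsm : Measurable fun m : Mark Θ => if m.2.2 < ψ z then A m.2.1 else 0 :=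
    hBm.comp measurable_snd
  have h1 : ∫⁻ m, ENNReal.ofReal m.1 ∂(markLaw β θ) = ENNReal.ofReal (∫ x, x ∂β) := by
    rw [lintegral_prod _ hfm.aemeasurable]
    simp only [lintegral_const, measure_univ, mul_one]
    rw [ofReal_integral_eq_lintegral_ofReal hβi hpos]
  have h2 : ∫⁻ m, (if m.2.2 < ψ z then A m.2.1 else 0) ∂(markLaw β θ) =
      ENNReal.ofReal (ψ z) * ∫⁻ u, A u ∂θ := by
    rw [lintegral_prod _ hsm.aemeasurable]
    simp only [lintegral_const, measure_univ, mul_one]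
    rw [lintegral_ite_unif θ hψ0 hψ1 hAm, mul_zero, add_zero]
  rw [lintegral_congr_ae e, lintegral_add_left hfm, h1, h2, mul_add, load,
    ENNReal.ofReal_mul hlam.le, lintegral_vacationArrivals hlam, mul_left_comm,
    ← lintegral_const_mul _ hAm]
  simp_rw [hw]

/-! ### The queue at service completions -/

/-- The number of customers left behind by the `n`-th service completion. -/
def left (ψ : ℕ → ℝ) (R : VacationRule Θ) (k : ℕ) (ω : Sample Θ) (n : ℕ) : ℕ :=
  k + arrivalCount (epochs ω.1) (departure ψ R k ω n) - n

/-- The time between the completions with index `n` and `n + 1`. -/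
def cycleLength (ψ : ℕ → ℝ) (R : VacationRule Θ) (k : ℕ) (ω : Sample Θ) (n : ℕ) : ℝ :=
  idleTime ψ R (left ψ R k ω n) (mark ω.2 n)
    (arrivalsAfter (epochs ω.1) (departure ψ R k ω n)) + (mark ω.2 n).1

/-- The number of arrivals between the completions with index `n` and `n + 1`. -/
def cycleArrivals (ψ : ℕ → ℝ) (R : VacationRule Θ) (k : ℕ) (ω : Sample Θ) (n : ℕ) : ℕ :=
  arrivalCount (arrivalsAfter (epochs ω.1) (departure ψ R k ω n)) (cycleLength ψ R k ω n)

lemma departure_zero (ψ : ℕ → ℝ) (R : VacationRule Θ) (k : ℕ) (ω : Sample Θ) :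
    departure ψ R k ω 0 = 0 := rfl

lemma departure_succ (ψ : ℕ → ℝ) (R : VacationRule Θ) (k : ℕ) (ω : Sample Θ) (n : ℕ) :
    departure ψ R k ω (n + 1) = departure ψ R k ω n + cycleLength ψ R k ω n :=
  add_assoc _ _ _

lemma cycleLength_nonneg (ψ : ℕ → ℝ) (R : VacationRule Θ) (k : ℕ) {ω : Sample Θ}
    (hω : ∀ n, 0 ≤ ω.2.1 n) (n : ℕ) : 0 ≤ cycleLength ψ R k ω n :=
  add_nonneg (idleTime_nonneg _ _ _ _ _) (hω n)

lemma departure_mono (ψ : ℕ → ℝ) (R : VacationRule Θ) (k : ℕ) {ω : Sample Θ}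
    (hω : ∀ n, 0 ≤ ω.2.1 n) : Monotone (departure ψ R k ω) :=
  monotone_nat_of_le_succ fun n => by
    rw [departure_succ]
    linarith [cycleLength_nonneg ψ R k hω n]

lemma departure_nonneg (ψ : ℕ → ℝ) (R : VacationRule Θ) (k : ℕ) {ω : Sample Θ}
    (hω : ∀ n, 0 ≤ ω.2.1 n) (n : ℕ) : 0 ≤ departure ψ R k ω n :=
  departure_mono ψ R k hω (Nat.zero_le n)

lemma departure_congr_marks (ψ : ℕ → ℝ) (R : VacationRule Θ) (k : ℕ) (g : ℕ → ℝ) {w w' : Marks Θ}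
    {n : ℕ} (h : ∀ j < n, mark w j = mark w' j) :
    departure ψ R k (g, w) n = departure ψ R k (g, w') n := by
  induction n with
  | zero => rfl
  | succ n ih =>
    have h1 := ih fun j hj => h j (by omega)
    rw [departure_succ, departure_succ]
    simp only [cycleLength, left, h1, h n (by omega)]

lemma departure_congr_gaps (ψ : ℕ → ℝ) (R : VacationRule Θ) (k : ℕ) {w : Marks Θ}
    (hw : ∀ n, 0 ≤ w.1 n) {g g' : ℕ → ℝ} (hg : IsGapSeq g) (hg' : IsGapSeq g') (n : ℕ)
    (h : ∀ t ≤ departure ψ R k (g, w) n,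
      arrivalCount (epochs g') t = arrivalCount (epochs g) t) :
    departure ψ R k (g', w) n = departure ψ R k (g, w) n := by
  induction n with
  | zero => rfl
  | succ n ih =>
    have hmono := departure_mono ψ R k (ω := (g, w)) hw n.le_succ
    have h1 := ih fun t ht => h t (ht.trans hmono)
    rw [departure_succ] at h ⊢
    rw [departure_succ]
    have h2 : left ψ R k (g', w) n = left ψ R k (g, w) n := by
      simp only [left, h1]
      rw [h _ (by linarith [cycleLength_nonneg ψ R k (ω := (g, w)) hw n])]
    rw [h1]
    congr 1
    simp only [cycleLength, h1, h2]
    congr 1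
    refine idleTime_congr ψ R _ _ (hg.isArrivalSeq.arrivalsAfter _)
      (hg'.isArrivalSeq.arrivalsAfter _) fun t ht => ?_
    refine hg.isArrivalSeq.arrivalsAfter_congr hg'.isArrivalSeq h t (ht.trans ?_)
    have : 0 ≤ (mark w n).1 := hw n
    simp only [cycleLength]
    linarith

lemma nonanticipating_departure (ψ : ℕ → ℝ) (R : VacationRule Θ) (k : ℕ) {w : Marks Θ}
    (hw : ∀ n, 0 ≤ w.1 n) (n : ℕ) : Nonanticipating fun g => departure ψ R k (g, w) n :=
  fun _ _ hg hg' h => departure_congr_gaps ψ R k hw hg hg' n h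

lemma measurable_left_of (ψ : ℕ → ℝ) (R : VacationRule Θ) (k n : ℕ)
    (h : Measurable fun ω => departure ψ R k ω n) : Measurable fun ω => left ψ R k ω n := by
  have h1 := measurable_arrivalCount (measurable_epochs.comp measurable_fst) h
  exact (measurable_of_countable fun c : ℕ => k + c - n).comp h1

lemma measurable_departure (ψ : ℕ → ℝ) (R : VacationRule Θ) (k n : ℕ) :
    Measurable fun ω => departure ψ R k ω n := by
  induction n with
  | zero => exact measurable_const
  | succ n ih =>
    simp only [departure_succ, cycleLength]
    refine ih.add (Measurable.add ?_ ?_)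
    · exact measurable_idleTime ψ R (measurable_left_of ψ R k n ih)
        ((measurable_mark n).comp measurable_snd)
        (measurable_arrivalsAfter (measurable_epochs.comp measurable_fst) ih)
    · exact measurable_fst.comp ((measurable_mark n).comp measurable_snd)

lemma measurable_left (ψ : ℕ → ℝ) (R : VacationRule Θ) (k n : ℕ) :
    Measurable fun ω => left ψ R k ω n :=
  measurable_left_of ψ R k n (measurable_departure ψ R k n)

lemma isProbabilityMeasure_sampleLaw {lam : ℝ} (hlam : 0 < lam) (β : Measure ℝ)
    [IsProbabilityMeasure β] (θ : Measure Θ) [IsProbabilityMeasure θ] :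
    IsProbabilityMeasure (sampleLaw lam β θ) := by
  have := isProbabilityMeasure_poissonGaps hlam
  unfold sampleLaw
  infer_instance

lemma sampleLaw_eq (lam : ℝ) (β : Measure ℝ) (θ : Measure Θ) :
    sampleLaw lam β θ = (poissonGaps lam).prod (marksLaw β θ) := rfl

lemma ae_marks_nonneg (β : Measure ℝ) [IsProbabilityMeasure β] (hβ : β (Iio 0) = 0)
    (θ : Measure Θ) [IsProbabilityMeasure θ] : ∀ᵐ w ∂(marksLaw β θ), ∀ n, 0 ≤ w.1 n := by
  have hpos : ∀ᵐ x ∂β, 0 ≤ x := by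
    filter_upwards [measure_eq_zero_iff_ae_notMem.1 hβ] with x hx using not_lt.1 hx
  refine Measure.quasiMeasurePreserving_fst.ae
    (p := fun b : ℕ → ℝ => ∀ n, 0 ≤ b n) (ae_all_iff.2 fun n => ?_)
  exact (measurePreserving_eval_infinitePi (fun _ : ℕ => β) n).quasiMeasurePreserving.ae hpos

/-- The regeneration of the arrivals at service completions: what happens in the cycle after the
`n`-th completion depends on the past only through the number of customers left behind. -/
lemma lintegral_cycle {lam : ℝ} (hlam : 0 < lam) (β : Measure ℝ) [IsProbabilityMeasure β]
    (hβ : β (Iio 0) = 0) (θ : Measure Θ) [IsProbabilityMeasure θ] (ψ : ℕ → ℝ) (R : VacationRule Θ)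
    (k n z : ℕ) {φ : ℝ → ℝ≥0∞} (hφ : Measurable φ) {Ψ : Mark Θ → (ℕ → ℝ) → ℝ≥0∞}
    (hΨ : Measurable fun p : Mark Θ × (ℕ → ℝ) => Ψ p.1 p.2) :
    ∫⁻ ω, (if left ψ R k ω n = z then φ (departure ψ R k ω n) else 0) *
        Ψ (mark ω.2 n) (arrivalsAfter (epochs ω.1) (departure ψ R k ω n)) ∂(sampleLaw lam β θ) =
      (∫⁻ ω, (if left ψ R k ω n = z then φ (departure ψ R k ω n) else 0) ∂(sampleLaw lam β θ)) *
        ∫⁻ m, ∫⁻ g, Ψ m (epochs g) ∂(poissonGaps lam) ∂(markLaw β θ) := by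
  have := isProbabilityMeasure_poissonGaps hlam
  set Φ : Sample Θ → ℝ≥0∞ := fun ω => if left ψ R k ω n = z then φ (departure ψ R k ω n) else 0
    with hΦ
  have hΦm : Measurable Φ :=
    Measurable.ite (measurable_left ψ R k n (measurableSet_singleton z))
      (hφ.comp (measurable_departure ψ R k n)) measurable_const
  have hDm := measurable_departure ψ R k n
  have haft : Measurable fun ω : Sample Θ => arrivalsAfter (epochs ω.1) (departure ψ R k ω n) :=
    measurable_arrivalsAfter (measurable_epochs.comp measurable_fst) hDm
  have hJ : Measurable fun p : Sample Θ × Mark Θ =>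
      Φ p.1 * Ψ p.2 (arrivalsAfter (epochs p.1.1) (departure ψ R k p.1 n)) :=
    (hΦm.comp measurable_fst).mul
      (hΨ.comp (measurable_snd.prodMk (haft.comp measurable_fst)))
  have hI : Measurable fun ω : Sample Θ =>
      Φ ω * Ψ (mark ω.2 n) (arrivalsAfter (epochs ω.1) (departure ψ R k ω n)) :=
    hJ.comp (f := fun ω : Sample Θ => (ω, mark ω.2 n))
      (measurable_id.prodMk ((measurable_mark n).comp measurable_snd))
  change ∫⁻ ω, Φ ω * Ψ (mark ω.2 n) (arrivalsAfter (epochs ω.1) (departure ψ R k ω n))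
    ∂(sampleLaw lam β θ) = (∫⁻ ω, Φ ω ∂(sampleLaw lam β θ)) * _
  rw [sampleLaw_eq, lintegral_prod _ hI.aemeasurable, lintegral_prod_symm _ hΦm.aemeasurable]
  -- For given arrivals, the input of the cycle is integrated out; then the strong Markov property
  -- applies for given inputs of all cycles.
  have e1 : ∀ g : ℕ → ℝ, ∫⁻ w, Φ (g, w) *
      Ψ (mark w n) (arrivalsAfter (epochs g) (departure ψ R k (g, w) n)) ∂(marksLaw β θ) =
      ∫⁻ w, ∫⁻ m, Φ (g, w) *
        Ψ m (arrivalsAfter (epochs g) (departure ψ R k (g, w) n)) ∂(markLaw β θ)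
        ∂(marksLaw β θ) := by
    intro g
    refine indepOfPast_marks β θ n (fun w m => Φ (g, w) *
      Ψ m (arrivalsAfter (epochs g) (departure ψ R k (g, w) n))) ?_ ?_
    · exact hJ.comp (f := fun p : Marks Θ × Mark Θ => ((g, p.1), p.2))
        ((measurable_const.prodMk measurable_fst).prodMk measurable_snd)
    · intro w w' m hw
      have hd := departure_congr_marks ψ R k g hw
      have hl : left ψ R k (g, w) n = left ψ R k (g, w') n := by simp only [left, hd]
      simp only [hΦ]
      rw [hl, hd]
  simp_rw [e1]
  have hswap : AEMeasurable (Function.uncurry fun (g : ℕ → ℝ) (w : Marks Θ) =>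
      ∫⁻ m, Φ (g, w) * Ψ m (arrivalsAfter (epochs g) (departure ψ R k (g, w) n)) ∂(markLaw β θ))
      ((poissonGaps lam).prod (marksLaw β θ)) := (hJ.lintegral_prod_right').aemeasurable
  rw [lintegral_lintegral_swap hswap, ← lintegral_mul_const _ hΦm.lintegral_prod_left']
  refine lintegral_congr_ae ((ae_marks_nonneg β hβ θ).mono fun w hw => ?_)
  have hgw : Measurable fun g : ℕ → ℝ => (g, w) := measurable_id.prodMk measurable_const
  have hswap2 : AEMeasurable (Function.uncurry fun (g : ℕ → ℝ) (m : Mark Θ) =>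
      Φ (g, w) * Ψ m (arrivalsAfter (epochs g) (departure ψ R k (g, w) n)))
      ((poissonGaps lam).prod (markLaw β θ)) :=
    (hJ.comp ((hgw.comp measurable_fst).prodMk measurable_snd)).aemeasurable
  simp only
  rw [lintegral_lintegral_swap hswap2, ← lintegral_const_mul]
  · refine lintegral_congr fun m => ?_
    have hna := nonanticipating_departure ψ R k hw n
    refine strong_markov hlam (T := fun g => departure ψ R k (g, w) n) (hDm.comp hgw)
      (fun g _ => departure_nonneg ψ R k hw n) (Φ := fun g => Φ (g, w)) (hΦm.comp hgw) ?_
      (Ψ := Ψ m) (hΨ.comp (measurable_const.prodMk measurable_id))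
    intro g g' hg hg' hgg
    have h1 := hna g g' hg hg' hgg
    refine ⟨h1, ?_⟩
    have h2 := hgg _ le_rfl
    simp only at h1
    have hl : left ψ R k (g', w) n = left ψ R k (g, w) n := by simp only [left, h1, h2]
    simp only [hΦ]
    rw [hl, h1]
  · exact Measurable.lintegral_prod_right' (f := fun p : Mark Θ × (ℕ → ℝ) => Ψ p.1 (epochs p.2))
      (hΨ.comp (measurable_fst.prodMk (measurable_epochs.comp measurable_snd)))

/-- The expected number of service completions up to time `t` (including the one at time `0`) that
leave `z` customers behind. -/
def visits (lam : ℝ) (β : Measure ℝ) (θ : Measure Θ) (ψ : ℕ → ℝ) (R : VacationRule Θ) (k : ℕ)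
    (t : ℝ) (z : ℕ) : ℝ≥0∞ :=
  ∑' n, ∫⁻ ω, (if left ψ R k ω n = z then (if departure ψ R k ω n ≤ t then 1 else 0) else 0)
    ∂(sampleLaw lam β θ)

/-- The expected total contribution of the cycles that begin up to time `t`. -/
lemma tsum_lintegral_cycles {lam : ℝ} (hlam : 0 < lam) (β : Measure ℝ) [IsProbabilityMeasure β]
    (hβ : β (Iio 0) = 0) (θ : Measure Θ) [IsProbabilityMeasure θ] (ψ : ℕ → ℝ) (R : VacationRule Θ)
    (k : ℕ) (t : ℝ) {Ψ : ℕ → Mark Θ → (ℕ → ℝ) → ℝ≥0∞}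
    (hΨ : ∀ z, Measurable fun p : Mark Θ × (ℕ → ℝ) => Ψ z p.1 p.2) :
    ∑' n, ∫⁻ ω, (if departure ψ R k ω n ≤ t then Ψ (left ψ R k ω n) (mark ω.2 n)
        (arrivalsAfter (epochs ω.1) (departure ψ R k ω n)) else 0) ∂(sampleLaw lam β θ) =
      ∑' z, visits lam β θ ψ R k t z *
        ∫⁻ m, ∫⁻ g, Ψ z m (epochs g) ∂(poissonGaps lam) ∂(markLaw β θ) := by
  have hφ : Measurable fun d : ℝ => if d ≤ t then (1 : ℝ≥0∞) else 0 :=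
    Measurable.ite measurableSet_Iic measurable_const measurable_const
  have haft : ∀ n, Measurable fun ω : Sample Θ =>
      arrivalsAfter (epochs ω.1) (departure ψ R k ω n) := fun n =>
    measurable_arrivalsAfter (measurable_epochs.comp measurable_fst) (measurable_departure ψ R k n)
  simp_rw [visits, ← ENNReal.tsum_mul_right]
  rw [ENNReal.tsum_comm]
  refine tsum_congr fun n => ?_
  simp_rw [← lintegral_cycle hlam β hβ θ ψ R k n _ hφ (hΨ _)]
  rw [← lintegral_tsum]
  · refine lintegral_congr fun ω => ?_
    rw [tsum_eq_single (left ψ R k ω n) fun z hz => by rw [if_neg hz.symm, zero_mul], if_pos rfl]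
    split_ifs <;> simp
  · intro z
    refine (Measurable.mul ?_ ?_).aemeasurable
    · exact Measurable.ite (measurable_left ψ R k n (measurableSet_singleton z))
        (hφ.comp (measurable_departure ψ R k n)) measurable_const
    · exact (hΨ z).comp (((measurable_mark n).comp measurable_snd).prodMk (haft n))

/-! ### Regular samples -/

/-- The properties that almost all samples have: a genuine sequence of arrivals, nonnegative
service times, and a customer present for each service. -/
structure IsRegular (ψ : ℕ → ℝ) (R : VacationRule Θ) (k : ℕ) (ω : Sample Θ) : Prop where
  gaps : IsGapSeq ω.1
  service_nonneg : ∀ n, 0 ≤ ω.2.1 n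
  le_arrivals : ∀ n, n ≤ k + arrivalCount (epochs ω.1) (departure ψ R k ω n)

lemma arrivalCount_departure_succ (ψ : ℕ → ℝ) (R : VacationRule Θ) (k : ℕ) {ω : Sample Θ}
    (hg : IsGapSeq ω.1) (hb : ∀ n, 0 ≤ ω.2.1 n) (n : ℕ) :
    arrivalCount (epochs ω.1) (departure ψ R k ω (n + 1)) =
      arrivalCount (epochs ω.1) (departure ψ R k ω n) + cycleArrivals ψ R k ω n := by
  rw [departure_succ, hg.isArrivalSeq.arrivalCount_add _ (cycleLength_nonneg ψ R k hb n)]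
  rfl

lemma IsRegular.left_succ {ψ : ℕ → ℝ} {R : VacationRule Θ} {k : ℕ} {ω : Sample Θ}
    (h : IsRegular ψ R k ω) (n : ℕ) :
    left ψ R k ω (n + 1) + 1 = left ψ R k ω n + cycleArrivals ψ R k ω n := by
  have h1 := h.le_arrivals n
  have h2 := h.le_arrivals (n + 1)
  have h3 := arrivalCount_departure_succ ψ R k h.gaps h.service_nonneg n
  simp only [left]
  omega

lemma ae_isRegular {lam : ℝ} (hlam : 0 < lam) (β : Measure ℝ) [IsProbabilityMeasure β]
    (hβ : β (Iio 0) = 0) (θ : Measure Θ) [IsProbabilityMeasure θ] {ψ : ℕ → ℝ} (hψ : ψ 0 = 1)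
    (R : VacationRule Θ) (hR0 : (vacationArrivals lam θ R 0).real {0} = 0) (k : ℕ) :
    ∀ᵐ ω ∂(sampleLaw lam β θ), IsRegular ψ R k ω := by
  have := isProbabilityMeasure_poissonGaps hlam
  have := isProbabilityMeasure_vacationArrivals hlam θ R 0
  have h1 : ∀ᵐ ω ∂(sampleLaw lam β θ), IsGapSeq ω.1 :=
    Measure.quasiMeasurePreserving_fst.ae (ae_isGapSeq hlam)
  have h2 : ∀ᵐ ω ∂(sampleLaw lam β θ), ∀ n, 0 ≤ ω.2.1 n :=
    Measure.quasiMeasurePreserving_snd.ae (ae_marks_nonneg β hβ θ)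
  have hΨ : Measurable fun p : Mark Θ × (ℕ → ℝ) =>
      ENNReal.ofReal 0 ^ arrivalCount p.2 (idleTime ψ R 0 p.1 p.2 + p.1.1) :=
    measurable_ennreal_pow _ (measurable_arrivalCount measurable_snd
      ((measurable_idleTime ψ R measurable_const measurable_fst measurable_snd).add
        (measurable_fst.comp measurable_fst)))
  have h3 : ∀ᵐ ω ∂(sampleLaw lam β θ), ∀ n, left ψ R k ω n = 0 → cycleArrivals ψ R k ω n ≠ 0 := by
    rw [ae_all_iff]
    intro n
    -- The generating function of the arrivals in a cycle that starts with no customers vanishes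
    -- at `0`.
    have h4 := lintegral_cycle hlam β hβ θ ψ R k n 0 (φ := fun _ => 1) measurable_const
      (Ψ := fun m a => ENNReal.ofReal 0 ^ arrivalCount a (idleTime ψ R 0 m a + m.1)) hΨ
    rw [lintegral_pow_cycle hlam β hβ θ R (by rw [hψ]; exact zero_le_one) hψ.le le_rfl
      zero_le_one] at h4
    have h5 : ∫⁻ n, ENNReal.ofReal 0 ^ n ∂(vacationArrivals lam θ R 0) = 0 := by
      rw [lintegral_eq_zero_iff (measurable_of_countable _)]
      have h6 : vacationArrivals lam θ R 0 {0} = 0 := by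
        rwa [measureReal_eq_zero_iff] at hR0
      filter_upwards [measure_eq_zero_iff_ae_notMem.1 h6] with n hn
      simpa using hn
    rw [h5, hψ] at h4
    simp only [mul_zero, sub_self, ENNReal.ofReal_zero, add_zero] at h4
    rw [lintegral_eq_zero_iff] at h4
    · filter_upwards [h4] with ω hω h0 hc
      rw [if_pos h0, one_mul] at hω
      have hc' := hc
      unfold cycleArrivals cycleLength at hc'
      rw [h0] at hc'
      rw [hc'] at hω
      simp at hω
    · refine Measurable.mul (Measurable.ite (measurable_left ψ R k n (measurableSet_singleton 0))
        measurable_const measurable_const) ?_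
      have hm := measurable_arrivalsAfter
        (measurable_epochs.comp (measurable_fst (α := ℕ → ℝ) (β := Marks Θ)))
        (measurable_departure ψ R k n)
      have := hΨ.comp (((measurable_mark n).comp measurable_snd).prodMk hm)
      simpa only [ENNReal.ofReal_zero, Function.comp_def] using this
  filter_upwards [h1, h2, h3] with ω hg hb hc
  refine ⟨hg, hb, fun n => ?_⟩
  induction n with
  | zero => exact Nat.zero_le _
  | succ n ih =>
    have h4 := arrivalCount_departure_succ ψ R k hg hb n
    have h5 := hc n
    simp only [left] at h5
    omega

/-! ### Counting service completions -/

/-- The number of services completed up to time `t`. -/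
def departureCount (ψ : ℕ → ℝ) (R : VacationRule Θ) (k : ℕ) (ω : Sample Θ) (t : ℝ) : ℕ :=
  {n : ℕ | 1 ≤ n ∧ departure ψ R k ω n ≤ t}.ncard

/-- The number of services completed strictly before time `t`. -/
def departureCountBefore (ψ : ℕ → ℝ) (R : VacationRule Θ) (k : ℕ) (ω : Sample Θ) (t : ℝ) : ℕ :=
  {n : ℕ | 1 ≤ n ∧ departure ψ R k ω n < t}.ncard

lemma ncard_one_le (p : ℕ → Prop) : {n : ℕ | 1 ≤ n ∧ p n}.ncard = {n : ℕ | p (n + 1)}.ncard := by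
  rw [← ncard_image_of_injective {n : ℕ | p (n + 1)} Nat.succ_injective]
  congr 1
  ext n
  constructor
  · rintro ⟨h1, h2⟩
    exact ⟨n - 1, by simpa [Nat.sub_add_cancel h1] using h2, by simp; omega⟩
  · rintro ⟨m, hm, rfl⟩
    exact ⟨by simp, hm⟩

namespace IsRegular

variable {ψ : ℕ → ℝ} {R : VacationRule Θ} {k : ℕ} {ω : Sample Θ}

lemma departure_mono (h : IsRegular ψ R k ω) : Monotone (departure ψ R k ω) :=
  VacQueue.departure_mono ψ R k h.service_nonneg

lemma le_of_departure_le (h : IsRegular ψ R k ω) {n : ℕ} {t : ℝ} (hn : departure ψ R k ω n ≤ t) :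
    n ≤ k + arrivalCount (epochs ω.1) t :=
  (h.le_arrivals n).trans (Nat.add_le_add_left (h.gaps.isArrivalSeq.arrivalCount_mono hn) k)

lemma lt_departureCount_iff (h : IsRegular ψ R k ω) {n : ℕ} {t : ℝ} :
    n < departureCount ψ R k ω t ↔ departure ψ R k ω (n + 1) ≤ t := by
  rw [departureCount, ncard_one_le]
  refine lt_ncard_iff_mem (S := {n : ℕ | departure ψ R k ω (n + 1) ≤ t})
    (fun j i hij hj => (h.departure_mono (Nat.succ_le_succ hij)).trans hj)
    ((finite_Iic (k + arrivalCount (epochs ω.1) t)).subset fun n hn => ?_) n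
  exact (Nat.le_succ n).trans (h.le_of_departure_le hn)

lemma lt_departureCountBefore_iff (h : IsRegular ψ R k ω) {n : ℕ} {t : ℝ} :
    n < departureCountBefore ψ R k ω t ↔ departure ψ R k ω (n + 1) < t := by
  rw [departureCountBefore, ncard_one_le]
  refine lt_ncard_iff_mem (S := {n : ℕ | departure ψ R k ω (n + 1) < t})
    (fun j i hij hj => (h.departure_mono (Nat.succ_le_succ hij)).trans_lt hj)
    ((finite_Iic (k + arrivalCount (epochs ω.1) t)).subset fun n hn => ?_) n
  exact (Nat.le_succ n).trans (h.le_of_departure_le (le_of_lt hn))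

lemma lt_departureCount_add_one_iff (h : IsRegular ψ R k ω) {n : ℕ} {t : ℝ} (ht : 0 ≤ t) :
    n < departureCount ψ R k ω t + 1 ↔ departure ψ R k ω n ≤ t := by
  rcases n with _ | n
  · simpa [departure_zero] using ht
  · rw [Nat.add_lt_add_iff_right, h.lt_departureCount_iff]

lemma departureCount_le (h : IsRegular ψ R k ω) {t : ℝ} (ht : 0 ≤ t) :
    departureCount ψ R k ω t ≤ k + arrivalCount (epochs ω.1) t :=
  h.le_of_departure_le ((h.lt_departureCount_add_one_iff ht).1 (Nat.lt_succ_self _))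

lemma tsum_departure_le (h : IsRegular ψ R k ω) {t : ℝ} (ht : 0 ≤ t) (f : ℕ → ℝ≥0∞) :
    ∑' n, (if departure ψ R k ω n ≤ t then f n else 0) =
      ∑ n ∈ Finset.range (departureCount ψ R k ω t + 1), f n := by
  rw [tsum_eq_sum (s := Finset.range (departureCount ψ R k ω t + 1))]
  · refine Finset.sum_congr rfl fun n hn => ?_
    rw [if_pos]
    exact (h.lt_departureCount_add_one_iff ht).1 (Finset.mem_range.1 hn)
  · intro n hn
    rw [if_neg]
    exact fun h' => hn (Finset.mem_range.2 ((h.lt_departureCount_add_one_iff ht).2 h'))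

end IsRegular

/-! ### Balance equations up to time `t` -/

section Balance

variable {lam : ℝ} {β : Measure ℝ} [IsProbabilityMeasure β] {θ : Measure Θ}
  [IsProbabilityMeasure θ] {ψ : ℕ → ℝ} {R : VacationRule Θ}

/-- The expected sum over the service completions up to time `t` of a function of the number of
customers left behind. -/
lemma lintegral_sum_left (hlam : 0 < lam) (hβ : β (Iio 0) = 0) (hψ : ψ 0 = 1)
    (hR0 : (vacationArrivals lam θ R 0).real {0} = 0) (k : ℕ) {t : ℝ} (ht : 0 ≤ t)
    (f : ℕ → ℝ≥0∞) :
    ∑' z, visits lam β θ ψ R k t z * f z =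
      ∫⁻ ω, ∑ n ∈ Finset.range (departureCount ψ R k ω t + 1), f (left ψ R k ω n)
        ∂(sampleLaw lam β θ) := by
  have := isProbabilityMeasure_poissonGaps hlam
  have h := tsum_lintegral_cycles hlam β hβ θ ψ R k t (Ψ := fun z _ _ => f z)
    (fun z => measurable_const)
  simp only [lintegral_const, measure_univ, mul_one] at h
  rw [← h, ← lintegral_tsum]
  · exact lintegral_congr_ae ((ae_isRegular hlam β hβ θ hψ R hR0 k).mono fun ω hω =>
      hω.tsum_departure_le ht fun n => f (left ψ R k ω n))
  · intro n
    exact (Measurable.ite (measurableSet_le (measurable_departure ψ R k n) measurable_const)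
      ((measurable_of_countable f).comp (measurable_left ψ R k n)) measurable_const).aemeasurable

/-- The expected number of service completions up to time `t` is at most the expected number of
customers that have been in the system. -/
lemma tsum_visits_le (hlam : 0 < lam) (hβ : β (Iio 0) = 0) (hψ : ψ 0 = 1)
    (hR0 : (vacationArrivals lam θ R 0).real {0} = 0) (k : ℕ) {t : ℝ} (ht : 0 ≤ t) :
    ∑' z, visits lam β θ ψ R k t z ≤ ENNReal.ofReal (k + 1 + lam * t) := by
  have := isProbabilityMeasure_poissonGaps hlam
  have h := lintegral_sum_left (β := β) (θ := θ) hlam hβ hψ hR0 k ht (fun _ => 1)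
  simp only [mul_one] at h
  rw [h]
  have h1 : ∫⁻ ω, (arrivalCount (epochs ω.1) t : ℝ≥0∞) ∂(sampleLaw lam β θ) =
      ENNReal.ofReal (lam * t) := by
    have hm : Measurable fun ω : Sample Θ => (arrivalCount (epochs ω.1) t : ℝ≥0∞) :=
      (measurable_of_countable fun n : ℕ => (n : ℝ≥0∞)).comp
        (measurable_arrivalCount (measurable_epochs.comp measurable_fst) measurable_const)
    rw [sampleLaw_eq, lintegral_prod _ hm.aemeasurable]
    simp only [lintegral_const, measure_univ, mul_one]
    rw [lintegral_arrivalCount hlam measurable_const (nonanticipating_const t), lintegral_const,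
      measure_univ, mul_one, ENNReal.ofReal_mul hlam.le]
  have hp := isProbabilityMeasure_sampleLaw hlam β θ
  have h2 : ∫⁻ ω, ((k + 1 : ℕ) : ℝ≥0∞) + (arrivalCount (epochs ω.1) t : ℝ≥0∞)
      ∂(sampleLaw lam β θ) = ENNReal.ofReal (k + 1 + lam * t) := by
    rw [lintegral_add_left measurable_const, h1, lintegral_const, measure_univ, mul_one,
      ENNReal.ofReal_add (by positivity) (by positivity)]
    congr 1
    rw [← ENNReal.ofReal_natCast]
    push_cast
    rfl
  rw [← h2]
  refine lintegral_mono_ae ((ae_isRegular hlam β hβ θ hψ R hR0 k).mono fun ω hω => ?_)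
  simp only [Finset.sum_const, Finset.card_range, nsmul_eq_mul, mul_one]
  have := hω.departureCount_le ht
  rw [← Nat.cast_add]
  exact Nat.cast_le.2 (by omega)

/-- The balance of the numbers of customers left behind, in terms of generating functions: shifting
the sequence of service completions by one changes the sum by at most one. -/
lemma visits_balance (hlam : 0 < lam) (hβ : β (Iio 0) = 0) (hψ : ψ 0 = 1)
    (hψ0 : ∀ z, 0 ≤ ψ z) (hψ1 : ∀ z, ψ z ≤ 1)
    (hR0 : (vacationArrivals lam θ R 0).real {0} = 0) (k : ℕ) {t : ℝ} (ht : 0 ≤ t) {r : ℝ}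
    (hr0 : 0 ≤ r) (hr1 : r ≤ 1) :
    let A := ∑' z, visits lam β θ ψ R k t z * (ENNReal.ofReal r ^ z *
      (ENNReal.ofReal (lst β (lam * (1 - r))) *
        (ENNReal.ofReal (ψ z) * ∫⁻ n, ENNReal.ofReal r ^ n ∂(vacationArrivals lam θ R z) +
          ENNReal.ofReal (1 - ψ z))))
    let B := ∑' z, visits lam β θ ψ R k t z * ENNReal.ofReal r ^ z
    A ≤ ENNReal.ofReal r * (B + 1) ∧ ENNReal.ofReal r * B ≤ A + 1 := by
  intro A B
  have := isProbabilityMeasure_poissonGaps hlam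
  have hp := isProbabilityMeasure_sampleLaw hlam β θ
  set x := ENNReal.ofReal r with hx
  have hx1 : ∀ n, x ^ n ≤ 1 := fun n => pow_le_one' (by simpa [hx] using hr1) n
  have hBe : B = ∫⁻ ω, ∑ n ∈ Finset.range (departureCount ψ R k ω t + 1), x ^ left ψ R k ω n
      ∂(sampleLaw lam β θ) := lintegral_sum_left hlam hβ hψ hR0 k ht fun z => x ^ z
  have hcm : ∀ z, Measurable fun p : Mark Θ × (ℕ → ℝ) =>
      arrivalCount p.2 (idleTime ψ R z p.1 p.2 + p.1.1) := fun z =>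
    measurable_arrivalCount measurable_snd
      ((measurable_idleTime ψ R measurable_const measurable_fst measurable_snd).add
        (measurable_fst.comp measurable_fst))
  have hcm' : ∀ z, Measurable fun p : Mark Θ × (ℕ → ℝ) =>
      x ^ arrivalCount p.2 (idleTime ψ R z p.1 p.2 + p.1.1) := fun z =>
    measurable_ennreal_pow _ (hcm z)
  have hAe : A = ∫⁻ ω, ∑ n ∈ Finset.range (departureCount ψ R k ω t + 1),
      x * x ^ left ψ R k ω (n + 1) ∂(sampleLaw lam β θ) := by
    have h := tsum_lintegral_cycles hlam β hβ θ ψ R k t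
      (Ψ := fun z m a => x ^ z * x ^ arrivalCount a (idleTime ψ R z m a + m.1))
      (fun z => (hcm' z).const_mul _)
    have e : ∀ z, ∫⁻ m, ∫⁻ g, x ^ z * x ^ arrivalCount (epochs g)
        (idleTime ψ R z m (epochs g) + m.1) ∂(poissonGaps lam) ∂(markLaw β θ) =
        x ^ z * (ENNReal.ofReal (lst β (lam * (1 - r))) *
          (ENNReal.ofReal (ψ z) * ∫⁻ n, x ^ n ∂(vacationArrivals lam θ R z) +
            ENNReal.ofReal (1 - ψ z))) := by
      intro z
      rw [← lintegral_pow_cycle hlam β hβ θ R (hψ0 z) (hψ1 z) hr0 hr1, ← lintegral_const_mul]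
      · refine lintegral_congr fun m => ?_
        rw [lintegral_const_mul]
        exact measurable_ennreal_pow _ ((hcm z).comp (f := fun g => (m, epochs g))
          (measurable_const.prodMk measurable_epochs))
      · refine Measurable.lintegral_prod_right' (f := fun p : Mark Θ × (ℕ → ℝ) =>
          x ^ arrivalCount (epochs p.2) (idleTime ψ R z p.1 (epochs p.2) + p.1.1)) ?_
        exact measurable_ennreal_pow _ ((hcm z).comp
          (f := fun p : Mark Θ × (ℕ → ℝ) => (p.1, epochs p.2))
          (measurable_fst.prodMk (measurable_epochs.comp measurable_snd)))
    simp_rw [e] at h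
    refine h.symm.trans ?_
    rw [← lintegral_tsum]
    · refine lintegral_congr_ae ((ae_isRegular hlam β hβ θ hψ R hR0 k).mono fun ω hω => ?_)
      refine (hω.tsum_departure_le ht fun n => x ^ left ψ R k ω n * x ^ arrivalCount
        (arrivalsAfter (epochs ω.1) (departure ψ R k ω n))
        (idleTime ψ R (left ψ R k ω n) (mark ω.2 n)
          (arrivalsAfter (epochs ω.1) (departure ψ R k ω n)) + (mark ω.2 n).1)).trans ?_
      refine Finset.sum_congr rfl fun n _ => ?_
      rw [← pow_succ', hω.left_succ n, pow_add]
      rfl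
    · intro n
      have haft := measurable_arrivalsAfter
        (measurable_epochs.comp (measurable_fst (α := ℕ → ℝ) (β := Marks Θ)))
        (measurable_departure ψ R k n)
      have hmk : Measurable fun ω : Sample Θ => mark ω.2 n :=
        (measurable_mark n).comp measurable_snd
      have hidle := measurable_idleTime ψ R (measurable_left ψ R k n) hmk haft
      have h1 : Measurable fun ω : Sample Θ => x ^ left ψ R k ω n :=
        measurable_ennreal_pow _ (measurable_left ψ R k n)
      have h2 : Measurable fun ω : Sample Θ => x ^ arrivalCount
          (arrivalsAfter (epochs ω.1) (departure ψ R k ω n)) (idleTime ψ R (left ψ R k ω n)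
            (mark ω.2 n) (arrivalsAfter (epochs ω.1) (departure ψ R k ω n)) + (mark ω.2 n).1) :=
        measurable_ennreal_pow _ (measurable_arrivalCount haft
          (hidle.add (measurable_fst.comp hmk)))
      exact (Measurable.ite (measurableSet_le (measurable_departure ψ R k n) measurable_const)
        (h1.mul h2) measurable_const).aemeasurable
  -- Both sums run over consecutive completions and differ in their end terms only.
  have hshift : ∀ ω : Sample Θ,
      ∑ n ∈ Finset.range (departureCount ψ R k ω t + 1), x ^ left ψ R k ω n +
        x ^ left ψ R k ω (departureCount ψ R k ω t + 1) =
      ∑ n ∈ Finset.range (departureCount ψ R k ω t + 1), x ^ left ψ R k ω (n + 1) +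
        x ^ left ψ R k ω 0 := by
    intro ω
    rw [← Finset.sum_range_succ, Finset.sum_range_succ']
  constructor
  · rw [hAe, hBe]
    calc _ ≤ ∫⁻ ω, x * (∑ n ∈ Finset.range (departureCount ψ R k ω t + 1), x ^ left ψ R k ω n + 1)
          ∂(sampleLaw lam β θ) := by
          refine lintegral_mono fun ω => ?_
          rw [← Finset.mul_sum]
          gcongr
          exact le_self_add.trans ((hshift ω).symm.le.trans (add_le_add_right (hx1 _) _))
      _ = _ := by
          rw [lintegral_const_mul' _ _ ENNReal.ofReal_ne_top, lintegral_add_right _ measurable_const,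
            lintegral_one, measure_univ]
  · rw [hAe, hBe, ← lintegral_const_mul' _ _ ENNReal.ofReal_ne_top]
    calc _ ≤ ∫⁻ ω, (∑ n ∈ Finset.range (departureCount ψ R k ω t + 1),
            x * x ^ left ψ R k ω (n + 1)) + 1 ∂(sampleLaw lam β θ) := by
          refine lintegral_mono fun ω => ?_
          rw [← Finset.mul_sum]
          refine (mul_le_mul_right (le_self_add.trans (hshift ω).le) x).trans ?_
          rw [mul_add, ← pow_succ']
          exact add_le_add_right (hx1 _) _
      _ = _ := by
          rw [lintegral_add_right _ measurable_const]
          simp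

/-- The cycles that begin up to time `t` cover the interval from `0` to `t`. -/
lemma le_tsum_visits_mul (hlam : 0 < lam) (hβ : β (Iio 0) = 0) (hβi : Integrable (fun x => x) β)
    (hψ : ψ 0 = 1) (hψ0 : ∀ z, 0 ≤ ψ z) (hψ1 : ∀ z, ψ z ≤ 1)
    (hR0 : (vacationArrivals lam θ R 0).real {0} = 0) (k : ℕ) {t : ℝ} (ht : 0 ≤ t) :
    ENNReal.ofReal (lam * t) ≤ ∑' z, visits lam β θ ψ R k t z * (ENNReal.ofReal (load lam β) +
        ENNReal.ofReal (ψ z) * ∫⁻ n, (n : ℝ≥0∞) ∂(vacationArrivals lam θ R z)) := by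
  have := isProbabilityMeasure_poissonGaps hlam
  have hp := isProbabilityMeasure_sampleLaw hlam β θ
  have hcm : ∀ z, Measurable fun p : Mark Θ × (ℕ → ℝ) =>
      ENNReal.ofReal (idleTime ψ R z p.1 p.2 + p.1.1) := fun z =>
    ((measurable_idleTime ψ R measurable_const measurable_fst measurable_snd).add
      (measurable_fst.comp measurable_fst)).ennreal_ofReal
  have h := tsum_lintegral_cycles hlam β hβ θ ψ R k t
    (Ψ := fun z m a => ENNReal.ofReal (idleTime ψ R z m a + m.1)) hcm
  simp_rw [← lintegral_cycle_length hlam β hβ hβi θ R (hψ0 _) (hψ1 _), mul_left_comm _ (ENNReal.ofReal lam)]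
  rw [ENNReal.tsum_mul_left, ← h, ENNReal.ofReal_mul hlam.le]
  gcongr
  rw [← lintegral_tsum]
  · calc ENNReal.ofReal t = ∫⁻ _, ENNReal.ofReal t ∂(sampleLaw lam β θ) := by simp
      _ ≤ _ := by
        refine lintegral_mono_ae ((ae_isRegular hlam β hβ θ hψ R hR0 k).mono fun ω hω => ?_)
        have h1 := hω.tsum_departure_le ht fun n => ENNReal.ofReal (cycleLength ψ R k ω n)
        refine le_trans ?_ h1.symm.le
        rw [← ENNReal.ofReal_sum_of_nonneg fun n _ => cycleLength_nonneg ψ R k hω.service_nonneg n]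
        refine ENNReal.ofReal_le_ofReal ?_
        have h2 : ∀ N, ∑ n ∈ Finset.range N, cycleLength ψ R k ω n = departure ψ R k ω N := by
          intro N
          induction N with
          | zero => simp [departure_zero]
          | succ N ih => rw [Finset.sum_range_succ, ih, departure_succ]
        rw [h2]
        by_contra! h3
        exact lt_irrefl _ ((hω.lt_departureCount_add_one_iff ht).2 h3.le)
  · intro n
    have haft := measurable_arrivalsAfter
      (measurable_epochs.comp (measurable_fst (α := ℕ → ℝ) (β := Marks Θ)))
      (measurable_departure ψ R k n)
    have hmk : Measurable fun ω : Sample Θ => mark ω.2 n :=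
      (measurable_mark n).comp measurable_snd
    exact (Measurable.ite (measurableSet_le (measurable_departure ψ R k n) measurable_const)
      ((measurable_idleTime ψ R (measurable_left ψ R k n) hmk haft).add
        (measurable_fst.comp hmk)).ennreal_ofReal measurable_const).aemeasurable

end Balance

/-! ### Level crossings -/

lemma sum_range_ite_le_sub (f : ℕ → ℤ) {y N : ℕ} (h : y ≤ N) :
    ∑ i ∈ Finset.range N, (if y ≤ i then f (i + 1) - f i else 0) = f N - f y := by
  induction N, h using Nat.le_induction with
  | base =>
    rw [sub_self]
    exact Finset.sum_eq_zero fun i hi => if_neg (not_le.2 (Finset.mem_range.1 hi))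
  | succ N hN ih =>
    rw [Finset.sum_range_succ, ih, if_pos hN]
    ring

/-- The change of a function along a monotone lattice path from `(0, 0)` to `(N, M)` is the sum of
its changes along the steps. The horizontal step from `i` to `i + 1` is at height `x i`, the
vertical step from `n` to `n + 1` is at abscissa `y n`. -/
lemma sum_lattice_path (F : ℕ → ℕ → ℤ) (x y : ℕ → ℕ) {N M : ℕ}
    (h : ∀ i < N, ∀ n < M, n < x i ↔ y n ≤ i) (hx : ∀ i < N, x i ≤ M) (hy : ∀ n < M, y n ≤ N) :
    ∑ i ∈ Finset.range N, (F (i + 1) (x i) - F i (x i)) +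
      ∑ n ∈ Finset.range M, (F (y n) (n + 1) - F (y n) n) = F N M - F 0 0 := by
  obtain ⟨δ, hδ⟩ : ∃ δ : ℕ → ℕ → ℤ, ∀ i n, F i (n + 1) - F i n = δ i n := ⟨_, fun _ _ => rfl⟩
  have h1 : ∀ i m, F i m = F i 0 + ∑ n ∈ Finset.range m, δ i n := fun i m => by
    simp_rw [← hδ]
    rw [Finset.sum_range_sub (F i)]
    ring
  have h2 : ∀ i ∈ Finset.range N, F (i + 1) (x i) - F i (x i) = (F (i + 1) 0 - F i 0) +
      ∑ n ∈ Finset.range M, (if y n ≤ i then δ (i + 1) n - δ i n else 0) := by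
    intro i hi
    rw [Finset.mem_range] at hi
    have h3 : ∑ n ∈ Finset.range M, (if y n ≤ i then δ (i + 1) n - δ i n else 0) =
        ∑ n ∈ Finset.range (x i), (δ (i + 1) n - δ i n) := by
      rw [← Finset.sum_filter]
      refine Finset.sum_congr ?_ fun _ _ => rfl
      ext n
      simp only [Finset.mem_filter, Finset.mem_range]
      constructor
      · rintro ⟨hn, hyn⟩
        exact (h i hi n hn).2 hyn
      · intro hn
        have := hn.trans_le (hx i hi)
        exact ⟨this, (h i hi n this).1 hn⟩
    rw [h3, h1 (i + 1) (x i), h1 i (x i), Finset.sum_sub_distrib]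
    ring
  simp_rw [hδ]
  rw [Finset.sum_congr rfl h2, Finset.sum_add_distrib, Finset.sum_range_sub (fun i => F i 0),
    Finset.sum_comm, h1 N M]
  have h4 : ∀ n ∈ Finset.range M, ∑ i ∈ Finset.range N,
      (if y n ≤ i then δ (i + 1) n - δ i n else 0) = δ N n - δ (y n) n := fun n hn =>
    sum_range_ite_le_sub (fun i => δ i n) (hy n (Finset.mem_range.1 hn))
  rw [Finset.sum_congr rfl h4, Finset.sum_sub_distrib]
  ring

/-- The number of customers just before time `t`. -/
def customersBefore (ψ : ℕ → ℝ) (R : VacationRule Θ) (k : ℕ) (t : ℝ) (ω : Sample Θ) : ℕ :=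
  k + arrivalCountBefore (epochs ω.1) t - departureCountBefore ψ R k ω t

lemma customers_eq (ψ : ℕ → ℝ) (R : VacationRule Θ) (k : ℕ) (t : ℝ) (ω : Sample Θ) :
    customers ψ R k t ω = k + arrivalCount (epochs ω.1) t - departureCount ψ R k ω t := rfl

lemma customersBefore_eq_customers (ψ : ℕ → ℝ) (R : VacationRule Θ) (k : ℕ) {t : ℝ}
    {ω : Sample Θ} (ha : ∀ j, epochs ω.1 j ≠ t) (hd : ∀ n, departure ψ R k ω n ≠ t) :
    customersBefore ψ R k t ω = customers ψ R k t ω := by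
  have : {n : ℕ | 1 ≤ n ∧ departure ψ R k ω n < t} =
      {n : ℕ | 1 ≤ n ∧ departure ψ R k ω n ≤ t} := by
    ext n
    exact and_congr_right fun _ => ⟨le_of_lt, fun h => lt_of_le_of_ne h (hd n)⟩
  rw [customersBefore, arrivalCountBefore_eq_arrivalCount ha, departureCountBefore, this,
    customers_eq, departureCount]

lemma measurable_customers (ψ : ℕ → ℝ) (R : VacationRule Θ) (k : ℕ) :
    Measurable fun p : ℝ × Sample Θ => customers ψ R k p.1 p.2 := by
  have h1 : Measurable fun p : ℝ × Sample Θ => arrivalCount (epochs p.2.1) p.1 :=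
    measurable_arrivalCount (measurable_epochs.comp (measurable_fst.comp measurable_snd))
      measurable_fst
  have h2 : Measurable fun p : ℝ × Sample Θ => departureCount ψ R k p.2 p.1 :=
    measurable_ncard fun n => (MeasurableSet.const _).inter
      (measurableSet_le ((measurable_departure ψ R k n).comp measurable_snd) measurable_fst)
  exact (measurable_of_countable fun q : ℕ × ℕ => k + q.1 - q.2).comp (h1.prodMk h2)

lemma measurable_customersBefore (ψ : ℕ → ℝ) (R : VacationRule Θ) (k : ℕ) :
    Measurable fun p : ℝ × Sample Θ => customersBefore ψ R k p.1 p.2 := by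
  have h1 : Measurable fun p : ℝ × Sample Θ => arrivalCountBefore (epochs p.2.1) p.1 :=
    measurable_arrivalCountBefore (measurable_epochs.comp (measurable_fst.comp measurable_snd))
      measurable_fst
  have h2 : Measurable fun p : ℝ × Sample Θ => departureCountBefore ψ R k p.2 p.1 :=
    measurable_ncard fun n => (MeasurableSet.const _).inter
      (measurableSet_lt ((measurable_departure ψ R k n).comp measurable_snd) measurable_fst)
  exact (measurable_of_countable fun q : ℕ × ℕ => k + q.1 - q.2).comp (h1.prodMk h2)

/-- The number of customers just before a time is determined by the earlier arrivals. -/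
lemma customersBefore_congr (ψ : ℕ → ℝ) (R : VacationRule Θ) (k : ℕ) {w : Marks Θ}
    (hw : ∀ n, 0 ≤ w.1 n) {g g' : ℕ → ℝ} (hg : IsGapSeq g) (hg' : IsGapSeq g') {s : ℝ}
    (h : ∀ t < s, arrivalCount (epochs g') t = arrivalCount (epochs g) t) :
    customersBefore ψ R k s (g', w) = customersBefore ψ R k s (g, w) := by
  have h1 : {n : ℕ | 1 ≤ n ∧ departure ψ R k (g', w) n < s} =
      {n : ℕ | 1 ≤ n ∧ departure ψ R k (g, w) n < s} := by
    ext n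
    have := (nonanticipating_departure ψ R k hw n).le_iff hg hg' h
    exact and_congr_right fun _ => by simpa only [not_le] using not_congr this
  simp only [customersBefore, departureCountBefore, h1,
    hg.isArrivalSeq.arrivalCountBefore_congr hg'.isArrivalSeq h]

/-- Up to time `t`, the completions that leave `j` customers behind and the arrivals that find `j`
customers alternate. -/
lemma IsRegular.level_crossing {ψ : ℕ → ℝ} {R : VacationRule Θ} {k : ℕ} {ω : Sample Θ}
    (h : IsRegular ψ R k ω) (t : ℝ) (j : ℕ) :
    let U := ∑ i ∈ Finset.range (arrivalCount (epochs ω.1) t),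
      if customersBefore ψ R k (epochs ω.1 i) ω = j then 1 else 0
    let V := ∑ n ∈ Finset.range (departureCount ψ R k ω t + 1), if left ψ R k ω n = j then 1 else 0
    V ≤ U + 2 ∧ U ≤ V + 1 := by
  intro U V
  have ha := h.gaps.isArrivalSeq
  -- The indicator of at most `j` customers drops at an arrival that finds `j` customers, rises at a
  -- completion that leaves `j`, and changes at no other epoch.
  set φ : ℤ → ℤ := fun z => if z ≤ j then 1 else 0 with hφ
  have hφ01 : ∀ z, 0 ≤ φ z ∧ φ z ≤ 1 := fun z => by
    simp only [hφ]
    split_ifs <;> simp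
  have hφs : ∀ z, φ z - φ (z + 1) = if z = j then 1 else 0 := fun z => by
    simp only [hφ]
    split_ifs <;> omega
  have hxa : ∀ i, departureCountBefore ψ R k ω (epochs ω.1 i) ≤ k + i := by
    intro i
    rcases hm : departureCountBefore ψ R k ω (epochs ω.1 i) with _ | m
    · omega
    · have h1 := h.lt_departureCountBefore_iff.1 (show m < departureCountBefore ψ R k ω (epochs ω.1 i) by omega)
      have h2 := h.le_arrivals (m + 1)
      have h3 : ¬ (i < arrivalCount (epochs ω.1) (departure ψ R k ω (m + 1))) := by
        rw [ha.lt_arrivalCount_iff]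
        exact not_le.2 h1
      omega
  have key := sum_lattice_path (fun i n => φ (k + i - n))
    (fun i => departureCountBefore ψ R k ω (epochs ω.1 i))
    (fun n => arrivalCount (epochs ω.1) (departure ψ R k ω (n + 1)))
    (N := arrivalCount (epochs ω.1) t) (M := departureCount ψ R k ω t)
    (fun i _ n _ => by
      rw [h.lt_departureCountBefore_iff, ← not_iff_not, not_lt, not_le, ha.lt_arrivalCount_iff])
    (fun i hi => by
      by_contra! hc
      have h1 := h.lt_departureCountBefore_iff.1 hc
      have h2 := ha.lt_arrivalCount_iff.1 hi
      exact lt_irrefl _ (h.lt_departureCount_iff.2 (h1.le.trans h2)))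
    (fun n hn => ha.arrivalCount_mono (h.lt_departureCount_iff.1 hn))
  have e1 : ∀ i, φ (k + ((i + 1 : ℕ) : ℤ) - departureCountBefore ψ R k ω (epochs ω.1 i)) -
      φ (k + (i : ℤ) - departureCountBefore ψ R k ω (epochs ω.1 i)) =
      -((if customersBefore ψ R k (epochs ω.1 i) ω = j then 1 else 0 : ℕ) : ℤ) := by
    intro i
    have h1 := hφs (k + (i : ℤ) - departureCountBefore ψ R k ω (epochs ω.1 i))
    have h2 : (k + ((i + 1 : ℕ) : ℤ) - departureCountBefore ψ R k ω (epochs ω.1 i)) =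
        (k + (i : ℤ) - departureCountBefore ψ R k ω (epochs ω.1 i)) + 1 := by
      push_cast
      ring
    have h3 : (k + (i : ℤ) - departureCountBefore ψ R k ω (epochs ω.1 i) = j) ↔
        customersBefore ψ R k (epochs ω.1 i) ω = j := by
      rw [customersBefore, ha.arrivalCountBefore_eq]
      have := hxa i
      omega
    rw [h2, ← neg_sub, h1]
    simp only [h3]
    push_cast
    rfl
  have e2 : ∀ n, φ (k + (arrivalCount (epochs ω.1) (departure ψ R k ω (n + 1)) : ℤ) -
        ((n + 1 : ℕ) : ℤ)) -
      φ (k + (arrivalCount (epochs ω.1) (departure ψ R k ω (n + 1)) : ℤ) - (n : ℤ)) =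
      ((if left ψ R k ω (n + 1) = j then 1 else 0 : ℕ) : ℤ) := by
    intro n
    have h4 := h.le_arrivals (n + 1)
    have h1 := hφs (k + (arrivalCount (epochs ω.1) (departure ψ R k ω (n + 1)) : ℤ) -
      ((n + 1 : ℕ) : ℤ))
    have h2 : (k + (arrivalCount (epochs ω.1) (departure ψ R k ω (n + 1)) : ℤ) -
        ((n + 1 : ℕ) : ℤ)) + 1 =
        (k + (arrivalCount (epochs ω.1) (departure ψ R k ω (n + 1)) : ℤ) - (n : ℤ)) := by
      push_cast
      ring
    have h3 : ((k + (arrivalCount (epochs ω.1) (departure ψ R k ω (n + 1)) : ℤ) -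
        ((n + 1 : ℕ) : ℤ)) = j) ↔ left ψ R k ω (n + 1) = j := by
      rw [left]
      omega
    rw [← h2, h1]
    simp only [h3]
    push_cast
    rfl
  simp only [e1, e2, Finset.sum_neg_distrib, ← Nat.cast_sum] at key
  have hV : V = ∑ n ∈ Finset.range (departureCount ψ R k ω t),
      (if left ψ R k ω (n + 1) = j then 1 else 0) + if left ψ R k ω 0 = j then 1 else 0 :=
    Finset.sum_range_succ' _ _
  have h0 : (if left ψ R k ω 0 = j then 1 else 0 : ℕ) ≤ 1 := by split_ifs <;> simp
  have h5 := hφ01 (k + (arrivalCount (epochs ω.1) t : ℤ) - (departureCount ψ R k ω t : ℤ))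
  have h6 := hφ01 (k + ((0 : ℕ) : ℤ) - ((0 : ℕ) : ℤ))
  change -(U : ℤ) + _ = _ at key
  omega

/-- The number of completions up to time `t` that leave `j` customers behind is on average,
up to a constant, `lam` times the time during which there are `j` customers. -/
lemma visits_level_crossing {lam : ℝ} (hlam : 0 < lam) (β : Measure ℝ) [IsProbabilityMeasure β]
    (hβ : β (Iio 0) = 0) (θ : Measure Θ) [IsProbabilityMeasure θ] {ψ : ℕ → ℝ} (hψ : ψ 0 = 1)
    (R : VacationRule Θ) (hR0 : (vacationArrivals lam θ R 0).real {0} = 0) (k j : ℕ) {t : ℝ}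
    (ht : 0 ≤ t) :
    let S := ENNReal.ofReal lam * ∫⁻ s in Ioc 0 t, sampleLaw lam β θ {ω | customers ψ R k s ω = j}
    visits lam β θ ψ R k t j ≤ S + 2 ∧ S ≤ visits lam β θ ψ R k t j + 1 := by
  intro S
  have := isProbabilityMeasure_poissonGaps hlam
  have hp := isProbabilityMeasure_sampleLaw hlam β θ
  have hreg := ae_isRegular hlam β hβ θ hψ R hR0 k
  set H : ℝ → Sample Θ → ℝ≥0∞ := fun s ω =>
    if s ≤ t then (if customersBefore ψ R k s ω = j then 1 else 0) else 0 with hH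
  have hHm : Measurable fun p : ℝ × Sample Θ => H p.1 p.2 :=
    Measurable.ite (measurableSet_le measurable_fst measurable_const)
      (Measurable.ite (measurable_customersBefore ψ R k (measurableSet_singleton j))
        measurable_const measurable_const) measurable_const
  have hHe : ∀ i, Measurable fun ω : Sample Θ => H (epochs ω.1 i) ω := fun i =>
    hHm.comp (f := fun ω : Sample Θ => (epochs ω.1 i, ω))
      (((measurable_pi_apply i).comp (measurable_epochs.comp measurable_fst)).prodMk measurable_id)
  have hsum : ∫⁻ ω, ∑' i, H (epochs ω.1 i) ω ∂(sampleLaw lam β θ) = S := by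
    have e1 : ∫⁻ ω, ∑' i, H (epochs ω.1 i) ω ∂(sampleLaw lam β θ) =
        ENNReal.ofReal lam * ∫⁻ ω, (∫⁻ s in Ioi 0, H s ω) ∂(sampleLaw lam β θ) := by
      have hm1 : Measurable fun ω : Sample Θ => ∑' i, H (epochs ω.1 i) ω :=
        Measurable.tsum fun i => hHe i
      have hm2 : Measurable fun ω : Sample Θ => ∫⁻ s in Ioi 0, H s ω :=
        Measurable.lintegral_prod_left' (f := fun p : ℝ × Sample Θ => H p.1 p.2) hHm
      rw [sampleLaw_eq, lintegral_prod_symm _ hm1.aemeasurable,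
        lintegral_prod_symm _ hm2.aemeasurable, ← lintegral_const_mul _ hm2.lintegral_prod_left']
      refine lintegral_congr_ae ((ae_marks_nonneg β hβ θ).mono fun w hw => ?_)
      refine lintegral_sum_arrivals hlam (H := fun s g => H s (g, w)) ?_ ?_
      · exact hHm.comp (f := fun p : ℝ × (ℕ → ℝ) => (p.1, (p.2, w)))
          (measurable_fst.prodMk (measurable_snd.prodMk measurable_const))
      · intro g g' s hg hg' _ hs
        simp only [hH, customersBefore_congr ψ R k hw hg hg' hs]
    have e2 : ∀ ω : Sample Θ, ∫⁻ s in Ioi 0, H s ω =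
        ∫⁻ s in Ioc 0 t, (if customers ψ R k s ω = j then 1 else 0) := by
      intro ω
      rw [← lintegral_indicator measurableSet_Ioi, ← lintegral_indicator measurableSet_Ioc]
      refine lintegral_congr_ae ?_
      have hne1 : ∀ᵐ s : ℝ, ∀ i, epochs ω.1 i ≠ s := by
        rw [ae_all_iff]
        intro i
        simp [ae_iff]
      have hne2 : ∀ᵐ s : ℝ, ∀ n, departure ψ R k ω n ≠ s := by
        rw [ae_all_iff]
        intro n
        simp [ae_iff]
      filter_upwards [hne1, hne2] with s h1 h2
      by_cases h0 : 0 < s <;> by_cases h3 : s ≤ t <;>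
        simp [indicator, h0, h3, hH, customersBefore_eq_customers ψ R k h1 h2]
    rw [e1]
    simp_rw [e2]
    have hcm : Measurable fun p : ℝ × Sample Θ =>
        if customers ψ R k p.1 p.2 = j then (1 : ℝ≥0∞) else 0 :=
      Measurable.ite (measurable_customers ψ R k (measurableSet_singleton j)) measurable_const
        measurable_const
    have hsw : AEMeasurable (Function.uncurry fun (ω : Sample Θ) (s : ℝ) =>
        if customers ψ R k s ω = j then (1 : ℝ≥0∞) else 0)
        ((sampleLaw lam β θ).prod (volume.restrict (Ioc 0 t))) :=
      (hcm.comp measurable_swap).aemeasurable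
    rw [lintegral_lintegral_swap hsw]
    congr 1
    refine lintegral_congr fun s => ?_
    have hset : MeasurableSet {ω | customers ψ R k s ω = j} :=
      (measurable_customers ψ R k).comp (measurable_const.prodMk measurable_id)
        (measurableSet_singleton j)
    rw [← lintegral_indicator_one hset]
    exact lintegral_congr fun ω => by simp [indicator]
  have hvis : visits lam β θ ψ R k t j = ∫⁻ ω,
      ((∑ n ∈ Finset.range (departureCount ψ R k ω t + 1),
        if left ψ R k ω n = j then 1 else 0 : ℕ) : ℝ≥0∞) ∂(sampleLaw lam β θ) := by
    have h := lintegral_sum_left (β := β) (θ := θ) hlam hβ hψ hR0 k ht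
      (fun z => if z = j then 1 else 0)
    rw [tsum_eq_single j fun z hz => by simp [hz]] at h
    simpa using h
  have hS : S = ∫⁻ ω, ((∑ i ∈ Finset.range (arrivalCount (epochs ω.1) t),
      if customersBefore ψ R k (epochs ω.1 i) ω = j then 1 else 0 : ℕ) : ℝ≥0∞)
        ∂(sampleLaw lam β θ) := by
    rw [← hsum]
    refine lintegral_congr_ae (hreg.mono fun ω hω => ?_)
    refine (hω.gaps.tsum_le_eq t _).trans ?_
    push_cast
    rfl
  have hconst : ∀ (f : Sample Θ → ℝ≥0∞) (c : ℝ≥0∞),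
      ∫⁻ ω, f ω + c ∂(sampleLaw lam β θ) = ∫⁻ ω, f ω ∂(sampleLaw lam β θ) + c := fun f c => by
    rw [lintegral_add_right _ measurable_const]
    simp
  rw [hvis, hS]
  constructor
  · rw [← hconst]
    refine lintegral_mono_ae (hreg.mono fun ω hω => ?_)
    have := (hω.level_crossing t j).1
    exact_mod_cast this
  · rw [← hconst]
    refine lintegral_mono_ae (hreg.mono fun ω hω => ?_)
    have := (hω.level_crossing t j).2
    exact_mod_cast this

/-! ### The functions `Y` and `K` -/

lemma exp_neg_le_quadratic {y : ℝ} (hy : 0 ≤ y) : Real.exp (-y) ≤ 1 - y + y ^ 2 := by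
  rw [Real.exp_neg]
  have h := Real.add_one_le_exp y
  refine (inv_anti₀ (by linarith) h).trans ?_
  rw [inv_le_iff_one_le_mul₀ (by linarith)]
  nlinarith [pow_nonneg hy 3]

/-- A function that is `m y + O(y ^ 2)` at `0` has slope `m` there. -/
lemma tendsto_div_of_quadratic_bounds {h : ℝ → ℝ} {m s : ℝ}
    (h1 : ∀ r ∈ Ico (0 : ℝ) 1, m * (1 - r) - s * (1 - r) ^ 2 ≤ h r)
    (h2 : ∀ r ∈ Ico (0 : ℝ) 1, h r ≤ m * (1 - r)) :
    Tendsto (fun r => h r / (1 - r)) (𝓝[Ico 0 1] 1) (𝓝 m) := by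
  have h3 : Tendsto (fun r : ℝ => m - s * (1 - r)) (𝓝[Ico 0 1] 1) (𝓝 m) := by
    have : Continuous fun r : ℝ => m - s * (1 - r) := by fun_prop
    have h4 := (this.tendsto 1).mono_left (nhdsWithin_le_nhds (s := Ico (0 : ℝ) 1))
    simpa using h4
  refine tendsto_of_tendsto_of_tendsto_of_le_of_le' h3 tendsto_const_nhds ?_ ?_
  · filter_upwards [self_mem_nhdsWithin] with r hr
    have : 0 < 1 - r := by linarith [hr.2]
    rw [le_div_iff₀ this]
    nlinarith [h1 r hr]
  · filter_upwards [self_mem_nhdsWithin] with r hr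
    have : 0 < 1 - r := by linarith [hr.2]
    rw [div_le_iff₀ this]
    exact h2 r hr

section genFun

variable (μ : Measure ℕ) [IsProbabilityMeasure μ]

lemma integrable_pow {r : ℝ} (hr : r ∈ Icc (0 : ℝ) 1) : Integrable (fun n : ℕ => r ^ n) μ :=
  (integrable_const (1 : ℝ)).mono' (measurable_of_countable _).aestronglyMeasurable
    (ae_of_all _ fun n => by
      rw [Real.norm_eq_abs, abs_of_nonneg (pow_nonneg hr.1 n)]
      exact pow_le_one₀ hr.1 hr.2)

omit [IsProbabilityMeasure μ] in
lemma genFun_nonneg {r : ℝ} (hr : 0 ≤ r) : 0 ≤ genFun μ r :=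
  integral_nonneg fun _ => pow_nonneg hr _

lemma genFun_le_one {r : ℝ} (hr : r ∈ Icc (0 : ℝ) 1) : genFun μ r ≤ 1 := by
  refine (integral_mono (integrable_pow μ hr) (integrable_const (1 : ℝ)) fun n =>
    pow_le_one₀ hr.1 hr.2).trans ?_
  simp

omit [IsProbabilityMeasure μ] in
lemma genFun_zero : genFun μ 0 = μ.real {0} := by
  rw [genFun, ← integral_indicator_one (measurableSet_singleton 0)]
  refine integral_congr_ae (ae_of_all _ fun n => ?_)
  rcases n with _ | n <;> simp

lemma continuousOn_genFun : ContinuousOn (genFun μ) (Icc 0 1) := by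
  intro r _
  refine tendsto_integral_filter_of_dominated_convergence (fun _ => 1)
    (Eventually.of_forall fun _ => (measurable_of_countable _).aestronglyMeasurable) ?_
    (integrable_const _) (ae_of_all _ fun n => ?_)
  · filter_upwards [self_mem_nhdsWithin] with x hx
    refine ae_of_all _ fun n => ?_
    rw [Real.norm_eq_abs, abs_of_nonneg (pow_nonneg hx.1 n)]
    exact pow_le_one₀ hx.1 hx.2
  · exact ((continuous_pow n).tendsto r).mono_left nhdsWithin_le_nhds

omit [IsProbabilityMeasure μ] in
lemma integrable_natCast (h : Integrable (fun n : ℕ => (n : ℝ) ^ 2) μ) :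
    Integrable (fun n : ℕ => (n : ℝ)) μ :=
  h.mono' (measurable_of_countable _).aestronglyMeasurable (ae_of_all _ fun n => by
    rw [Real.norm_eq_abs, abs_of_nonneg (Nat.cast_nonneg n), ← Nat.cast_pow]
    exact Nat.cast_le.2 (Nat.le_self_pow two_ne_zero n))

lemma tendsto_one_sub_genFun_div (h : Integrable (fun n : ℕ => (n : ℝ) ^ 2) μ) :
    Tendsto (fun r => (1 - genFun μ r) / (1 - r)) (𝓝[Ico 0 1] 1) (𝓝 (mean μ)) := by
  have hi := integrable_natCast μ h
  have e : ∀ r ∈ Ico (0 : ℝ) 1, 1 - genFun μ r = ∫ n, (1 - r ^ n) ∂μ := fun r hr => by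
    rw [integral_sub (integrable_const _) (integrable_pow μ ⟨hr.1, hr.2.le⟩), genFun]
    simp
  refine tendsto_div_of_quadratic_bounds (s := ∫ n, (n : ℝ) ^ 2 ∂μ) (fun r hr => ?_)
    (fun r hr => ?_)
  · rw [e r hr, mean, ← integral_mul_const, ← integral_mul_const,
      ← integral_sub (hi.mul_const _) (h.mul_const _)]
    refine integral_mono ((hi.mul_const _).sub (h.mul_const _))
      ((integrable_const _).sub (integrable_pow μ ⟨hr.1, hr.2.le⟩)) fun n => ?_
    have h1 : r ^ n ≤ Real.exp (-(n * (1 - r))) := by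
      rw [← mul_neg, Real.exp_nat_mul]
      refine pow_le_pow_left₀ hr.1 ?_ n
      have := Real.add_one_le_exp (-(1 - r))
      linarith
    have h2 := exp_neg_le_quadratic (y := n * (1 - r))
      (mul_nonneg (Nat.cast_nonneg n) (by linarith [hr.2]))
    simp only
    nlinarith
  · rw [e r hr, mean, ← integral_mul_const]
    refine integral_mono ((integrable_const _).sub (integrable_pow μ ⟨hr.1, hr.2.le⟩))
      (hi.mul_const _) fun n => ?_
    have := one_add_mul_le_pow (a := r - 1) (by linarith [hr.1]) n
    simp only [add_sub_cancel] at this ⊢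
    linarith

end genFun

section lst

variable (β : Measure ℝ) [IsProbabilityMeasure β] (hβ : β (Iio 0) = 0)

include hβ

omit [IsProbabilityMeasure β] in
lemma ae_nonneg_of_measure_Iio : ∀ᵐ x ∂β, 0 ≤ x := by
  filter_upwards [measure_eq_zero_iff_ae_notMem.1 hβ] with x hx using not_lt.1 hx

lemma integrable_exp_neg {s : ℝ} (hs : 0 ≤ s) : Integrable (fun x => Real.exp (-(s * x))) β := by
  refine (integrable_const (1 : ℝ)).mono' (by fun_prop) ?_
  filter_upwards [ae_nonneg_of_measure_Iio β hβ] with x hx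
  rw [Real.norm_eq_abs, abs_of_pos (Real.exp_pos _), Real.exp_le_one_iff]
  nlinarith [mul_nonneg hs hx]

lemma continuousOn_lst : ContinuousOn (lst β) (Ici 0) := by
  intro s _
  refine tendsto_integral_filter_of_dominated_convergence (fun _ => 1)
    (Eventually.of_forall fun _ => by fun_prop) ?_
    (integrable_const _) (ae_of_all _ fun x => ?_)
  · filter_upwards [self_mem_nhdsWithin] with s hs
    filter_upwards [ae_nonneg_of_measure_Iio β hβ] with x hx
    rw [Real.norm_eq_abs, abs_of_pos (Real.exp_pos _), Real.exp_le_one_iff]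
    nlinarith [mul_nonneg (mem_Ici.1 hs) hx]
  · have : Continuous fun s : ℝ => Real.exp (-(s * x)) := by fun_prop
    exact (this.tendsto s).mono_left nhdsWithin_le_nhds

omit hβ in
lemma integrable_id_of_sq (hβ2 : Integrable (fun x => x ^ 2) β) : Integrable (fun x => x) β :=
  (hβ2.add (integrable_const (1 : ℝ))).mono' (by fun_prop) (ae_of_all _ fun x => by
    rw [Real.norm_eq_abs]
    simp only [Pi.add_apply]
    nlinarith [sq_abs x, sq_nonneg (|x| - 1), abs_nonneg x])

lemma one_sub_lst_le (hβ2 : Integrable (fun x => x ^ 2) β) {lam : ℝ} (hlam : 0 < lam) {r : ℝ}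
    (hr : r ≤ 1) : 1 - lst β (lam * (1 - r)) ≤ load lam β * (1 - r) := by
  have hs : 0 ≤ lam * (1 - r) := mul_nonneg hlam.le (by linarith)
  have e : 1 - lst β (lam * (1 - r)) = ∫ x, (1 - Real.exp (-(lam * (1 - r) * x))) ∂β := by
    rw [integral_sub (integrable_const _) (integrable_exp_neg β hβ hs), lst]
    simp
  rw [e, load, mul_right_comm, ← integral_const_mul]
  refine integral_mono ((integrable_const _).sub (integrable_exp_neg β hβ hs))
    ((integrable_id_of_sq β hβ2).const_mul _) fun x => ?_
  have := Real.add_one_le_exp (-(lam * (1 - r) * x))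
  simp only
  linarith

lemma tendsto_one_sub_lst_div (hβ2 : Integrable (fun x => x ^ 2) β) {lam : ℝ} (hlam : 0 < lam) :
    Tendsto (fun r => (1 - lst β (lam * (1 - r))) / (1 - r)) (𝓝[Ico 0 1] 1)
      (𝓝 (load lam β)) := by
  have hi := integrable_id_of_sq β hβ2
  refine tendsto_div_of_quadratic_bounds (s := lam ^ 2 * ∫ x, x ^ 2 ∂β) (fun r hr => ?_)
    (fun r hr => one_sub_lst_le β hβ hβ2 hlam hr.2.le)
  have hs : 0 ≤ lam * (1 - r) := mul_nonneg hlam.le (by linarith [hr.2])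
  have e : 1 - lst β (lam * (1 - r)) = ∫ x, (1 - Real.exp (-(lam * (1 - r) * x))) ∂β := by
    rw [integral_sub (integrable_const _) (integrable_exp_neg β hβ hs), lst]
    simp
  have e2 : load lam β * (1 - r) - lam ^ 2 * (∫ x, x ^ 2 ∂β) * (1 - r) ^ 2 =
      ∫ x, (lam * (1 - r) * x - lam ^ 2 * (1 - r) ^ 2 * x ^ 2) ∂β := by
    rw [integral_sub (hi.const_mul _) (hβ2.const_mul _), integral_const_mul, integral_const_mul,
      load]
    ring
  rw [e, e2]
  refine integral_mono_ae ((hi.const_mul _).sub (hβ2.const_mul _))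
    ((integrable_const _).sub (integrable_exp_neg β hβ hs)) ?_
  filter_upwards [ae_nonneg_of_measure_Iio β hβ] with x hx
  have := exp_neg_le_quadratic (y := lam * (1 - r) * x) (mul_nonneg hs hx)
  nlinarith

variable {lam : ℝ} (hlam : 0 < lam) (hβ2 : Integrable (fun x => x ^ 2) β)
  (hρ : load lam β < 1)

include hlam hβ2 hρ

lemma lst_sub_pos {r : ℝ} (hr : r < 1) : 0 < lst β (lam * (1 - r)) - r := by
  have := one_sub_lst_le β hβ hβ2 hlam hr.le
  nlinarith [mul_pos (sub_pos.2 hρ) (sub_pos.2 hr)]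

omit hβ2 hρ in
lemma continuousOn_lst_comp : ContinuousOn (fun r => lst β (lam * (1 - r))) (Icc 0 1) :=
  (continuousOn_lst β hβ).comp (by fun_prop) fun r hr =>
    mul_nonneg hlam.le (by linarith [hr.2])

/-- The common form of `Y` and `K`: the singularity at `1` is removable. -/
lemma continuousOn_of_slope {h : ℝ → ℝ} (hh : ContinuousOn h (Icc 0 1)) {m : ℝ}
    (hm : Tendsto (fun r => h r / (1 - r)) (𝓝[Ico 0 1] 1) (𝓝 m)) :
    ContinuousOn (fun r => if r = 1 then m / (1 - load lam β) else
      lst β (lam * (1 - r)) * h r / (lst β (lam * (1 - r)) - r)) (Icc 0 1) := by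
  have hb := continuousOn_lst_comp β hβ hlam
  have hIco : ContinuousOn (fun r => lst β (lam * (1 - r)) * h r / (lst β (lam * (1 - r)) - r))
      (Ico 0 1) := by
    refine ((hb.mul hh).mono Ico_subset_Icc_self).div
      ((hb.sub continuousOn_id).mono Ico_subset_Icc_self) fun r hr => ?_
    exact (lst_sub_pos β hβ hlam hβ2 hρ hr.2).ne'
  intro r hr
  rcases eq_or_lt_of_le hr.2 with rfl | hr1
  · have h0 : lst β (lam * (1 - 1)) = 1 := by simp [lst]
    rw [← insert_eq_of_mem hr, ← Ico_union_right (zero_le_one' ℝ), insert_union_distrib]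
    have h1 : Tendsto (fun r => lst β (lam * (1 - r))) (𝓝[Ico 0 1] 1) (𝓝 1) := by
      have := (hb 1 hr).mono_left (nhdsWithin_mono 1
        (Ico_subset_Icc_self : Ico (0 : ℝ) 1 ⊆ Icc 0 1))
      simpa only [h0] using this
    have h2 := tendsto_one_sub_lst_div β hβ hβ2 hlam
    have h3 : Tendsto (fun r => lst β (lam * (1 - r)) * (h r / (1 - r)) /
        (1 - (1 - lst β (lam * (1 - r))) / (1 - r))) (𝓝[Ico 0 1] 1)
        (𝓝 (1 * m / (1 - load lam β))) :=
      (h1.mul hm).div (tendsto_const_nhds.sub h2) (by linarith)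
    rw [one_mul] at h3
    have h4 : insert (1 : ℝ) (Ico 0 1) ∪ insert 1 {1} = insert 1 (Ico 0 1) := by simp
    rw [h4, continuousWithinAt_insert_self, ContinuousWithinAt, if_pos rfl]
    refine h3.congr' ?_
    filter_upwards [self_mem_nhdsWithin] with x hx
    have h5 : 0 < 1 - x := by linarith [hx.2]
    have h6 := lst_sub_pos β hβ hlam hβ2 hρ hx.2
    rw [if_neg hx.2.ne]
    have h7 : 1 - (1 - lst β (lam * (1 - x))) / (1 - x) = (lst β (lam * (1 - x)) - x) / (1 - x) := by
      field_simp
      ring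
    rw [h7]
    field_simp
  · have h1 := hIco r ⟨hr.1, hr1⟩
    have h2 : ContinuousWithinAt (fun r => lst β (lam * (1 - r)) * h r /
        (lst β (lam * (1 - r)) - r)) (Icc 0 1) r := by
      refine h1.mono_of_mem_nhdsWithin ?_
      filter_upwards [self_mem_nhdsWithin, nhdsWithin_le_nhds (Iio_mem_nhds hr1)] with x hx hx1
      exact ⟨hx.1, hx1⟩
    refine h2.congr_of_eventuallyEq ?_ (if_neg hr1.ne)
    filter_upwards [nhdsWithin_le_nhds (Iio_mem_nhds hr1)] with x hx1
    exact if_neg (ne_of_lt hx1)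

variable (X X₀ : Measure ℕ) [IsProbabilityMeasure X] [IsProbabilityMeasure X₀]

lemma continuousOn_Y (hX : Integrable (fun n : ℕ => (n : ℝ) ^ 2) X) :
    ContinuousOn (Y lam β X) (Icc 0 1) :=
  continuousOn_of_slope β hβ hlam hβ2 hρ (h := fun r => 1 - genFun X r)
    (continuousOn_const.sub (continuousOn_genFun X)) (tendsto_one_sub_genFun_div X hX)

lemma continuousOn_K (hX : Integrable (fun n : ℕ => (n : ℝ) ^ 2) X)
    (hX₀ : Integrable (fun n : ℕ => (n : ℝ) ^ 2) X₀) :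
    ContinuousOn (K lam β X X₀) (Icc 0 1) := by
  refine continuousOn_of_slope β hβ hlam hβ2 hρ (h := fun r => genFun X r - genFun X₀ r)
    ((continuousOn_genFun X).sub (continuousOn_genFun X₀)) ?_
  refine ((tendsto_one_sub_genFun_div X₀ hX₀).sub (tendsto_one_sub_genFun_div X hX)).congr
    fun r => ?_
  ring

end lst

/-! ### Power series with summable coefficients -/

/-- The power series with coefficients `q`. -/
def powSum (q : ℕ → ℝ) (r : ℝ) : ℝ := ∑' z, q z * r ^ z

/-- The primitive of the power series with coefficients `q`. -/
def avgSum (q : ℕ → ℝ) (r : ℝ) : ℝ := ∑' z, q z * (r ^ (z + 1) / (z + 1))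

section PowerSeries

variable {q : ℕ → ℝ} (hq : Summable fun z => |q z|)

include hq

lemma summable_mul_of_abs_le_one {f : ℕ → ℝ} (hf : ∀ z, |f z| ≤ 1) :
    Summable fun z => q z * f z :=
  Summable.of_norm_bounded hq fun z => by
    rw [Real.norm_eq_abs, abs_mul]
    exact mul_le_of_le_one_right (abs_nonneg _) (hf z)

omit hq in
lemma abs_pow_le_one_of_mem {r : ℝ} (hr : r ∈ Icc (0 : ℝ) 1) (z : ℕ) : |r ^ z| ≤ 1 := by
  rw [abs_of_nonneg (pow_nonneg hr.1 z)]
  exact pow_le_one₀ hr.1 hr.2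

omit hq in
lemma abs_pow_succ_div_le_one {r : ℝ} (hr : r ∈ Icc (0 : ℝ) 1) (z : ℕ) :
    |r ^ (z + 1) / ((z : ℝ) + 1)| ≤ 1 := by
  rw [abs_of_nonneg (div_nonneg (pow_nonneg hr.1 _) (by positivity)), div_le_one (by positivity)]
  exact (pow_le_one₀ hr.1 hr.2).trans (by linarith [(Nat.cast_nonneg z : (0 : ℝ) ≤ z)])

lemma continuousOn_powSum : ContinuousOn (powSum q) (Icc 0 1) :=
  continuousOn_tsum (fun z => by fun_prop) hq fun z r hr => by
    rw [Real.norm_eq_abs, abs_mul]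
    exact mul_le_of_le_one_right (abs_nonneg _) (abs_pow_le_one_of_mem hr z)

lemma continuousOn_avgSum : ContinuousOn (avgSum q) (Icc 0 1) :=
  continuousOn_tsum (fun z => by fun_prop) hq fun z r hr => by
    rw [Real.norm_eq_abs, abs_mul]
    exact mul_le_of_le_one_right (abs_nonneg _) (abs_pow_succ_div_le_one hr z)

lemma hasDerivAt_avgSum {r : ℝ} (hr : r ∈ Ioo (0 : ℝ) 1) :
    HasDerivAt (avgSum q) (powSum q r) r := by
  refine hasDerivAt_tsum_of_isPreconnected (t := Ioo (0 : ℝ) 1)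
    (g := fun z r => q z * (r ^ (z + 1) / (z + 1))) (g' := fun z r => q z * r ^ z) hq isOpen_Ioo
    isPreconnected_Ioo (fun z y _ => ?_) (fun z y hy => ?_) hr ?_ hr
  · have h := (((hasDerivAt_pow (z + 1) y).div_const ((z : ℝ) + 1)).const_mul (q z))
    refine h.congr_deriv ?_
    have : (z : ℝ) + 1 ≠ 0 := by positivity
    push_cast
    field_simp
  · rw [Real.norm_eq_abs, abs_mul]
    exact mul_le_of_le_one_right (abs_nonneg _) (abs_pow_le_one_of_mem ⟨hy.1.le, hy.2.le⟩ z)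
  · exact summable_mul_of_abs_le_one hq fun z => abs_pow_succ_div_le_one ⟨hr.1.le, hr.2.le⟩ z

omit hq in
lemma powSum_zero : powSum q 0 = q 0 := by
  rw [powSum, tsum_eq_single 0 fun z hz => by simp [hz]]
  simp

lemma coeff_zero_of_powSum_eq_zero (h : ∀ r ∈ Ioo (0 : ℝ) 1, powSum q r = 0) : q 0 = 0 := by
  have h1 : Tendsto (powSum q) (𝓝[Ioo 0 1] 0) (𝓝 (powSum q 0)) :=
    (continuousOn_powSum hq 0 (by simp)).mono_left (nhdsWithin_mono 0 Ioo_subset_Icc_self)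
  have h2 : Tendsto (powSum q) (𝓝[Ioo 0 1] 0) (𝓝 0) :=
    tendsto_const_nhds.congr'
      (by filter_upwards [self_mem_nhdsWithin] with r hr using (h r hr).symm)
  have : (𝓝[Ioo (0 : ℝ) 1] 0).NeBot := by
    rw [nhdsWithin_Ioo_eq_nhdsGT one_pos]
    infer_instance
  rw [← powSum_zero (q := q)]
  exact tendsto_nhds_unique h1 h2

/-- A power series that vanishes on `(0, 1)` has vanishing coefficients. -/
lemma eq_zero_of_powSum_eq_zero (h : ∀ r ∈ Ioo (0 : ℝ) 1, powSum q r = 0) (n : ℕ) : q n = 0 := by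
  induction n generalizing q with
  | zero => exact coeff_zero_of_powSum_eq_zero hq h
  | succ n ih =>
    have h0 := coeff_zero_of_powSum_eq_zero hq h
    refine ih (q := fun z => q (z + 1)) ((summable_nat_add_iff 1).2 hq) fun r hr => ?_
    have h3 := h r hr
    have hs := summable_mul_of_abs_le_one hq (abs_pow_le_one_of_mem ⟨hr.1.le, hr.2.le⟩)
    rw [powSum, hs.tsum_eq_zero_add, h0, zero_mul, zero_add] at h3
    have h4 : ∑' z, q (z + 1) * r ^ (z + 1) = r * powSum (fun z => q (z + 1)) r := by
      rw [powSum, ← tsum_mul_left]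
      exact tsum_congr fun z => by ring
    rw [h4] at h3
    exact (mul_eq_zero.1 h3).resolve_left hr.1.ne'

end PowerSeries

/-! ### The differential equation for the generating function -/

section ODE

variable {Y K : ℝ → ℝ} (hY : ContinuousOn Y (Icc 0 1)) (hK : ContinuousOn K (Icc 0 1))

include hY

lemma intervalIntegrable_div_id {a b : ℝ} (ha : a ∈ Ioc (0 : ℝ) 1) (hb : b ∈ Ioc (0 : ℝ) 1) :
    IntervalIntegrable (fun x => Y x / x) volume a b := by
  refine ContinuousOn.intervalIntegrable ?_
  have hsub : uIcc a b ⊆ Ioc 0 1 := ordConnected_Ioc.uIcc_subset ha hb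
  exact (hY.mono (hsub.trans Ioc_subset_Icc_self)).div continuousOn_id fun x hx => (hsub hx).1.ne'

lemma continuousOn_primitive_div {a : ℝ} (ha : a ∈ Ioc (0 : ℝ) 1) :
    ContinuousOn (fun r => ∫ x in r..1, Y x / x) (Icc a 1) := by
  have h := intervalIntegrable_div_id hY ha ⟨one_pos, le_rfl⟩
  rw [intervalIntegrable_iff_integrableOn_Icc_of_le ha.2, ← uIcc_of_le ha.2] at h
  rw [← uIcc_of_le ha.2]
  exact intervalIntegral.continuousOn_primitive_interval_left h

lemma hasDerivAt_primitive_div {r : ℝ} (hr : r ∈ Ioo (0 : ℝ) 1) :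
    HasDerivAt (fun r => ∫ x in r..1, Y x / x) (-(Y r / r)) r := by
  have hc : ContinuousOn (fun x => Y x / x) (Ioo 0 1) :=
    (hY.mono Ioo_subset_Icc_self).div continuousOn_id fun x hx => hx.1.ne'
  exact intervalIntegral.integral_hasDerivAt_left
    (intervalIntegrable_div_id hY ⟨hr.1, hr.2.le⟩ ⟨one_pos, le_rfl⟩)
    (hc.stronglyMeasurableAtFilter isOpen_Ioo r hr) (hc.continuousAt (Ioo_mem_nhds hr.1 hr.2))

include hK

/-- Variation of constants for `R' = (Y / r) R + c K`, where `R` is the primitive of the power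
series. -/
lemma avgSum_mul_exp_sub {q : ℕ → ℝ} (hq : Summable fun z => |q z|) {c : ℝ}
    (hode : ∀ r ∈ Ioo (0 : ℝ) 1, powSum q r = Y r * (avgSum q r / r) + c * K r) {a b : ℝ}
    (ha : 0 < a) (hab : a ≤ b) (hb : b ≤ 1) :
    avgSum q b * Real.exp (∫ x in b..1, Y x / x) - avgSum q a * Real.exp (∫ x in a..1, Y x / x) =
      c * ∫ y in a..b, K y * Real.exp (∫ x in y..1, Y x / x) := by
  have hα : ContinuousOn (fun r => Real.exp (∫ x in r..1, Y x / x)) (Icc a b) :=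
    Real.continuous_exp.comp_continuousOn
      ((continuousOn_primitive_div hY ⟨ha, hab.trans hb⟩).mono (Icc_subset_Icc_right hb))
  have hsub : Icc a b ⊆ Icc 0 1 := Icc_subset_Icc ha.le hb
  rw [← intervalIntegral.integral_const_mul]
  refine (intervalIntegral.integral_eq_sub_of_hasDerivAt_of_le
    (f := fun r => avgSum q r * Real.exp (∫ x in r..1, Y x / x)) hab
    (((continuousOn_avgSum hq).mono hsub).mul hα) (fun r hr => ?_) ?_).symm
  · have hr' : r ∈ Ioo (0 : ℝ) 1 := ⟨ha.trans hr.1, hr.2.trans_le hb⟩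
    refine ((hasDerivAt_avgSum hq hr').mul (hasDerivAt_primitive_div hY hr').exp).congr_deriv ?_
    rw [hode r hr']
    ring
  · refine ContinuousOn.intervalIntegrable ?_
    rw [uIcc_of_le hab]
    exact continuousOn_const.mul ((hK.mono hsub).mul hα)

omit hK

/-- If `Y 0 < 1`, the exponential factor is dominated near `0` by a power with exponent above
`-1`. -/
lemma exists_exp_le_rpow (hY0 : Y 0 < 1) : ∃ y < (1 : ℝ), ∃ C, ∃ ε ∈ Ioc (0 : ℝ) 1,
    ∀ r ∈ Ioc 0 ε, Real.exp (∫ x in r..1, Y x / x) ≤ C * r ^ (-y) := by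
  obtain ⟨y, hy0, hy1⟩ := exists_between hY0
  have h1 : ∀ᶠ x in 𝓝[Icc 0 1] (0 : ℝ), Y x < y := (hY 0 (by simp)).eventually_lt_const hy0
  rw [eventually_nhdsWithin_iff, Metric.eventually_nhds_iff] at h1
  obtain ⟨δ, hδ, h2⟩ := h1
  set ε := min (δ / 2) 1 with hε
  have hε0 : 0 < ε := lt_min (by linarith) one_pos
  have hε1 : ε ≤ 1 := min_le_right _ _
  have h3 : ∀ x ∈ Ioc 0 ε, Y x ≤ y := fun x hx => by
    have hxδ : x ≤ δ / 2 := hx.2.trans (min_le_left _ _)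
    refine (h2 (y := x) ?_ ⟨hx.1.le, hx.2.trans hε1⟩).le
    rw [Real.dist_eq, sub_zero, abs_of_pos hx.1]
    linarith
  refine ⟨y, hy1, Real.exp (y * Real.log ε + ∫ x in ε..1, Y x / x), ε, ⟨hε0, hε1⟩, fun r hr => ?_⟩
  have h4 : ∫ x in r..ε, Y x / x ≤ y * (Real.log ε - Real.log r) := by
    have h5 : ∫ x in r..ε, y * x⁻¹ = y * (Real.log ε - Real.log r) := by
      rw [intervalIntegral.integral_const_mul, integral_inv_of_pos hr.1 hε0,
        Real.log_div hε0.ne' hr.1.ne']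
    rw [← h5]
    refine intervalIntegral.integral_mono_on hr.2
      (intervalIntegrable_div_id hY ⟨hr.1, hr.2.trans hε1⟩ ⟨hε0, hε1⟩) ?_ fun x hx => ?_
    · refine ContinuousOn.intervalIntegrable ?_
      rw [uIcc_of_le hr.2]
      exact continuousOn_const.mul (continuousOn_inv₀.mono fun x hx => (hr.1.trans_le hx.1).ne')
    · have hx0 : 0 < x := hr.1.trans_le hx.1
      rw [div_eq_mul_inv]
      exact mul_le_mul_of_nonneg_right (h3 x ⟨hx0, hx.2⟩) (inv_nonneg.2 hx0.le)
  rw [← intervalIntegral.integral_add_adjacent_intervals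
    (intervalIntegrable_div_id hY ⟨hr.1, hr.2.trans hε1⟩ ⟨hε0, hε1⟩)
    (intervalIntegrable_div_id hY ⟨hε0, hε1⟩ ⟨one_pos, le_rfl⟩), Real.rpow_def_of_pos hr.1,
    ← Real.exp_add, Real.exp_le_exp]
  linarith

include hK

lemma intervalIntegrable_mul_exp (hY0 : Y 0 < 1) :
    IntervalIntegrable (fun y => K y * Real.exp (∫ x in y..1, Y x / x)) volume 0 1 := by
  obtain ⟨y, hy1, C, ε, hε, hC⟩ := exists_exp_le_rpow hY hY0
  have hc : ∀ a ∈ Ioc (0 : ℝ) 1,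
      ContinuousOn (fun y => K y * Real.exp (∫ x in y..1, Y x / x)) (Icc a 1) := fun a ha =>
    (hK.mono (Icc_subset_Icc_left ha.1.le)).mul
      (Real.continuous_exp.comp_continuousOn (continuousOn_primitive_div hY ha))
  have hc' : ContinuousOn (fun y => K y * Real.exp (∫ x in y..1, Y x / x)) (Ioc 0 ε) := by
    intro a ha
    have ha1 : a ≤ 1 := ha.2.trans hε.2
    have h1 := hc (a / 2) ⟨half_pos ha.1, by linarith [ha.1]⟩ a ⟨by linarith [ha.1], ha1⟩
    refine (h1.mono_of_mem_nhdsWithin ?_)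
    filter_upwards [self_mem_nhdsWithin, nhdsWithin_le_nhds (Ioi_mem_nhds (half_lt_self ha.1))]
      with x hx1 hx2
    exact ⟨le_of_lt hx2, hx1.2.trans hε.2⟩
  refine IntervalIntegrable.trans (b := ε) ?_ (by
    refine ContinuousOn.intervalIntegrable ?_
    rw [uIcc_of_le hε.2]
    exact hc ε hε)
  obtain ⟨B, hB⟩ := isCompact_Icc.exists_bound_of_continuousOn hK
  have hB0 : 0 ≤ B := (norm_nonneg _).trans (hB 0 (by simp))
  have hint : IntervalIntegrable (fun r : ℝ => B * (C * r ^ (-y))) volume 0 ε :=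
    ((intervalIntegral.intervalIntegrable_rpow' (by linarith)).const_mul C).const_mul B
  refine hint.mono_fun' ?_ ?_
  · rw [uIoc_of_le hε.1.le]
    exact hc'.aestronglyMeasurable measurableSet_Ioc
  · rw [uIoc_of_le hε.1.le]
    filter_upwards [ae_restrict_mem measurableSet_Ioc] with r hr
    rw [norm_mul, Real.norm_eq_abs (Real.exp _), abs_of_pos (Real.exp_pos _)]
    exact mul_le_mul (hB r ⟨hr.1.le, hr.2.trans hε.2⟩) (hC r hr) (Real.exp_pos _).le hB0

/-- The solution of the differential equation when `Y 0 < 1`: the constant of integration vanishes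
because the primitive is `O(r)` at `0`. -/
lemma avgSum_mul_exp_eq (hY0 : Y 0 < 1) {q : ℕ → ℝ} (hq : Summable fun z => |q z|) {c : ℝ}
    (hode : ∀ r ∈ Ioo (0 : ℝ) 1, powSum q r = Y r * (avgSum q r / r) + c * K r) {r : ℝ}
    (hr : r ∈ Ioc (0 : ℝ) 1) :
    avgSum q r * Real.exp (∫ x in r..1, Y x / x) =
      c * ∫ y in (0 : ℝ)..r, K y * Real.exp (∫ x in y..1, Y x / x) := by
  obtain ⟨y, hy1, C, ε, hε, hC⟩ := exists_exp_le_rpow hY hY0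
  have hint := intervalIntegrable_mul_exp hY hK hY0
  have h1 : Tendsto (fun a => avgSum q a * Real.exp (∫ x in a..1, Y x / x)) (𝓝[>] 0) (𝓝 0) := by
    have h2 : Tendsto (fun a : ℝ => (∑' z, |q z|) * (C * a ^ (1 - y))) (𝓝[>] 0) (𝓝 0) := by
      have h3 : ContinuousAt (fun a : ℝ => (∑' z, |q z|) * (C * a ^ (1 - y))) 0 :=
        continuousAt_const.mul (continuousAt_const.mul
          (Real.continuousAt_rpow_const 0 (1 - y) (Or.inr (by linarith))))
      have h4 := h3.tendsto.mono_left (nhdsWithin_le_nhds (s := Ioi (0 : ℝ)))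
      simpa [Real.zero_rpow (by linarith : 1 - y ≠ 0)] using h4
    refine squeeze_zero_norm' ?_ h2
    filter_upwards [Ioc_mem_nhdsGT hε.1] with a ha
    have ha1 : a ≤ 1 := ha.2.trans hε.2
    have h5 : |avgSum q a| ≤ (∑' z, |q z|) * a := by
      rw [← tsum_mul_right]
      have hs : Summable fun z => ‖q z * (a ^ (z + 1) / ((z : ℝ) + 1))‖ :=
        (summable_mul_of_abs_le_one hq fun z => abs_pow_succ_div_le_one ⟨ha.1.le, ha1⟩ z).norm
      rw [← Real.norm_eq_abs, avgSum]
      refine (norm_tsum_le_tsum_norm hs).trans (hs.tsum_le_tsum (fun z => ?_) (hq.mul_right a))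
      rw [Real.norm_eq_abs, abs_mul]
      refine mul_le_mul_of_nonneg_left ?_ (abs_nonneg _)
      rw [abs_of_nonneg (div_nonneg (pow_nonneg ha.1.le _) (by positivity)),
        div_le_iff₀ (by positivity), pow_succ']
      refine mul_le_mul_of_nonneg_left ?_ ha.1.le
      exact (pow_le_one₀ ha.1.le ha1).trans (by linarith [(Nat.cast_nonneg z : (0 : ℝ) ≤ z)])
    rw [norm_mul, Real.norm_eq_abs, Real.norm_eq_abs (Real.exp _), abs_of_pos (Real.exp_pos _)]
    have h6 : a ^ (1 - y) = a * a ^ (-y) := by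
      rw [sub_eq_add_neg, Real.rpow_add ha.1, Real.rpow_one]
    calc _ ≤ ((∑' z, |q z|) * a) * (C * a ^ (-y)) :=
          mul_le_mul h5 (hC a ha) (Real.exp_pos _).le
            (mul_nonneg (tsum_nonneg fun z => abs_nonneg _) ha.1.le)
      _ = _ := by
          rw [h6]
          ring
  have h2 : Tendsto (fun a => c * ∫ y in a..r, K y * Real.exp (∫ x in y..1, Y x / x)) (𝓝[>] 0)
      (𝓝 (c * ∫ y in (0 : ℝ)..r, K y * Real.exp (∫ x in y..1, Y x / x))) := by
    refine Tendsto.const_mul c ?_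
    have hint' : IntegrableOn (fun y => K y * Real.exp (∫ x in y..1, Y x / x)) (uIcc 0 r) := by
      rw [uIcc_of_le hr.1.le]
      rw [intervalIntegrable_iff_integrableOn_Icc_of_le zero_le_one] at hint
      exact hint.mono_set (Icc_subset_Icc_right hr.2)
    have h3 := intervalIntegral.continuousOn_primitive_interval_left hint' 0 left_mem_uIcc
    rw [uIcc_of_le hr.1.le] at h3
    refine h3.mono_left ?_
    rw [← nhdsWithin_Ioo_eq_nhdsGT hr.1]
    exact nhdsWithin_mono 0 Ioo_subset_Icc_self
  have h3 : Tendsto (fun a => avgSum q r * Real.exp (∫ x in r..1, Y x / x) -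
      avgSum q a * Real.exp (∫ x in a..1, Y x / x)) (𝓝[>] 0)
      (𝓝 (avgSum q r * Real.exp (∫ x in r..1, Y x / x) - 0)) := tendsto_const_nhds.sub h1
  rw [sub_zero] at h3
  refine tendsto_nhds_unique h3 (h2.congr' ?_)
  filter_upwards [Ioc_mem_nhdsGT hr.1] with a ha
  exact (avgSum_mul_exp_sub hY hK hq hode ha.1 ha.2 hr.2).symm

end ODE

/-! ### Limits of the visit frequencies -/

lemma lintegral_pow_eq_genFun (μ : Measure ℕ) [IsProbabilityMeasure μ] {r : ℝ}
    (hr : r ∈ Icc (0 : ℝ) 1) :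
    ∫⁻ n, ENNReal.ofReal r ^ n ∂μ = ENNReal.ofReal (genFun μ r) := by
  rw [genFun, ofReal_integral_eq_lintegral_ofReal (integrable_pow μ hr)
    (ae_of_all _ fun n => pow_nonneg hr.1 n)]
  exact lintegral_congr fun n => (ENNReal.ofReal_pow hr.1 n).symm

lemma lintegral_natCast_eq_mean (μ : Measure ℕ) (h : Integrable (fun n : ℕ => (n : ℝ)) μ) :
    ∫⁻ n, (n : ℝ≥0∞) ∂μ = ENNReal.ofReal (mean μ) := by
  rw [mean, ofReal_integral_eq_lintegral_ofReal h (ae_of_all _ fun n => Nat.cast_nonneg n)]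
  exact lintegral_congr fun n => (ENNReal.ofReal_natCast n).symm

lemma mean_nonneg (μ : Measure ℕ) : 0 ≤ mean μ := integral_nonneg fun n => Nat.cast_nonneg n

lemma lst_mem_Icc (β : Measure ℝ) [IsProbabilityMeasure β] (hβ : β (Iio 0) = 0) {s : ℝ}
    (hs : 0 ≤ s) : lst β s ∈ Icc (0 : ℝ) 1 := by
  refine ⟨integral_nonneg fun x => (Real.exp_pos _).le, ?_⟩
  have h := integral_mono_ae (integrable_exp_neg β hβ hs) (integrable_const (1 : ℝ)) (by
    filter_upwards [ae_nonneg_of_measure_Iio β hβ] with x hx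
    exact Real.exp_le_one_iff.2 (by simpa using mul_nonneg hs hx))
  simpa [lst] using h

/-- The generating function of a variable that is `0` with probability `1 - p` and has law `μ`
otherwise. -/
lemma one_sub_mul_genFun_mem_Icc (μ : Measure ℕ) [IsProbabilityMeasure μ] {p : ℝ}
    (hp : p ∈ Icc (0 : ℝ) 1) {r : ℝ} (hr : r ∈ Icc (0 : ℝ) 1) :
    1 - p * (1 - genFun μ r) ∈ Icc (0 : ℝ) 1 :=
  ⟨sub_nonneg.2 (mul_le_one₀ hp.2 (sub_nonneg.2 (genFun_le_one μ hr))
    (sub_le_self 1 (genFun_nonneg μ hr.1))),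
    sub_le_self _ (mul_nonneg hp.1 (sub_nonneg.2 (genFun_le_one μ hr)))⟩

section Visits

variable {lam : ℝ} (hlam : 0 < lam)
  {β : Measure ℝ} [IsProbabilityMeasure β] (hβ : β (Iio 0) = 0) {θ : Measure Θ}
  [IsProbabilityMeasure θ] {ψ : ℕ → ℝ} (hψ : ψ 0 = 1) {R : VacationRule Θ}
  (hR0 : (vacationArrivals lam θ R 0).real {0} = 0) (k : ℕ) {t : ℝ} (ht : 0 ≤ t)

include hlam hβ hψ hR0 ht

lemma visits_ne_top (z : ℕ) : visits lam β θ ψ R k t z ≠ ∞ :=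
  ((ENNReal.le_tsum z).trans (tsum_visits_le hlam hβ hψ hR0 k ht)).trans_lt
    ENNReal.ofReal_lt_top |>.ne

lemma summable_toReal_visits : Summable fun z => (visits lam β θ ψ R k t z).toReal :=
  ENNReal.summable_toReal
    ((tsum_visits_le hlam hβ hψ hR0 k ht).trans_lt ENNReal.ofReal_lt_top).ne

lemma tsum_toReal_visits_le :
    ∑' z, (visits lam β θ ψ R k t z).toReal ≤ k + 1 + lam * t := by
  rw [← ENNReal.tsum_toReal_eq (visits_ne_top hlam hβ hψ hR0 k ht)]
  exact ENNReal.toReal_le_of_le_ofReal (by positivity) (tsum_visits_le hlam hβ hψ hR0 k ht)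

lemma summable_toReal_visits_mul {f : ℕ → ℝ} {C : ℝ} (hf : ∀ z, |f z| ≤ C) :
    Summable fun z => (visits lam β θ ψ R k t z).toReal * f z := by
  refine Summable.of_norm_bounded
    ((summable_toReal_visits hlam hβ hψ hR0 k ht).mul_right C) fun z => ?_
  rw [Real.norm_eq_abs, abs_mul, abs_of_nonneg ENNReal.toReal_nonneg]
  exact mul_le_mul_of_nonneg_left (hf z) ENNReal.toReal_nonneg

lemma tsum_visits_mul_ofReal {f : ℕ → ℝ} {C : ℝ} (hf0 : ∀ z, 0 ≤ f z) (hf : ∀ z, f z ≤ C) :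
    ∑' z, visits lam β θ ψ R k t z * ENNReal.ofReal (f z) =
      ENNReal.ofReal (∑' z, (visits lam β θ ψ R k t z).toReal * f z) := by
  rw [ENNReal.ofReal_tsum_of_nonneg
    (fun z => mul_nonneg ENNReal.toReal_nonneg (hf0 z))
    (summable_toReal_visits_mul hlam hβ hψ hR0 k ht fun z => by
      rw [abs_of_nonneg (hf0 z)]
      exact hf z)]
  refine tsum_congr fun z => ?_
  rw [ENNReal.ofReal_mul ENNReal.toReal_nonneg,
    ENNReal.ofReal_toReal (visits_ne_top hlam hβ hψ hR0 k ht z)]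

/-- The balance of the generating function over the embedded transitions, with an error that does
not depend on time. -/
lemma abs_tsum_visits_balance (hψ0 : ∀ z, 0 ≤ ψ z) (hψ1 : ∀ z, ψ z ≤ 1) {r : ℝ}
    (hr : r ∈ Icc (0 : ℝ) 1) :
    |∑' z, (visits lam β θ ψ R k t z).toReal * (r ^ z * (r - lst β (lam * (1 - r)) *
      (1 - ψ z * (1 - genFun (vacationArrivals lam θ R z) r))))| ≤ 1 := by
  have hp := isProbabilityMeasure_vacationArrivals hlam θ R
  set b := lst β (lam * (1 - r)) with hb
  have hs0 : 0 ≤ lam * (1 - r) := mul_nonneg hlam.le (by linarith [hr.2])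
  obtain ⟨hb0, hb1⟩ := lst_mem_Icc β hβ hs0
  rw [← hb] at hb0 hb1
  set g : ℕ → ℝ := fun z => 1 - ψ z * (1 - genFun (vacationArrivals lam θ R z) r) with hg
  have hgn : ∀ z, 0 ≤ genFun (vacationArrivals lam θ R z) r := fun z => genFun_nonneg _ hr.1
  have hg0 : ∀ z, 0 ≤ g z := fun z => (one_sub_mul_genFun_mem_Icc _ ⟨hψ0 z, hψ1 z⟩ hr).1
  have hg1 : ∀ z, g z ≤ 1 := fun z => (one_sub_mul_genFun_mem_Icc _ ⟨hψ0 z, hψ1 z⟩ hr).2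
  have hr1 : ∀ z, r ^ z ≤ 1 := fun z => pow_le_one₀ hr.1 hr.2
  have hr0 : ∀ z, 0 ≤ r ^ z := fun z => pow_nonneg hr.1 z
  have h := visits_balance (β := β) (θ := θ) hlam hβ hψ hψ0 hψ1 hR0 k ht hr.1 hr.2
  have hA : ∀ z, visits lam β θ ψ R k t z * (ENNReal.ofReal r ^ z * (ENNReal.ofReal b *
      (ENNReal.ofReal (ψ z) * ∫⁻ n, ENNReal.ofReal r ^ n ∂(vacationArrivals lam θ R z) +
        ENNReal.ofReal (1 - ψ z)))) =
      visits lam β θ ψ R k t z * ENNReal.ofReal (r ^ z * (b * g z)) := fun z => by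
    rw [lintegral_pow_eq_genFun _ hr, ← ENNReal.ofReal_mul (hψ0 z),
      ← ENNReal.ofReal_add (mul_nonneg (hψ0 z) (hgn z)) (sub_nonneg.2 (hψ1 z)),
      ← ENNReal.ofReal_mul hb0, ← ENNReal.ofReal_pow hr.1, ← ENNReal.ofReal_mul (hr0 z)]
    congr 2
    simp only [hg]
    ring_nf
  have hfA0 : ∀ z, 0 ≤ r ^ z * (b * g z) := fun z => mul_nonneg (hr0 z) (mul_nonneg hb0 (hg0 z))
  have hfA1 : ∀ z, r ^ z * (b * g z) ≤ 1 := fun z =>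
    mul_le_one₀ (hr1 z) (mul_nonneg hb0 (hg0 z)) (mul_le_one₀ hb1 (hg0 z) (hg1 z))
  dsimp only at h
  rw [← hb] at h
  simp only [hA] at h
  simp only [← ENNReal.ofReal_pow hr.1] at h
  rw [tsum_visits_mul_ofReal hlam hβ hψ hR0 k ht hfA0 hfA1,
    tsum_visits_mul_ofReal hlam hβ hψ hR0 k ht hr0 hr1] at h
  set A := ∑' z, (visits lam β θ ψ R k t z).toReal * (r ^ z * (b * g z)) with hAdef
  set B := ∑' z, (visits lam β θ ψ R k t z).toReal * r ^ z with hBdef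
  have hA0 : 0 ≤ A := tsum_nonneg fun z => mul_nonneg ENNReal.toReal_nonneg (hfA0 z)
  have hB0 : 0 ≤ B := tsum_nonneg fun z => mul_nonneg ENNReal.toReal_nonneg (hr0 z)
  obtain ⟨h1, h2⟩ := h
  rw [← ENNReal.ofReal_one, ← ENNReal.ofReal_add hB0 zero_le_one, ← ENNReal.ofReal_mul hr.1,
    ENNReal.ofReal_le_ofReal_iff (mul_nonneg hr.1 (by linarith))] at h1
  rw [← ENNReal.ofReal_one, ← ENNReal.ofReal_add hA0 zero_le_one, ← ENNReal.ofReal_mul hr.1,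
    ENNReal.ofReal_le_ofReal_iff (by linarith)] at h2
  have hsum : ∑' z, (visits lam β θ ψ R k t z).toReal * (r ^ z * (r - b * g z)) = r * B - A := by
    rw [hBdef, hAdef, ← tsum_mul_left, ← Summable.tsum_sub]
    · exact tsum_congr fun z => by ring
    · exact (summable_toReal_visits_mul hlam hβ hψ hR0 k ht fun z => by
        rw [abs_of_nonneg (hr0 z)]
        exact hr1 z).mul_left r
    · exact summable_toReal_visits_mul hlam hβ hψ hR0 k ht fun z => by
        rw [abs_of_nonneg (hfA0 z)]
        exact hfA1 z
  rw [hsum, abs_le]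
  constructor <;> nlinarith [hr.2]

/-- The time elapsed is at most the work brought in by the visits. -/
lemma mul_le_tsum_visits (hβi : Integrable (fun x => x) β) (hψ0 : ∀ z, 0 ≤ ψ z)
    (hψ1 : ∀ z, ψ z ≤ 1)
    (hi : ∀ z, Integrable (fun n : ℕ => (n : ℝ)) (vacationArrivals lam θ R z)) {C : ℝ}
    (hC : ∀ z, mean (vacationArrivals lam θ R z) ≤ C) :
    lam * t ≤ load lam β * (k + 1 + lam * t) + ∑' z, (visits lam β θ ψ R k t z).toReal *
      (ψ z * mean (vacationArrivals lam θ R z)) := by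
  have hl0 : 0 ≤ load lam β := mul_nonneg hlam.le (integral_nonneg_of_ae (by
      filter_upwards [ae_nonneg_of_measure_Iio β hβ] with x hx using hx))
  have hm0 : ∀ z, 0 ≤ ψ z * mean (vacationArrivals lam θ R z) := fun z =>
    mul_nonneg (hψ0 z) (mean_nonneg _)
  have hm1 : ∀ z, ψ z * mean (vacationArrivals lam θ R z) ≤ C := fun z =>
    (mul_le_of_le_one_left (mean_nonneg _) (hψ1 z)).trans (hC z)
  have h := le_tsum_visits_mul (β := β) (θ := θ) hlam hβ hβi hψ hψ0 hψ1 hR0 k ht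
  have h1 : ∀ z, visits lam β θ ψ R k t z * (ENNReal.ofReal (load lam β) +
      ENNReal.ofReal (ψ z) * ∫⁻ n, (n : ℝ≥0∞) ∂(vacationArrivals lam θ R z)) =
      visits lam β θ ψ R k t z *
        ENNReal.ofReal (load lam β + ψ z * mean (vacationArrivals lam θ R z)) := fun z => by
    rw [lintegral_natCast_eq_mean _ (hi z), ← ENNReal.ofReal_mul (hψ0 z),
      ← ENNReal.ofReal_add hl0 (hm0 z)]
  simp only [h1] at h
  rw [tsum_visits_mul_ofReal hlam hβ hψ hR0 k ht (fun z => add_nonneg hl0 (hm0 z))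
    (fun z => add_le_add_right (hm1 z) _), ENNReal.ofReal_le_ofReal_iff (tsum_nonneg fun z =>
      mul_nonneg ENNReal.toReal_nonneg (add_nonneg hl0 (hm0 z)))] at h
  refine h.trans ?_
  simp only [mul_add (visits lam β θ ψ R k t _).toReal]
  rw [Summable.tsum_add ((summable_toReal_visits hlam hβ hψ hR0 k ht).mul_right _)
    (summable_toReal_visits_mul hlam hβ hψ hR0 k ht fun z => by
      rw [abs_of_nonneg (hm0 z)]
      exact hm1 z), tsum_mul_right, mul_comm]
  exact add_le_add_left
    (mul_le_mul_of_nonneg_left (tsum_toReal_visits_le hlam hβ hψ hR0 k ht) hl0) _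

/-- Up to a bounded error, the visits to `j` are the expected time in `j`, times the arrival
rate. -/
lemma abs_visits_sub_le (j : ℕ) :
    |(visits lam β θ ψ R k t j).toReal - lam * ∫ s in (0 : ℝ)..t,
      (sampleLaw lam β θ).real {ω | customers ψ R k s ω = j}| ≤ 2 := by
  have hp := isProbabilityMeasure_sampleLaw hlam β θ
  have hm : Measurable fun s => sampleLaw lam β θ {ω | customers ψ R k s ω = j} :=
    measurable_measure_prodMk_left
      (s := {p : ℝ × Sample Θ | customers ψ R k p.1 p.2 = j})
      ((measurable_customers ψ R k) (measurableSet_singleton j))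
  have h1 : ∫⁻ s in Ioc 0 t, sampleLaw lam β θ {ω | customers ψ R k s ω = j} =
      ENNReal.ofReal (∫ s in (0 : ℝ)..t,
        (sampleLaw lam β θ).real {ω | customers ψ R k s ω = j}) := by
    rw [intervalIntegral.integral_of_le ht]
    simp only [measureReal_def]
    rw [integral_toReal hm.aemeasurable (ae_of_all _ fun s => measure_lt_top _ _),
      ENNReal.ofReal_toReal]
    refine ne_top_of_le_ne_top ?_ (lintegral_mono (g := fun _ => 1) fun s => prob_le_one)
    simp
  have hI0 : 0 ≤ ∫ s in (0 : ℝ)..t, (sampleLaw lam β θ).real {ω | customers ψ R k s ω = j} :=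
    intervalIntegral.integral_nonneg ht fun s _ => measureReal_nonneg
  obtain ⟨h2, h3⟩ := visits_level_crossing hlam β hβ θ hψ R hR0 k j ht
  set I := ∫ s in (0 : ℝ)..t, (sampleLaw lam β θ).real {ω | customers ψ R k s ω = j}
  have hV := visits_ne_top (β := β) (θ := θ) hlam hβ hψ hR0 k ht j
  rw [h1, ← ENNReal.ofReal_mul hlam.le] at h2 h3
  rw [← ENNReal.ofReal_toReal hV] at h2 h3
  set V := (visits lam β θ ψ R k t j).toReal
  have hV0 : 0 ≤ V := ENNReal.toReal_nonneg
  have hlI : 0 ≤ lam * I := mul_nonneg hlam.le hI0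
  rw [← ENNReal.ofReal_ofNat 2, ← ENNReal.ofReal_add hlI (by norm_num),
    ENNReal.ofReal_le_ofReal_iff (by positivity)] at h2
  rw [← ENNReal.ofReal_one, ← ENNReal.ofReal_add hV0 (by norm_num),
    ENNReal.ofReal_le_ofReal_iff (by positivity)] at h3
  rw [abs_le]
  constructor <;> linarith

end Visits

/-- Passage to the limit in an inequality `a ≤ ∑ x c` for weights `c` that vanish at infinity, so
that the part of the mass of `x` that escapes to infinity does not contribute. -/
lemma le_tsum_of_tendsto {ι : Type*} {l : Filter ι} [l.NeBot] {x : ι → ℕ → ℝ} {q c : ℕ → ℝ}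
    {a : ι → ℝ} {a₀ C : ℝ} (hx0 : ∀ᶠ i in l, ∀ z, 0 ≤ x i z) (hxs : ∀ᶠ i in l, Summable (x i))
    (hxC : ∀ᶠ i in l, ∑' z, x i z ≤ C) (hx : ∀ z, Tendsto (fun i => x i z) l (𝓝 (q z)))
    (hc0 : ∀ z, 0 ≤ c z) (hc : Tendsto c atTop (𝓝 0)) (hq0 : ∀ z, 0 ≤ q z)
    (hqc : Summable fun z => q z * c z) (ha : Tendsto a l (𝓝 a₀))
    (hax : ∀ᶠ i in l, a i ≤ ∑' z, x i z * c z) : a₀ ≤ ∑' z, q z * c z := by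
  have hC : 0 ≤ C := by
    obtain ⟨i, h1, h2⟩ := (hx0.and hxC).exists
    exact (tsum_nonneg h1).trans h2
  refine le_of_forall_pos_le_add fun ε hε => ?_
  set δ := ε / (C + 1) with hδ
  have hδ0 : 0 < δ := by positivity
  -- Beyond `N` the weights are at most `δ`, so the tail of the sum is at most `δ * C`.
  obtain ⟨N, hN⟩ := eventually_atTop.1 (hc.eventually_le_const hδ0)
  have h1 : ∀ᶠ i in l, a i ≤ ∑ z ∈ Finset.range N, x i z * c z + δ * C := by
    filter_upwards [hx0, hxs, hxC, hax] with i hi0 his hiC hia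
    have h2 : HasSum (fun z => (if z ∈ Finset.range N then x i z * c z else 0) + δ * x i z)
        (∑ z ∈ Finset.range N, x i z * c z + δ * ∑' z, x i z) := by
      refine HasSum.add ?_ (his.hasSum.mul_left δ)
      have h := hasSum_sum_of_ne_finset_zero (L := .unconditional ℕ) (s := Finset.range N)
        (f := fun z => if z ∈ Finset.range N then x i z * c z else 0) fun z hz => if_neg hz
      rwa [Finset.sum_congr rfl fun z hz => if_pos hz] at h
    have h3 : ∀ z, x i z * c z ≤ (if z ∈ Finset.range N then x i z * c z else 0) + δ * x i z := by
      intro z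
      split_ifs with hz
      · exact le_add_of_nonneg_right (mul_nonneg hδ0.le (hi0 z))
      · rw [zero_add, mul_comm]
        exact mul_le_mul_of_nonneg_right (hN z (by simpa using hz)) (hi0 z)
    have h4 : Summable fun z => x i z * c z :=
      Summable.of_nonneg_of_le (fun z => mul_nonneg (hi0 z) (hc0 z)) h3 h2.summable
    refine hia.trans ((h4.tsum_le_tsum h3 h2.summable).trans ?_)
    rw [h2.tsum_eq]
    exact add_le_add_right (mul_le_mul_of_nonneg_left hiC hδ0.le) _
  have h2 : a₀ ≤ ∑ z ∈ Finset.range N, q z * c z + δ * C :=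
    le_of_tendsto_of_tendsto ha
      ((tendsto_finsetSum _ fun z _ => (hx z).mul_const (c z)).add_const _) h1
  have h3 : ∑ z ∈ Finset.range N, q z * c z ≤ ∑' z, q z * c z :=
    hqc.sum_le_tsum _ fun z _ => mul_nonneg (hq0 z) (hc0 z)
  have h4 : δ * C ≤ ε := by
    rw [hδ, div_mul_eq_mul_div, div_le_iff₀ (by positivity)]
    nlinarith
  linarith

/-- The relations that hold for every limit point `q` of the expected fractions of time. The
total mass is only known to be at most `1` beforehand. -/
structure IsLimitLaw (lam : ℝ) (β : Measure ℝ) (X X₀ : Measure ℕ) (q : ℕ → ℝ) : Prop where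
  nonneg : ∀ z, 0 ≤ q z
  sum_le : ∀ s : Finset ℕ, ∑ z ∈ s, q z ≤ 1
  /-- The balance of the embedded transitions, divided by `lst β (lam * (1 - r)) - r`. -/
  balance : ∀ r ∈ Ioo (0 : ℝ) 1,
    powSum q r = Y lam β X r * (avgSum q r / r) + q 0 * K lam β X X₀ r
  /-- The cycles cover the time axis. -/
  mean_le : 1 - load lam β ≤ mean X * avgSum q 1 + q 0 * (mean X₀ - mean X)

section Limit

variable {lam : ℝ} (hlam : 0 < lam)
  {β : Measure ℝ} [IsProbabilityMeasure β] (hβ : β (Iio 0) = 0)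
  (hβ2 : Integrable (fun x => x ^ 2) β) (hρ : load lam β < 1) {θ : Measure Θ}
  [IsProbabilityMeasure θ] {R : VacationRule Θ}
  (hR0 : (vacationArrivals lam θ R 0).real {0} = 0)
  (hR2 : ∀ i, Integrable (fun m : ℕ => (m : ℝ) ^ 2) (vacationArrivals lam θ R i))
  {X : Measure ℕ} (hX : ∀ i, 1 ≤ i → vacationArrivals lam θ R i = X)

include hlam hβ hβ2 hρ hR0 hR2 hX

/-- Limits of the averages along any filter satisfy the limit relations. -/
lemma isLimitLaw_of_tendsto (k : ℕ) {l : Filter ℝ} [l.NeBot] (hl : l ≤ atTop) {q : ℕ → ℝ}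
    (hq : ∀ j, Tendsto (fun t : ℝ => (∫ s in (0 : ℝ)..t, (sampleLaw lam β θ).real
      {ω | customers (fun i => 1 / ((i : ℝ) + 1)) R k s ω = j}) / t) l (𝓝 (q j))) :
    IsLimitLaw lam β X (vacationArrivals lam θ R 0) q := by
  have hprob := isProbabilityMeasure_vacationArrivals hlam θ R
  have hXp : IsProbabilityMeasure X := hX 1 le_rfl ▸ hprob 1
  set ψ : ℕ → ℝ := fun i => 1 / ((i : ℝ) + 1) with hψdef
  have hψ : ψ 0 = 1 := by simp [hψdef]
  have hψ0 : ∀ z, 0 ≤ ψ z := fun z => by positivity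
  have hψ1 : ∀ z, ψ z ≤ 1 := fun z =>
    (div_le_one (by positivity)).2 (by linarith [(Nat.cast_nonneg z : (0 : ℝ) ≤ z)])
  set ξ := vacationArrivals lam θ R with hξ
  set V : ℝ → ℕ → ℝ := fun t z => (visits lam β θ ψ R k t z).toReal with hV
  -- The visit frequencies, scaled to total mass `1` in the limit, have the same limits as the
  -- averages.
  set x : ℝ → ℕ → ℝ := fun t z => (lam * t)⁻¹ * V t z with hxdef
  have hpos : ∀ᶠ t : ℝ in l, 0 < t := hl (eventually_gt_atTop 0)
  have hinv : Tendsto (fun t : ℝ => (lam * t)⁻¹) l (𝓝 0) :=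
    (tendsto_inv_atTop_zero.comp (tendsto_id.const_mul_atTop hlam)).mono_left hl
  have htot : Tendsto (fun t : ℝ => (lam * t)⁻¹ * (k + 1 + lam * t)) l (𝓝 1) := by
    have h := (hinv.mul_const ((k : ℝ) + 1)).add_const 1
    rw [zero_mul, zero_add] at h
    refine h.congr' ?_
    filter_upwards [hpos] with t ht
    have : lam * t ≠ 0 := by positivity
    field_simp
  have hx0 : ∀ᶠ t in l, ∀ z, 0 ≤ x t z := by
    filter_upwards [hpos] with t ht z
    exact mul_nonneg (by positivity) ENNReal.toReal_nonneg
  have hxs : ∀ᶠ t in l, Summable (x t) := by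
    filter_upwards [hpos] with t ht
    exact (summable_toReal_visits hlam hβ hψ hR0 k ht.le).mul_left _
  have hxle : ∀ᶠ t in l, ∑' z, x t z ≤ (lam * t)⁻¹ * (k + 1 + lam * t) := by
    filter_upwards [hpos] with t ht
    rw [hxdef, tsum_mul_left]
    exact mul_le_mul_of_nonneg_left (tsum_toReal_visits_le hlam hβ hψ hR0 k ht.le) (by positivity)
  have hxC : ∀ᶠ t in l, ∑' z, x t z ≤ 2 := by
    filter_upwards [hxle, htot.eventually_le_const one_lt_two] with t h1 h2
    exact h1.trans h2
  have hx : ∀ z, Tendsto (fun t => x t z) l (𝓝 (q z)) := by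
    intro j
    have h1 : Tendsto (fun t => x t j - (∫ s in (0 : ℝ)..t, (sampleLaw lam β θ).real
        {ω | customers ψ R k s ω = j}) / t) l (𝓝 0) := by
      have h2 := hinv.mul_const 2
      rw [zero_mul] at h2
      refine squeeze_zero_norm' ?_ h2
      filter_upwards [hpos] with t ht
      have h3 := abs_visits_sub_le (β := β) (θ := θ) hlam hβ hψ hR0 k ht.le j
      have h4 : x t j - (∫ s in (0 : ℝ)..t, (sampleLaw lam β θ).real
          {ω | customers ψ R k s ω = j}) / t = (lam * t)⁻¹ * (V t j - lam * ∫ s in (0 : ℝ)..t,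
          (sampleLaw lam β θ).real {ω | customers ψ R k s ω = j}) := by
        simp only [hxdef]
        field_simp
      rw [h4, norm_mul, Real.norm_eq_abs, Real.norm_eq_abs, abs_of_nonneg (by positivity)]
      exact mul_le_mul_of_nonneg_left h3 (by positivity)
    simpa using h1.add (hq j)
  have hq0 : ∀ z, 0 ≤ q z := fun z =>
    ge_of_tendsto (hx z) (hx0.mono fun t h => h z)
  have hqsum : ∀ s : Finset ℕ, ∑ z ∈ s, q z ≤ 1 := fun s => by
    refine le_of_tendsto_of_tendsto (tendsto_finsetSum s fun z _ => hx z) htot ?_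
    filter_upwards [hx0, hxs, hxle] with t h0 h1 h2
    exact (h1.sum_le_tsum s fun z _ => h0 z).trans h2
  have hqs : Summable fun z => |q z| := by
    simp only [abs_of_nonneg (hq0 _)]
    exact summable_of_sum_le hq0 hqsum
  refine ⟨hq0, hqsum, fun r hr => ?_, ?_⟩
  · have hr' : r ∈ Icc (0 : ℝ) 1 := ⟨hr.1.le, hr.2.le⟩
    set b := lst β (lam * (1 - r)) with hb
    have hbI := lst_mem_Icc β hβ (s := lam * (1 - r)) (mul_nonneg hlam.le (by linarith [hr.2]))
    set f : ℕ → ℝ := fun z => r ^ z * (r - b * (1 - ψ z * (1 - genFun (ξ z) r))) with hf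
    have hfle : ∀ z, |f z| ≤ r ^ z := fun z => by
      have hg := one_sub_mul_genFun_mem_Icc (ξ z) ⟨hψ0 z, hψ1 z⟩ hr'
      have h1 := mul_nonneg hbI.1 hg.1
      have h2 := mul_le_one₀ hbI.2 hg.1 hg.2
      rw [hf, abs_mul, abs_of_nonneg (pow_nonneg hr.1.le z)]
      refine mul_le_of_le_one_right (pow_nonneg hr.1.le z) (abs_le.2 ⟨?_, ?_⟩) <;>
        linarith [hr.1, hr.2]
    -- The factor `r ^ z` with `r < 1` dominates, whatever mass escapes to infinity.
    have h1 : Tendsto (fun t => ∑' z, x t z * f z) l (𝓝 (∑' z, q z * f z)) := by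
      refine tendsto_tsum_of_dominated_convergence (bound := fun z => 2 * r ^ z)
        ((summable_geometric_of_lt_one hr.1.le hr.2).mul_left 2)
        (fun z => (hx z).mul_const (f z)) ?_
      filter_upwards [hx0, hxs, hxC] with t h0 h1 h2 z
      rw [norm_mul, Real.norm_eq_abs, Real.norm_eq_abs, abs_of_nonneg (h0 z)]
      exact mul_le_mul ((h1.le_tsum z fun z _ => h0 z).trans h2) (hfle z) (abs_nonneg _) two_pos.le
    have h2 : Tendsto (fun t => ∑' z, x t z * f z) l (𝓝 0) := by
      have h3 := hinv.mul_const 1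
      rw [zero_mul] at h3
      refine squeeze_zero_norm' ?_ h3
      filter_upwards [hpos] with t ht
      have h4 := abs_tsum_visits_balance (β := β) (θ := θ) hlam hβ hψ hR0 k ht.le hψ0 hψ1 hr'
      simp only [hxdef, mul_assoc]
      rw [tsum_mul_left, norm_mul, Real.norm_eq_abs, Real.norm_eq_abs,
        abs_of_nonneg (by positivity)]
      exact mul_le_mul_of_nonneg_left h4 (by positivity)
    have h3 := tendsto_nhds_unique h1 h2
    -- The law of `X` replaces that of `X₀` in the term with `z = 0`; the last summand corrects this.
    have h4 : HasSum (fun z => q z * f z) ((r - b) * powSum q r +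
        b * (1 - genFun X r) / r * avgSum q r +
        b * q 0 * (genFun X r - genFun (ξ 0) r)) := by
      have h5 := (((summable_mul_of_abs_le_one hqs (abs_pow_le_one_of_mem hr')).hasSum.mul_left
        (r - b)).add ((summable_mul_of_abs_le_one hqs
          (abs_pow_succ_div_le_one hr')).hasSum.mul_left (b * (1 - genFun X r) / r))).add
        (hasSum_ite_eq 0 (b * q 0 * (genFun X r - genFun (ξ 0) r)))
      refine (congrArg (fun g : ℕ → ℝ => HasSum g _) (funext fun z => ?_)).mpr h5
      have hr0 := hr.1.ne'
      rcases Nat.eq_zero_or_pos z with rfl | hz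
      · simp only [hf, hψdef, if_true]
        field_simp
        push_cast
        ring
      · simp only [hf, hψdef, if_neg hz.ne', hX z hz]
        field_simp
        ring
    rw [h4.tsum_eq] at h3
    have h5 := lst_sub_pos β hβ hlam hβ2 hρ hr.2
    rw [← hb] at h5
    rw [Y, K, if_neg hr.2.ne, if_neg hr.2.ne, ← hb]
    have := hr.1.ne'
    field_simp at h3 ⊢
    linarith
  · have hmX := mean_nonneg X
    have h4 : HasSum (fun z => q z * (ψ z * mean (ξ z)))
        (mean X * avgSum q 1 + q 0 * (mean (ξ 0) - mean X)) := by
      have h5 := ((summable_mul_of_abs_le_one hqs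
          (abs_pow_succ_div_le_one (r := 1) (by simp))).hasSum.mul_left (mean X)).add
        (hasSum_ite_eq 0 (q 0 * (mean (ξ 0) - mean X)))
      refine (congrArg (fun g : ℕ → ℝ => HasSum g _) (funext fun z => ?_)).mpr h5
      rcases Nat.eq_zero_or_pos z with rfl | hz
      · simp only [hψdef, if_true]
        push_cast
        ring
      · simp only [hψdef, if_neg hz.ne', hX z hz]
        ring
    rw [← h4.tsum_eq]
    have ha : Tendsto (fun t : ℝ => 1 - load lam β * ((lam * t)⁻¹ * (k + 1 + lam * t))) l
        (𝓝 (1 - load lam β)) := by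
      simpa using (htot.const_mul (load lam β)).const_sub 1
    refine le_tsum_of_tendsto hx0 hxs hxC hx (fun z => mul_nonneg (hψ0 z) (mean_nonneg _)) ?_ hq0
      h4.summable ha ?_
    · have h5 := (tendsto_one_div_add_atTop_nhds_zero_nat (𝕜 := ℝ)).mul_const (mean X)
      rw [zero_mul] at h5
      refine h5.congr' ?_
      filter_upwards [eventually_ge_atTop 1] with z hz
      rw [hX z hz]
    · filter_upwards [hpos] with t ht
      have hC : ∀ z, mean (ξ z) ≤ max (mean (ξ 0)) (mean X) := fun z => by
        rcases Nat.eq_zero_or_pos z with rfl | hz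
        · exact le_max_left _ _
        · rw [hX z hz]
          exact le_max_right _ _
      have h6 := mul_le_tsum_visits (β := β) (θ := θ) hlam hβ hψ hR0 k ht.le
        (integrable_id_of_sq β hβ2) hψ0 hψ1 (fun z => integrable_natCast _ (hR2 z)) hC
      simp only [hxdef, mul_assoc]
      rw [tsum_mul_left, sub_le_iff_le_add]
      have hlt : 0 < lam * t := mul_pos hlam ht
      have h7 := mul_le_mul_of_nonneg_left h6 (inv_pos.2 hlt).le
      rw [inv_mul_cancel₀ hlt.ne'] at h7
      refine h7.trans (le_of_eq ?_)
      simp only [hV, hξ]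
      ring

end Limit

/-! ### Solution of the limit relations -/

section Solution

variable {lam : ℝ} (hlam : 0 < lam) {β : Measure ℝ} [IsProbabilityMeasure β]
  (hβ : β (Iio 0) = 0) (hβ2 : Integrable (fun x => x ^ 2) β) (hρ : load lam β < 1)
  {X X₀ : Measure ℕ} [IsProbabilityMeasure X] [IsProbabilityMeasure X₀]
  (hX : Integrable (fun n : ℕ => (n : ℝ) ^ 2) X)
  (hX₀ : Integrable (fun n : ℕ => (n : ℝ) ^ 2) X₀)

omit [IsProbabilityMeasure β] [IsProbabilityMeasure X] in
lemma K_self (r : ℝ) : K lam β X X r = 0 := by simp [K]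

omit [IsProbabilityMeasure β] [IsProbabilityMeasure X] in
lemma α_one : α lam β X 1 = 0 := intervalIntegral.integral_same

include hlam hβ hβ2 hρ

omit [IsProbabilityMeasure X] in
lemma Y_zero : Y lam β X 0 = 1 - X.real {0} := by
  have h : 0 < lst β (lam * (1 - 0)) := by
    simpa only [sub_zero] using lst_sub_pos β hβ hlam hβ2 hρ (r := 0) one_pos
  rw [Y, if_neg zero_ne_one, genFun_zero, sub_zero (lst β _), mul_div_cancel_left₀ _ h.ne']

namespace IsLimitLaw

variable {q : ℕ → ℝ} (h : IsLimitLaw lam β X X₀ q)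

include h

omit hlam [IsProbabilityMeasure β] hβ hβ2 hρ [IsProbabilityMeasure X]
  [IsProbabilityMeasure X₀] in
lemma summable : Summable q := summable_of_sum_le h.nonneg h.sum_le

omit hlam [IsProbabilityMeasure β] hβ hβ2 hρ [IsProbabilityMeasure X]
  [IsProbabilityMeasure X₀] in
lemma summable_abs : Summable fun z => |q z| := by
  simpa only [abs_of_nonneg (h.nonneg _)] using h.summable

include hX hX₀

lemma balance_of_mem_Ioc {r : ℝ} (hr : r ∈ Ioc (0 : ℝ) 1) :
    powSum q r = Y lam β X r * (avgSum q r / r) + q 0 * K lam β X X₀ r := by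
  rcases hr.2.lt_or_eq with hr1 | rfl
  · exact h.balance r ⟨hr.1, hr1⟩
  have hY := continuousOn_Y β hβ hlam hβ2 hρ X hX
  have hK := continuousOn_K β hβ hlam hβ2 hρ X X₀ hX hX₀
  have hone : (1 : ℝ) ∈ Icc (0 : ℝ) 1 := by simp
  have hc : ContinuousWithinAt
      (fun r => Y lam β X r * (avgSum q r / r) + q 0 * K lam β X X₀ r) (Icc 0 1) 1 :=
    ((hY 1 hone).mul ((continuousOn_avgSum h.summable_abs 1 hone).div continuousWithinAt_id
      one_ne_zero)).add (continuousWithinAt_const.mul (hK 1 hone))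
  have hne : (𝓝[Ioo (0 : ℝ) 1] 1).NeBot := by
    rw [nhdsWithin_Ioo_eq_nhdsLT one_pos]
    infer_instance
  refine tendsto_nhds_unique
    ((continuousOn_powSum h.summable_abs 1 hone).mono_left
      (nhdsWithin_mono 1 Ioo_subset_Icc_self))
    ((hc.tendsto.mono_left (nhdsWithin_mono 1 Ioo_subset_Icc_self)).congr' ?_)
  filter_upwards [self_mem_nhdsWithin] with r hr using (h.balance r hr).symm

/-- No mass escapes: the balance relation at `1` expresses the total mass by the means, and the
inequality for the means bounds it below by `1`. -/
lemma powSum_one : powSum q 1 = 1 := by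
  refine le_antisymm ?_ ?_
  · simp only [powSum, one_pow, mul_one]
    exact h.summable.tsum_le_of_sum_le h.sum_le
  · rw [h.balance_of_mem_Ioc hlam hβ hβ2 hρ hX hX₀ ⟨one_pos, le_rfl⟩, Y, K, if_pos rfl, if_pos rfl]
    have h1 : 0 < 1 - load lam β := sub_pos.2 hρ
    have h2 : mean X / (1 - load lam β) * (avgSum q 1 / 1) +
        q 0 * ((mean X₀ - mean X) / (1 - load lam β)) =
        (mean X * avgSum q 1 + q 0 * (mean X₀ - mean X)) / (1 - load lam β) := by ring
    rw [h2, one_le_div h1]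
    exact h.mean_le

omit h hX₀ [IsProbabilityMeasure X₀] in
/-- The generating function when all vacations have the same law. -/
lemma powSum_eq_of_eq (h : IsLimitLaw lam β X X q) {r : ℝ} (hr : r ∈ Ioc (0 : ℝ) 1) :
    powSum q r = (1 - load lam β) * Y lam β X r / (r * mean X) * Real.exp (-α lam β X r) := by
  have hY := continuousOn_Y β hβ hlam hβ2 hρ X hX
  have hK := continuousOn_K β hβ hlam hβ2 hρ X X hX hX
  have h1 := avgSum_mul_exp_sub hY hK h.summable_abs h.balance hr.1 hr.2 le_rfl
  simp only [K_self, zero_mul, intervalIntegral.integral_zero, mul_zero,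
    intervalIntegral.integral_same, Real.exp_zero, mul_one] at h1
  have h2 := h.balance_of_mem_Ioc hlam hβ hβ2 hρ hX hX ⟨one_pos, le_rfl⟩
  rw [h.powSum_one hlam hβ hβ2 hρ hX hX, K_self, Y, if_pos rfl, mul_zero, add_zero, div_one] at h2
  have hρ' : 1 - load lam β ≠ 0 := (sub_pos.2 hρ).ne'
  have hm : mean X ≠ 0 := fun h0 => by simp [h0] at h2
  have h3 : avgSum q r = (1 - load lam β) / mean X * Real.exp (-α lam β X r) := by
    have h4 : avgSum q 1 = (1 - load lam β) / mean X := by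
      field_simp at h2 ⊢
      linarith
    have h5 : avgSum q r * Real.exp (α lam β X r) = (1 - load lam β) / mean X := by
      rw [← h4]
      exact (sub_eq_zero.1 h1).symm
    rw [← h5, mul_assoc, ← Real.exp_add, add_neg_cancel, Real.exp_zero, mul_one]
  rw [h.balance_of_mem_Ioc hlam hβ hβ2 hρ hX hX hr, K_self, h3]
  have := hr.1.ne'
  field_simp
  ring

/-- The generating function, up to the mass at `0`, when a vacation may see no arrival. -/
lemma powSum_eq_of_pos (hX0 : 0 < X.real {0}) {r : ℝ} (hr : r ∈ Ioc (0 : ℝ) 1) :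
    powSum q r = q 0 * (K lam β X X₀ r + Y lam β X r / r * Real.exp (-α lam β X r) *
      ∫ y in (0 : ℝ)..r, K lam β X X₀ y * Real.exp (α lam β X y)) := by
  have hY := continuousOn_Y β hβ hlam hβ2 hρ X hX
  have hK := continuousOn_K β hβ hlam hβ2 hρ X X₀ hX hX₀
  have hY0 : Y lam β X 0 < 1 := by
    rw [Y_zero hlam hβ hβ2 hρ]
    linarith
  have h1 : avgSum q r * Real.exp (α lam β X r) =
      q 0 * ∫ y in (0 : ℝ)..r, K lam β X X₀ y * Real.exp (α lam β X y) :=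
    avgSum_mul_exp_eq hY hK hY0 h.summable_abs h.balance hr
  have h2 : avgSum q r = (q 0 * ∫ y in (0 : ℝ)..r, K lam β X X₀ y * Real.exp (α lam β X y)) *
      Real.exp (-α lam β X r) := by
    rw [← h1, mul_assoc, ← Real.exp_add, add_neg_cancel, Real.exp_zero, mul_one]
  rw [h.balance_of_mem_Ioc hlam hβ hβ2 hρ hX hX₀ hr, h2]
  ring

/-- The mass at `0`, from the normalization. -/
lemma apply_zero_of_pos (hX0 : 0 < X.real {0}) :
    q 0 = 1 / (K lam β X X₀ 1 + Y lam β X 1 *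
      ∫ x in (0 : ℝ)..1, K lam β X X₀ x * Real.exp (α lam β X x)) := by
  have h1 := h.powSum_eq_of_pos hlam hβ hβ2 hρ hX hX₀ hX0 (r := 1) ⟨one_pos, le_rfl⟩
  rw [h.powSum_one hlam hβ hβ2 hρ hX hX₀, α_one, neg_zero, Real.exp_zero, div_one, mul_one] at h1
  exact eq_one_div_of_mul_eq_one_left h1.symm

lemma eq_of_isLimitLaw (hcase : X₀ = X ∨ 0 < X.real {0}) {q' : ℕ → ℝ}
    (h' : IsLimitLaw lam β X X₀ q') : q = q' := by
  have key : ∀ r ∈ Ioo (0 : ℝ) 1, powSum q r = powSum q' r := fun r hr => by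
    have hr' : r ∈ Ioc (0 : ℝ) 1 := ⟨hr.1, hr.2.le⟩
    rcases hcase with rfl | hpos
    · rw [h.powSum_eq_of_eq hlam hβ hβ2 hρ hX hr', h'.powSum_eq_of_eq hlam hβ hβ2 hρ hX hr']
    · rw [h.powSum_eq_of_pos hlam hβ hβ2 hρ hX hX₀ hpos hr',
        h'.powSum_eq_of_pos hlam hβ hβ2 hρ hX hX₀ hpos hr',
        h.apply_zero_of_pos hlam hβ hβ2 hρ hX hX₀ hpos,
        h'.apply_zero_of_pos hlam hβ hβ2 hρ hX hX₀ hpos]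
  have hs : Summable fun z => |(q - q') z| := (h.summable.sub h'.summable).abs
  funext n
  refine sub_eq_zero.1 (eq_zero_of_powSum_eq_zero hs (fun r hr => ?_) n)
  have hr' : r ∈ Icc (0 : ℝ) 1 := ⟨hr.1.le, hr.2.le⟩
  have h1 := (summable_mul_of_abs_le_one h.summable_abs (abs_pow_le_one_of_mem hr')).tsum_sub
    (summable_mul_of_abs_le_one h'.summable_abs (abs_pow_le_one_of_mem hr'))
  rw [powSum]
  simp only [Pi.sub_apply, sub_mul]
  rw [h1]
  exact sub_eq_zero.2 (key r hr)

/-- A limit law as a probability measure. -/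
lemma exists_measure : ∃ π : Measure ℕ, IsProbabilityMeasure π ∧ (∀ j, π.real {j} = q j) ∧
    ∀ r ∈ Icc (0 : ℝ) 1, genFun π r = powSum q r := by
  have h1 : HasSum q 1 := by
    have h2 := h.powSum_one hlam hβ hβ2 hρ hX hX₀
    simp only [powSum, one_pow, mul_one] at h2
    exact h2 ▸ h.summable.hasSum
  have h2 : HasSum (fun z => ENNReal.ofReal (q z)) 1 := by
    have h3 := ENNReal.ofReal_tsum_of_nonneg h.nonneg h.summable
    rw [h1.tsum_eq, ENNReal.ofReal_one] at h3
    exact h3 ▸ ENNReal.summable.hasSum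
  set p : PMF ℕ := ⟨_, h2⟩ with hp
  have hpa : ∀ z, p z = ENNReal.ofReal (q z) := fun z => rfl
  refine ⟨p.toMeasure, inferInstance, fun j => ?_, fun r hr => ?_⟩
  · rw [measureReal_def, PMF.toMeasure_apply_singleton _ _ (measurableSet_singleton j), hpa,
      ENNReal.toReal_ofReal (h.nonneg j)]
  · rw [genFun, PMF.integral_eq_tsum _ _ (integrable_pow _ hr), powSum]
    refine tsum_congr fun z => ?_
    rw [hpa, ENNReal.toReal_ofReal (h.nonneg z), smul_eq_mul]

end IsLimitLaw

end Solution

/-! ### The stationary law -/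

lemma exists_ultrafilter_limit {p : ℝ → ℕ → ℝ} {U : Ultrafilter ℝ}
    (hp : ∀ j, ∀ᶠ t in U, p t j ∈ Icc (0 : ℝ) 1) :
    ∃ q : ℕ → ℝ, ∀ j, Tendsto (fun t => p t j) U (𝓝 (q j)) := by
  have h : ∀ j, ∃ a, Tendsto (fun t => p t j) U (𝓝 a) := fun j => by
    obtain ⟨a, -, ha⟩ := isCompact_Icc.ultrafilter_le_nhds (U.map fun t => p t j)
      (le_principal_iff.2 (hp j))
    exact ⟨a, ha⟩
  choose q hq using h
  exact ⟨q, hq⟩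

section Stationary

variable {lam : ℝ} (hlam : 0 < lam)
  {β : Measure ℝ} [IsProbabilityMeasure β] (hβ : β (Iio 0) = 0)
  (hβ2 : Integrable (fun x => x ^ 2) β) (hρ : load lam β < 1) {θ : Measure Θ}
  [IsProbabilityMeasure θ] {R : VacationRule Θ}
  (hR0 : (vacationArrivals lam θ R 0).real {0} = 0)
  (hR2 : ∀ i, Integrable (fun m : ℕ => (m : ℝ) ^ 2) (vacationArrivals lam θ R i))
  {X : Measure ℕ} (hX : ∀ i, 1 ≤ i → vacationArrivals lam θ R i = X)
  (hcase : vacationArrivals lam θ R 0 = X ∨ 0 < X.real {0})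

include hlam in
lemma average_mem_Icc (ψ : ℕ → ℝ) (k j : ℕ) {t : ℝ} (ht : 0 < t) :
    (∫ s in (0 : ℝ)..t, (sampleLaw lam β θ).real {ω | customers ψ R k s ω = j}) / t ∈
      Icc (0 : ℝ) 1 := by
  have hp := isProbabilityMeasure_sampleLaw hlam β θ
  refine ⟨div_nonneg (intervalIntegral.integral_nonneg ht.le fun s _ => measureReal_nonneg) ht.le,
    (div_le_one ht).2 ?_⟩
  have h := intervalIntegral.norm_integral_le_of_norm_le_const (a := 0) (b := t) (C := 1)
    (f := fun s => (sampleLaw lam β θ).real {ω | customers ψ R k s ω = j}) fun s _ => by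
      rw [Real.norm_eq_abs, abs_of_nonneg measureReal_nonneg]
      exact measureReal_le_one
  rw [sub_zero, one_mul, abs_of_pos ht] at h
  exact (le_abs_self _).trans h

include hlam hβ hβ2 hρ hR0 hR2 hX hcase

/-- The expected fractions of time converge, to the only solution of the limit relations. -/
lemma exists_isLimitLaw_tendsto : ∃ q : ℕ → ℝ,
    IsLimitLaw lam β X (vacationArrivals lam θ R 0) q ∧ ∀ k j,
      Tendsto (fun t : ℝ => (∫ s in (0 : ℝ)..t, (sampleLaw lam β θ).real
        {ω | customers (fun i => 1 / ((i : ℝ) + 1)) R k s ω = j}) / t) atTop (𝓝 (q j)) := by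
  have hprob := isProbabilityMeasure_vacationArrivals hlam θ R
  have hXp : IsProbabilityMeasure X := hX 1 le_rfl ▸ hprob 1
  have hX2 : Integrable (fun m : ℕ => (m : ℝ) ^ 2) X := hX 1 le_rfl ▸ hR2 1
  have key : ∀ (k : ℕ) (U : Ultrafilter ℝ), (U : Filter ℝ) ≤ atTop → ∃ q : ℕ → ℝ,
      IsLimitLaw lam β X (vacationArrivals lam θ R 0) q ∧ ∀ j,
        Tendsto (fun t : ℝ => (∫ s in (0 : ℝ)..t, (sampleLaw lam β θ).real
          {ω | customers (fun i => 1 / ((i : ℝ) + 1)) R k s ω = j}) / t) U (𝓝 (q j)) := by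
    intro k U hU
    obtain ⟨q, hq⟩ := exists_ultrafilter_limit (U := U) fun j =>
      (Eventually.filter_mono hU (eventually_gt_atTop 0)).mono fun t ht =>
        average_mem_Icc (β := β) (θ := θ) (R := R) hlam (fun i => 1 / ((i : ℝ) + 1)) k j ht
    exact ⟨q, isLimitLaw_of_tendsto hlam hβ hβ2 hρ hR0 hR2 hX k hU hq, hq⟩
  obtain ⟨q, hq, -⟩ := key 0 (Ultrafilter.of atTop) (Ultrafilter.of_le _)
  refine ⟨q, hq, fun k j => (tendsto_iff_ultrafilter _ _ _).2 fun U hU => ?_⟩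
  obtain ⟨q', hq', h⟩ := key k U hU
  rw [hq.eq_of_isLimitLaw hlam hβ hβ2 hρ hX2 (hR2 0) hcase hq']
  exact h j

end Stationary

end VacQueue

end

theorem mainTheorem6 {Θ : Type*} [MeasurableSpace Θ] (lam : ℝ) (hlam : 0 < lam)
    (β : Measure ℝ) [IsProbabilityMeasure β] (hβ : β (Set.Iio 0) = 0)
    (hβ2 : Integrable (fun x => x ^ 2) β) (hρ : VacQueue.load lam β < 1)
    (θ : Measure Θ) [IsProbabilityMeasure θ] (R : VacQueue.VacationRule Θ)
    (hR0 : (VacQueue.vacationArrivals lam θ R 0).real {0} = 0)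
    (hR2 : ∀ i, Integrable (fun m : ℕ => (m : ℝ) ^ 2) (VacQueue.vacationArrivals lam θ R i))
    (X X₀ : Measure ℕ) (hX₀ : X₀ = VacQueue.vacationArrivals lam θ R 0)
    (hX : VacQueue.EqualVacations (VacQueue.vacationArrivals lam θ R) X) :
    ∃ π : Measure ℕ,
      VacQueue.IsStationaryLaw lam β θ (fun i => 1 / ((i : ℝ) + 1)) R π ∧
      (∀ r ∈ Set.Ioc (0 : ℝ) 1,
        IntervalIntegrable (fun x => VacQueue.Y lam β X x / x) volume r 1) ∧
      (X₀ = X →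
        (∀ r ∈ Set.Ioc (0 : ℝ) 1, VacQueue.genFun π r =
          (1 - VacQueue.load lam β) * VacQueue.Y lam β X r / (r * VacQueue.mean X)
            * Real.exp (-VacQueue.α lam β X r)) ∧
        Tendsto (fun r => (1 - VacQueue.load lam β) * VacQueue.Y lam β X r / (r * VacQueue.mean X)
            * Real.exp (-VacQueue.α lam β X r)) (𝓝[>] 0) (𝓝 (VacQueue.genFun π 0))) ∧
      (VacQueue.StStrictlyLarger X₀ X →
        IntervalIntegrable
          (fun x => VacQueue.K lam β X X₀ x * Real.exp (VacQueue.α lam β X x)) volume 0 1 ∧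
        π.real {0} = 1 / (VacQueue.K lam β X X₀ 1 + VacQueue.Y lam β X 1 *
          ∫ x in (0 : ℝ)..1, VacQueue.K lam β X X₀ x * Real.exp (VacQueue.α lam β X x)) ∧
        (∀ r ∈ Set.Ioc (0 : ℝ) 1, VacQueue.genFun π r =
          π.real {0} * (VacQueue.K lam β X X₀ r + VacQueue.Y lam β X r / r
            * Real.exp (-VacQueue.α lam β X r) *
            ∫ y in (0 : ℝ)..r, VacQueue.K lam β X X₀ y * Real.exp (VacQueue.α lam β X y))) ∧
        Tendsto (fun r =>
          π.real {0} * (VacQueue.K lam β X X₀ r + VacQueue.Y lam β X r / r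
            * Real.exp (-VacQueue.α lam β X r) *
            ∫ y in (0 : ℝ)..r, VacQueue.K lam β X X₀ y * Real.exp (VacQueue.α lam β X y)))
          (𝓝[>] 0) (𝓝 (VacQueue.genFun π 0))) := by
  have hprob := VacQueue.isProbabilityMeasure_vacationArrivals hlam θ R
  obtain ⟨hX1, -, hcases⟩ := hX
  subst hX₀
  have hXp : IsProbabilityMeasure X := hX1 1 le_rfl ▸ hprob 1
  have hX2 : Integrable (fun m : ℕ => (m : ℝ) ^ 2) X := hX1 1 le_rfl ▸ hR2 1
  have hY := VacQueue.continuousOn_Y β hβ hlam hβ2 hρ X hX2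
  have hK := VacQueue.continuousOn_K β hβ hlam hβ2 hρ X _ hX2 (hR2 0)
  obtain ⟨q, hq, hlim⟩ := VacQueue.exists_isLimitLaw_tendsto hlam hβ hβ2 hρ hR0 hR2 hX1
    (hcases.imp And.left And.right)
  obtain ⟨π, hπ, hπq, hgen⟩ := hq.exists_measure hlam hβ hβ2 hρ hX2 (hR2 0)
  have hlim0 : ∀ F : ℝ → ℝ, (∀ r ∈ Set.Ioc (0 : ℝ) 1, VacQueue.genFun π r = F r) →
      Tendsto F (𝓝[>] 0) (𝓝 (VacQueue.genFun π 0)) := fun F hF => by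
    have h1 := (VacQueue.continuousOn_genFun π 0 (by simp)).mono_left
      (nhdsWithin_mono 0 (Set.Ioo_subset_Icc_self (a := (0 : ℝ)) (b := 1)))
    rw [nhdsWithin_Ioo_eq_nhdsGT one_pos] at h1
    refine h1.congr' ?_
    filter_upwards [Ioc_mem_nhdsGT one_pos] with r hr using hF r hr
  refine ⟨π, ⟨hπ, fun k j => by rw [hπq]; exact hlim k j⟩, fun r hr =>
    VacQueue.intervalIntegrable_div_id hY hr ⟨one_pos, le_rfl⟩, fun hXX => ?_, fun hst => ?_⟩
  · have hF : ∀ r ∈ Set.Ioc (0 : ℝ) 1, VacQueue.genFun π r =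
        (1 - VacQueue.load lam β) * VacQueue.Y lam β X r / (r * VacQueue.mean X)
          * Real.exp (-VacQueue.α lam β X r) := fun r hr => by
      rw [hXX] at hq
      rw [hgen r ⟨hr.1.le, hr.2⟩]
      exact VacQueue.IsLimitLaw.powSum_eq_of_eq hlam hβ hβ2 hρ hX2 hq hr
    exact ⟨hF, hlim0 _ hF⟩
  · have hX0 : 0 < X.real {0} := by
      rcases hcases with h | h
      · obtain ⟨w, hw⟩ := hst.2
        rw [h.1] at hw
        exact absurd hw (lt_irrefl _)
      · exact h.2
    have hY0 : VacQueue.Y lam β X 0 < 1 := by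
      rw [VacQueue.Y_zero hlam hβ hβ2 hρ]
      linarith
    have hF : ∀ r ∈ Set.Ioc (0 : ℝ) 1, VacQueue.genFun π r = π.real {0} *
        (VacQueue.K lam β X (VacQueue.vacationArrivals lam θ R 0) r + VacQueue.Y lam β X r / r
          * Real.exp (-VacQueue.α lam β X r) * ∫ y in (0 : ℝ)..r,
            VacQueue.K lam β X (VacQueue.vacationArrivals lam θ R 0) y *
              Real.exp (VacQueue.α lam β X y)) := fun r hr => by
      rw [hgen r ⟨hr.1.le, hr.2⟩, hπq]
      exact hq.powSum_eq_of_pos hlam hβ hβ2 hρ hX2 (hR2 0) hX0 hr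
    refine ⟨VacQueue.intervalIntegrable_mul_exp hY hK hY0, ?_, hF, hlim0 _ hF⟩
    rw [hπq]
    exact hq.apply_zero_of_pos hlam hβ hβ2 hρ hX2 (hR2 0) hX0
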